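/- Let $\varphi:[0,\infty)\to[0,\infty)$ be an Orlicz function, i.e. $\varphi$ is non-decreasing and convex with $\varphi(0)=0$ and $\varphi(1)=1$. Let $I$ be a countable (finite or infinite) index set, let $\ell_\varphi$ be the real space of all $x=(x_i)_{i\in I}$ such that $\sum_i\varphi(|x_i|/\lambda)<\infty$ for some $\lambda>0$, and let $e_i$, $i\in I$, be its unit vectors. Equip $\ell_\varphi$ with either the Luxemburg norm $$\|x\|_\varphi=\inf\Big\{\lambda>0:\sum_i\varphi(|x_i|/\lambda)\le1\Big\}$$ or the Orlicz norm $$\|x\|_{\varphi,O}=\sup\Big\{\sum_i x_iy_i:\sum_i\varphi^*(|y_i|)\le1\Big\},\qquad \varphi^*(u)=\sup\{tu-\varphi(t):0<t<\infty\}\quad(u\ge0).$$ If $I$ is finite and the norm is the Orlicz norm, assume that $\varphi^*$ is finite-valued. Assume that the unit vectors form a basis of $\ell_\varphi$, i.e. that their linear span is dense (this is automatic if $I$ is finite). Suppose that $\varphi$ is not equivalent to $t^p$ for any $1\le p\le\infty$; that is, $\varphi(t)>0$ for all $t>0$ (the case $p=\infty$), and for no $p\in[1,\infty)$ are there $C_1,C_2,t_0>0$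 with $C_1t^p\le\varphi(t)\le C_2t^p$ for all $0\le t<t_0$. Let $n\ge 0$ be an integer and let $F\subset\ell_\varphi$ be a linear subspace of codimension $n$ with $\dim F>1$ that contains at least one unit vector $e_i$. Then $F$ is 1-complemented in $\ell_\varphi$ (i.e. $F$ is the range of a linear projection of norm one on $\ell_\varphi$) if and only if $F$ is the closed linear span of a block basis with constant coefficients of a permutation of the unit vector basis, i.e. of a family of nonzero finitely supported vectors with pairwise disjoint supports such that, for each of these vectors $b$, $|b_i|=|b_j|$ for all $i,j\in\operatorname{supp} b$. -/

import Mathlib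

open scoped ENNReal

noncomputable section

/-- Orlicz functions `φ : [0, ∞) → [0, ∞)`: non-decreasing, convex, `φ 0 = 0`, `φ 1 = 1`.
Such a function is represented by a function on `ℝ` whose values on negative numbers are
never used. -/
structure OrliczFunction where
  toFun : ℝ → ℝ
  monotoneOn : MonotoneOn toFun (Set.Ici 0)
  convexOn : ConvexOn ℝ (Set.Ici 0) toFun
  map_zero : toFun 0 = 0
  map_one : toFun 1 = 1

instance : CoeFun OrliczFunction (fun _ => ℝ → ℝ) := ⟨OrliczFunction.toFun⟩

namespace OrliczFunction

/-- The complementary function in the sense of Young,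
`φ* u = sup {t u - φ t : 0 < t < ∞}` for `u ≥ 0`, with values in `[0, ∞]`.
(The supremum is nonnegative, because `t u - φ t → 0` as `t → 0`; so nothing changes when
negative members of the set are replaced by `0`.) -/
def conj (φ : OrliczFunction) (u : ℝ) : ℝ≥0∞ :=
  ⨆ t : Set.Ioi (0 : ℝ), ENNReal.ofReal (t * u - φ t)

/-- The power `t ^ p` for `1 ≤ p ≤ ∞` and `t ≥ 0` near `0`; here `t ^ ∞ = 0` for `t < 1`. -/
def tPow (p : ℝ≥0∞) (t : ℝ) : ℝ := if p = ∞ then 0 else t ^ p.toReal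

/-- `φ` is equivalent to `t ^ p`: there are `C₁, C₂, t₀ > 0` with
`C₁ t ^ p ≤ φ t ≤ C₂ t ^ p` for all `t < t₀`.
For `p = ∞` this says that `φ` vanishes in a neighbourhood of `0`. -/
def EquivalentToPow (φ : OrliczFunction) (p : ℝ≥0∞) : Prop :=
  ∃ C₁ > 0, ∃ C₂ > 0, ∃ t₀ > 0, ∀ t : ℝ, 0 ≤ t → t < t₀ →
    C₁ * tPow p t ≤ φ t ∧ φ t ≤ C₂ * tPow p t

/-- The modular `∑ φ (|x i|)`, with values in `[0, ∞]`. -/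
def modular (φ : OrliczFunction) {ι : Type*} (x : ι → ℝ) : ℝ≥0∞ :=
  ∑' i, ENNReal.ofReal (φ |x i|)

/-- The modular of the complementary function. -/
def conjModular (φ : OrliczFunction) {ι : Type*} (y : ι → ℝ) : ℝ≥0∞ :=
  ∑' i, φ.conj |y i|

theorem mono (φ : OrliczFunction) {s t : ℝ} (hs : 0 ≤ s) (h : s ≤ t) : φ s ≤ φ t :=
  φ.monotoneOn hs (hs.trans h) h

theorem nonneg (φ : OrliczFunction) {t : ℝ} (ht : 0 ≤ t) : 0 ≤ φ t := by
  have := φ.mono le_rfl ht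
  rwa [φ.map_zero] at this

theorem modular_add_le (φ : OrliczFunction) {ι : Type*} (x y : ι → ℝ) {a b : ℝ}
    (ha : 0 < a) (hb : 0 < b) :
    φ.modular ((a + b)⁻¹ • (x + y)) ≤ φ.modular (a⁻¹ • x) + φ.modular (b⁻¹ • y) := by
  unfold modular
  rw [← ENNReal.tsum_add]
  refine ENNReal.tsum_le_tsum fun i => ?_
  have hx : 0 ≤ |(a⁻¹ • x) i| := abs_nonneg _
  have hy : 0 ≤ |(b⁻¹ • y) i| := abs_nonneg _
  rw [← ENNReal.ofReal_add (φ.nonneg hx) (φ.nonneg hy)]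
  refine ENNReal.ofReal_le_ofReal ?_
  have hab : 0 < a + b := add_pos ha hb
  have h1 : |((a + b)⁻¹ • (x + y)) i| ≤
      (a / (a + b)) • |(a⁻¹ • x) i| + (b / (a + b)) • |(b⁻¹ • y) i| := by
    have e : ((a + b)⁻¹ • (x + y)) i =
        (a / (a + b)) * (a⁻¹ • x) i + (b / (a + b)) * (b⁻¹ • y) i := by
      simp only [Pi.smul_apply, Pi.add_apply, smul_eq_mul]
      field_simp
    rw [e]
    refine (abs_add_le _ _).trans (le_of_eq ?_)
    rw [abs_mul, abs_mul, abs_of_pos (div_pos ha hab), abs_of_pos (div_pos hb hab)]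
    rfl
  refine (φ.mono (abs_nonneg _) h1).trans ?_
  have hc := φ.convexOn.2 (x := |(a⁻¹ • x) i|) (y := |(b⁻¹ • y) i|) hx hy
    (div_pos ha hab).le (div_pos hb hab).le (by field_simp)
  refine hc.trans ?_
  simp only [smul_eq_mul]
  have ha1 : a / (a + b) ≤ 1 := by rw [div_le_one hab]; linarith
  have hb1 : b / (a + b) ≤ 1 := by rw [div_le_one hab]; linarith
  exact add_le_add (mul_le_of_le_one_left (φ.nonneg hx) ha1)
    (mul_le_of_le_one_left (φ.nonneg hy) hb1)

/-- The Orlicz space `ℓ_φ` over the index set `ι`: all `x : ι → ℝ` such that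
`∑ φ (|x i| / s) < ∞` for some `s > 0`. -/
def space (φ : OrliczFunction) (ι : Type*) : Submodule ℝ (ι → ℝ) where
  carrier := {x | ∃ s : ℝ, 0 < s ∧ φ.modular (s⁻¹ • x) < ∞}
  zero_mem' := ⟨1, one_pos, by simp [modular, φ.map_zero]⟩
  add_mem' := by
    rintro x y ⟨a, ha, hx⟩ ⟨b, hb, hy⟩
    exact ⟨a + b, add_pos ha hb,
      (φ.modular_add_le x y ha hb).trans_lt (ENNReal.add_lt_top.2 ⟨hx, hy⟩)⟩
  smul_mem' := by
    rintro c x ⟨a, ha, hx⟩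
    refine ⟨a * (|c| + 1), by positivity, lt_of_le_of_lt ?_ hx⟩
    refine ENNReal.tsum_le_tsum fun i => ENNReal.ofReal_le_ofReal ?_
    refine φ.mono (abs_nonneg _) ?_
    have hc : (0 : ℝ) < |c| + 1 := by positivity
    simp only [Pi.smul_apply, smul_eq_mul, abs_mul, abs_inv, abs_of_pos ha, abs_of_pos hc]
    have h2 : (|c| + 1)⁻¹ * |c| ≤ 1 := by
      rw [inv_mul_le_one₀ hc]; linarith
    calc (a * (|c| + 1))⁻¹ * (|c| * |x i|) = (a⁻¹ * |x i|) * ((|c| + 1)⁻¹ * |c|) := by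
          rw [mul_inv]; ring
      _ ≤ a⁻¹ * |x i| := mul_le_of_le_one_right (by positivity) h2

open Classical in
/-- The unit vector `e_i` of `ℓ_φ`. -/
def unitVec (φ : OrliczFunction) {ι : Type*} (i : ι) : φ.space ι :=
  ⟨Pi.single i 1, 1, one_pos, by
    unfold modular
    rw [tsum_eq_single i]
    · exact ENNReal.ofReal_lt_top
    · intro j hj
      simp [hj, φ.map_zero]⟩

/-- The Luxemburg norm `inf {s > 0 : ∑ φ (|x i| / s) ≤ 1}` on `ℓ_φ`. -/
def luxemburgNorm (φ : OrliczFunction) {ι : Type*} (x : φ.space ι) : ℝ :=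
  sInf {s : ℝ | 0 < s ∧ φ.modular (s⁻¹ • (x : ι → ℝ)) ≤ 1}

/-- The Orlicz norm `sup {∑ x i * y i : ∑ φ* (|y i|) ≤ 1}` on `ℓ_φ`. (All these series
converge absolutely and the set is bounded, by Young's inequality.) -/
def orliczNorm (φ : OrliczFunction) {ι : Type*} (x : φ.space ι) : ℝ :=
  sSup {r : ℝ | ∃ y : ι → ℝ, φ.conjModular y ≤ 1 ∧ r = ∑' i, (x : ι → ℝ) i * y i}

/-- The closed linear span of `B ⊆ ℓ_φ` with respect to the norm `N`. -/
def closedSpan {φ : OrliczFunction} {ι : Type*} (N : φ.space ι → ℝ) (B : Set (φ.space ι)) :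
    Set (φ.space ι) :=
  {x | ∀ ε : ℝ, 0 < ε → ∃ y ∈ Submodule.span ℝ B, N (x - y) < ε}

/-- A nonzero subspace `F` of `(ℓ_φ, N)` is 1-complemented: it is the range of a linear
projection which does not increase the norm `N` (so that it has operator norm one). -/
def IsOneComplemented {φ : OrliczFunction} {ι : Type*} (N : φ.space ι → ℝ)
    (F : Submodule ℝ (φ.space ι)) : Prop :=
  ∃ P : φ.space ι →ₗ[ℝ] φ.space ι,
    P ∘ₗ P = P ∧ LinearMap.range P = F ∧ ∀ x, N (P x) ≤ N x

/-- `B` is (the set of members of) a block basis with constant coefficients of a permutation of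
the unit vector basis: nonzero, finitely supported vectors with pairwise disjoint supports, such
that the coefficients of each of them have the same absolute value on its support. -/
def IsConstCoeffBlockBasis {φ : OrliczFunction} {ι : Type*} (B : Set (φ.space ι)) : Prop :=
  (∀ b ∈ B, b ≠ 0 ∧ (Function.support (b : ι → ℝ)).Finite ∧
    ∀ i ∈ Function.support (b : ι → ℝ), ∀ j ∈ Function.support (b : ι → ℝ),
      |(b : ι → ℝ) i| = |(b : ι → ℝ) j|) ∧
  B.Pairwise fun b c =>
    Disjoint (Function.support (b : ι → ℝ)) (Function.support (c : ι → ℝ))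

end OrliczFunction

end

open scoped ENNReal
open Filter Topology

noncomputable section

/-! Sufficiency. If each block has constant modulus on its support, the orthogonal projection onto
the blocks has a symmetric matrix with absolute row sums at most one. By Jensen's inequality such a
matrix decreases the modulars of `φ` and of `φ*`, hence both norms
(`SymmSubstochastic.tsum_gauge_le`, `isOneComplemented_of_isConstCoeffBlockBasis`).

Necessity. Let `P` be a contractive projection onto `F`. Adding to `f` a suitable vector of `F`
disjoint from it (a multiple of the given unit vector, or a far away vector) turns the norm
inequality into one for the modular `M`: `M f ≤ M (f + z)` for small finitely supported `f ∈ F`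
vanishing at the given coordinate and all `z ∈ ker P` (`modular_le_modular_add`). Although `φ` need
not be differentiable, the integral of `M (t f + s z)` over `t ∈ [0, 1]` is differentiable at its
minimum `s = 0`, and this gives `∑ z_j q(f_j) = 0` with `q t = φ |t| / t`
(`sum_mul_oddQuot_eq_zero`).

For a suitable finite set `J` of coordinates, the vectors of `F` supported in `J` and the
restrictions of `ker P` to `J` are complementary subspaces `V`, `W` of `ℝ^J` linked by this
relation. Group the coordinates into classes that are proportional on `V`. The relation becomes a
functional equation `∑ β_d S_d(d f) = 0` over the classes. Taking differences eliminates all terms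
but one, and a local form of Fréchet's theorem makes `S_d` a polynomial near `0` if `β_d ≠ 0`; then
`q` is comparable to a power, which is excluded. So `V` contains the restriction of its generic
vector to each class (`block_mem`). Two different moduli within one class would give `q(r t) = κ
q(t)`, again a power (`abs_le_abs_of_relCoord_eq`). Finally a count shows that at most `2n` unit
vectors lie outside `F`, so one finite `J` accounts for all of `F` (`finite_setOf_unitVec_notMem`).
-/

theorem ENNReal.le_add_of_one_add_add_le {a b c η : ℝ≥0∞} (hc : c ≠ ∞)
    (h : 1 + (c + a) ≤ 1 + (c + b) + η) :
    a ≤ b + η := by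
  have h' : (1 + c) + a ≤ (1 + c) + (b + η) := by
    rw [← add_assoc, ← add_assoc] at *
    simpa [add_assoc] using h
  exact (ENNReal.add_le_add_iff_left (by simp [hc])).1 h'

/-! ### Convexity: subgradients, the conjugate function, Jensen's inequality. -/

namespace OrliczFunction

variable (φ : OrliczFunction)

theorem convexOn_abs : ConvexOn ℝ Set.univ fun x : ℝ => φ |x| := by
  refine ⟨convex_univ, fun x _ y _ a b ha hb hab => ?_⟩
  refine (φ.mono (abs_nonneg _) ?_).trans
    (φ.convexOn.2 (abs_nonneg x : |x| ∈ Set.Ici (0 : ℝ)) (abs_nonneg y) ha hb hab)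
  simp only [smul_eq_mul]
  refine (abs_add_le _ _).trans_eq ?_
  rw [abs_mul, abs_mul, abs_of_nonneg ha, abs_of_nonneg hb]

theorem continuous_abs : Continuous fun x : ℝ => φ |x| := by
  have h := φ.convexOn_abs.continuousOn isOpen_univ
  rwa [continuousOn_univ] at h

/-- `φ t / t` is non-decreasing. -/
theorem mul_map_le {s t : ℝ} (hs : 0 ≤ s) (hst : s ≤ t) : t * φ s ≤ s * φ t := by
  rcases hs.eq_or_lt with rfl | hs'
  · simp [φ.map_zero]
  have ht := hs'.trans_le hst
  have h := φ.convexOn.2 (x := t) (y := 0) ht.le (le_refl (0 : ℝ))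
    (div_nonneg hs ht.le) (sub_nonneg.2 ((div_le_one ht).2 hst)) (by ring)
  simp only [smul_eq_mul, mul_zero, add_zero, φ.map_zero] at h
  rw [div_mul_cancel₀ _ ht.ne'] at h
  calc t * φ s ≤ t * (s / t * φ t) := by gcongr
    _ = s * φ t := by field_simp

theorem map_mul_le {a t : ℝ} (ha : 0 ≤ a) (ha1 : a ≤ 1) (ht : 0 ≤ t) : φ (a * t) ≤ a * φ t := by
  have h := φ.convexOn.2 (x := t) (y := 0) ht (le_refl (0 : ℝ)) ha (sub_nonneg.2 ha1) (by ring)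
  simpa [φ.map_zero] using h

theorem self_le_map {t : ℝ} (ht : 1 ≤ t) : t ≤ φ t := by
  simpa [φ.map_one] using φ.mul_map_le zero_le_one ht

theorem map_le_self {t : ℝ} (h0 : 0 ≤ t) (ht : t ≤ 1) : φ t ≤ t := by
  simpa [φ.map_one] using φ.mul_map_le h0 ht

theorem le_one_of_map_le_one {t : ℝ} (h : φ t ≤ 1) : t ≤ 1 := by
  by_contra! ht
  exact absurd ((φ.self_le_map ht.le).trans h) ht.not_ge

theorem exists_subgradient {t : ℝ} (ht : 0 ≤ t) :
    ∃ p : ℝ, 0 ≤ p ∧ ∀ s, 0 ≤ s → φ t + p * (s - t) ≤ φ s := by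
  rcases ht.eq_or_lt with rfl | ht'
  · exact ⟨0, le_rfl, fun s hs => by simpa [φ.map_zero] using φ.nonneg hs⟩
  have hi : t ∈ interior (Set.Ici (0 : ℝ)) := by simpa using ht'
  refine ⟨derivWithin φ (Set.Ioi t) t, ?_, fun s hs => ?_⟩
  · have h1 := φ.convexOn.leftDeriv_le_rightDeriv_of_mem_interior hi
    have h2 := φ.convexOn.slope_le_leftDeriv_of_mem_interior (Set.mem_Ici.2 le_rfl) hi ht'
    refine le_trans ?_ (h2.trans h1)
    simp only [slope_def_field, φ.map_zero, sub_zero]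
    exact div_nonneg (φ.nonneg ht) ht
  · rcases lt_trichotomy s t with h | rfl | h
    · have h1 := φ.convexOn.leftDeriv_le_rightDeriv_of_mem_interior hi
      have h2 := φ.convexOn.slope_le_leftDeriv_of_mem_interior hs hi h
      have h3 := h2.trans h1
      rw [slope_def_field, div_le_iff₀ (by linarith)] at h3
      linarith
    · simp
    · have h1 := φ.convexOn.rightDeriv_le_slope_of_mem_interior hi hs h
      rw [slope_def_field, le_div_iff₀ (by linarith)] at h1
      linarith

/-- A nonnegative subgradient of `φ` at `t ≥ 0`. -/
def subgrad (t : ℝ) : ℝ := if ht : 0 ≤ t then (φ.exists_subgradient ht).choose else 0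

theorem subgrad_nonneg (t : ℝ) : 0 ≤ φ.subgrad t := by
  unfold subgrad
  split_ifs with ht
  · exact (φ.exists_subgradient ht).choose_spec.1
  · exact le_rfl

theorem map_add_subgrad_le {s t : ℝ} (ht : 0 ≤ t) (hs : 0 ≤ s) :
    φ t + φ.subgrad t * (s - t) ≤ φ s := by
  unfold subgrad
  rw [dif_pos ht]
  exact (φ.exists_subgradient ht).choose_spec.2 s hs

theorem map_le_mul_subgrad {t : ℝ} (ht : 0 ≤ t) : φ t ≤ t * φ.subgrad t := by
  have := φ.map_add_subgrad_le ht le_rfl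
  rw [φ.map_zero] at this
  linarith

theorem mul_subgrad_le {t : ℝ} (ht : 0 ≤ t) : t * φ.subgrad t ≤ φ (2 * t) := by
  have := φ.map_add_subgrad_le ht (by positivity : 0 ≤ 2 * t)
  have := φ.nonneg ht
  linarith

theorem subgrad_le {t : ℝ} (ht : 0 ≤ t) : φ.subgrad t ≤ φ (t + 1) := by
  have := φ.map_add_subgrad_le ht (by positivity : 0 ≤ t + 1)
  have := φ.nonneg ht
  linarith

/-- Young's inequality. -/
theorem ofReal_mul_le (t u : ℝ) (ht : 0 ≤ t) :
    ENNReal.ofReal (t * u) ≤ ENNReal.ofReal (φ t) + φ.conj u := by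
  rcases ht.eq_or_lt with rfl | ht
  · simp
  have h : ENNReal.ofReal (t * u - φ t) ≤ φ.conj u :=
    le_iSup (fun t : Set.Ioi (0 : ℝ) => ENNReal.ofReal (t * u - φ t)) ⟨t, ht⟩
  calc ENNReal.ofReal (t * u) = ENNReal.ofReal (φ t + (t * u - φ t)) := by ring_nf
    _ ≤ ENNReal.ofReal (φ t) + ENNReal.ofReal (t * u - φ t) := ENNReal.ofReal_add_le
    _ ≤ _ := by gcongr

theorem conj_mono {u v : ℝ} (h : u ≤ v) : φ.conj u ≤ φ.conj v := by
  refine iSup_mono fun t => ENNReal.ofReal_le_ofReal ?_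
  have ht : (0 : ℝ) < t := t.2
  nlinarith

theorem conj_zero : φ.conj 0 = 0 := by
  refine le_antisymm (iSup_le fun t => ?_) bot_le
  have ht : (0 : ℝ) < t := t.2
  simp [φ.nonneg ht.le]

theorem conj_one_le : φ.conj 1 ≤ 1 := by
  refine iSup_le fun t => ?_
  have ht : (0 : ℝ) < t := t.2
  rw [ENNReal.ofReal_le_one]
  rcases le_total (t : ℝ) 1 with h | h
  · have := φ.nonneg ht.le
    linarith
  · have := φ.self_le_map h
    linarith

/-- Young's inequality is an equality at a subgradient; this is the half that is not Young's
inequality. -/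
theorem conj_subgrad_le {t : ℝ} (ht : 0 ≤ t) :
    φ.conj (φ.subgrad t) ≤ ENNReal.ofReal (t * φ.subgrad t - φ t) := by
  refine iSup_le fun s => ENNReal.ofReal_le_ofReal ?_
  have := φ.map_add_subgrad_le ht (le_of_lt (show (0 : ℝ) < s from s.2))
  linarith

/-- `φ*` is convex; the weights may have total mass less than one. -/
theorem conj_sum_le {κ : Type*} (s : Finset κ) (w y : κ → ℝ) (hw : ∀ j ∈ s, 0 ≤ w j)
    (h1 : ∑ j ∈ s, w j ≤ 1) :
    φ.conj (∑ j ∈ s, w j * y j) ≤ ∑ j ∈ s, ENNReal.ofReal (w j) * φ.conj (y j) := by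
  refine iSup_le fun t => ?_
  have ht : (0 : ℝ) < t := t.2
  have e : (t : ℝ) * (∑ j ∈ s, w j * y j) - φ t ≤ ∑ j ∈ s, w j * (t * y j - φ t) := by
    simp only [mul_sub, Finset.sum_sub_distrib, ← Finset.sum_mul]
    have : (∑ j ∈ s, w j) * φ t ≤ φ t := mul_le_of_le_one_left (φ.nonneg ht.le) h1
    have h2 : (t : ℝ) * (∑ j ∈ s, w j * y j) = ∑ j ∈ s, w j * (t * y j) := by
      rw [Finset.mul_sum]
      exact Finset.sum_congr rfl fun j _ => by ring
    linarith
  refine (ENNReal.ofReal_le_ofReal e).trans ?_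
  calc ENNReal.ofReal (∑ j ∈ s, w j * (t * y j - φ t))
      ≤ ENNReal.ofReal (∑ j ∈ s, w j * max (t * y j - φ t) 0) := by
        refine ENNReal.ofReal_le_ofReal (Finset.sum_le_sum fun j hj => ?_)
        exact mul_le_mul_of_nonneg_left (le_max_left _ _) (hw j hj)
    _ = ∑ j ∈ s, ENNReal.ofReal (w j * max (t * y j - φ t) 0) :=
        ENNReal.ofReal_sum_of_nonneg fun j hj => mul_nonneg (hw j hj) (le_max_right _ _)
    _ ≤ ∑ j ∈ s, ENNReal.ofReal (w j) * φ.conj (y j) := by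
        refine Finset.sum_le_sum fun j hj => ?_
        rw [ENNReal.ofReal_mul (hw j hj)]
        gcongr
        have : ENNReal.ofReal (max (t * y j - φ t) 0) = ENNReal.ofReal (t * y j - φ t) := by
          simp [ENNReal.ofReal_max]
        rw [this]
        exact le_iSup (fun t : Set.Ioi (0 : ℝ) => ENNReal.ofReal (t * y j - φ t)) t

/-- Jensen's inequality for `φ`; the weights may have total mass less than one. -/
theorem map_sum_le {κ : Type*} (s : Finset κ) (w y : κ → ℝ) (hw : ∀ j ∈ s, 0 ≤ w j)
    (hy : ∀ j ∈ s, 0 ≤ y j) (h1 : ∑ j ∈ s, w j ≤ 1) :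
    φ (∑ j ∈ s, w j * y j) ≤ ∑ j ∈ s, w j * φ (y j) := by
  set T := ∑ j ∈ s, w j * y j with hT
  have hT0 : 0 ≤ T := Finset.sum_nonneg fun j hj => mul_nonneg (hw j hj) (hy j hj)
  -- Average the supporting line at `T`. Missing mass `1 - ∑ w` is multiplied by `T * φ.subgrad T -
  -- φ T ≥ 0`, so it does no harm.
  have h : ∑ j ∈ s, w j * (φ T + φ.subgrad T * (y j - T)) ≤ ∑ j ∈ s, w j * φ (y j) :=
    Finset.sum_le_sum fun j hj =>
      mul_le_mul_of_nonneg_left (φ.map_add_subgrad_le hT0 (hy j hj)) (hw j hj)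
  have e : ∑ j ∈ s, w j * (φ T + φ.subgrad T * (y j - T)) =
      φ T + (1 - ∑ j ∈ s, w j) * (T * φ.subgrad T - φ T) := by
    have : ∀ j ∈ s, w j * (φ T + φ.subgrad T * (y j - T)) =
        w j * (φ T - φ.subgrad T * T) + φ.subgrad T * (w j * y j) := fun j _ => by ring
    rw [Finset.sum_congr rfl this, Finset.sum_add_distrib, ← Finset.sum_mul, ← Finset.mul_sum,
      ← hT]
    ring
  rw [e] at h
  have := mul_nonneg (sub_nonneg.2 h1) (sub_nonneg.2 (φ.map_le_mul_subgrad hT0))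
  linarith


/-! ### The quotient `φ t / t` near zero. -/

theorem pos_of_not_equivalentToPow_top (h : ¬ φ.EquivalentToPow ∞) {t : ℝ} (ht : 0 < t) :
    0 < φ t := by
  by_contra! h0
  refine h ⟨1, one_pos, 1, one_pos, t, ht, fun s hs hst => ?_⟩
  have : φ s = 0 := le_antisymm ((φ.mono hs hst.le).trans h0) (φ.nonneg hs)
  simp [tPow, this]

/-- The quotient `φ t / t` is non-decreasing. If it did not tend to `0` at `0`, it would be bounded
below by a positive constant, and `φ t ≤ t` on `[0, 1]` would make `φ` equivalent to `t`. -/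
theorem exists_map_le_mul (h : ¬ φ.EquivalentToPow 1) {ε : ℝ} (hε : 0 < ε) :
    ∃ δ > 0, ∀ t, 0 ≤ t → t ≤ δ → φ t ≤ ε * t := by
  by_contra! hc
  refine h ⟨ε, hε, 1, one_pos, 1, one_pos, fun t ht ht1 => ?_⟩
  have e : tPow 1 t = t := by simp [tPow]
  rw [e]
  refine ⟨?_, by simpa using φ.map_le_self ht ht1.le⟩
  rcases ht.eq_or_lt with rfl | ht'
  · simp [φ.map_zero]
  obtain ⟨s, hs, hst, hlt⟩ := hc t ht'
  have h1 := φ.mul_map_le hs hst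
  have hs0 : 0 < s := by
    rcases hs.eq_or_lt with rfl | h
    · simp [φ.map_zero] at hlt
    · exact h
  have : s * (ε * t) ≤ s * φ t := by nlinarith
  exact le_of_mul_le_mul_left this hs0

theorem equivalentToPow_of_quotient {k : ℝ} (hk : 0 ≤ k) {c C t₀ : ℝ} (hc : 0 < c) (hC : 0 < C)
    (ht₀ : 0 < t₀)
    (h : ∀ t, 0 < t → t < t₀ → c * t ^ k ≤ φ t / t ∧ φ t / t ≤ C * t ^ k) :
    φ.EquivalentToPow (ENNReal.ofReal (k + 1)) := by
  refine ⟨c, hc, C, hC, t₀, ht₀, fun t ht htt => ?_⟩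
  have e : tPow (ENNReal.ofReal (k + 1)) t = t ^ (k + 1) := by
    simp [tPow, ENNReal.toReal_ofReal (by linarith : 0 ≤ k + 1)]
  rw [e]
  rcases ht.eq_or_lt with rfl | ht'
  · rw [Real.zero_rpow (by linarith)]
    simp [φ.map_zero]
  obtain ⟨h1, h2⟩ := h t ht' htt
  rw [le_div_iff₀ ht'] at h1
  rw [div_le_iff₀ ht'] at h2
  rw [Real.rpow_add_one ht'.ne', ← mul_assoc, ← mul_assoc]
  exact ⟨h1, h2⟩

/-- The odd function `φ |t| / t`. -/
def oddQuot (t : ℝ) : ℝ := φ |t| / t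

theorem oddQuot_zero : φ.oddQuot 0 = 0 := by simp [oddQuot]

theorem oddQuot_neg (t : ℝ) : φ.oddQuot (-t) = -φ.oddQuot t := by simp [oddQuot, div_neg]

theorem oddQuot_of_pos {t : ℝ} (ht : 0 < t) : φ.oddQuot t = φ t / t := by
  simp [oddQuot, abs_of_pos ht]

theorem oddQuot_mono {s t : ℝ} (hs : 0 ≤ s) (hst : s ≤ t) : φ.oddQuot s ≤ φ.oddQuot t := by
  rcases hs.eq_or_lt with rfl | hs'
  · rw [oddQuot_zero, oddQuot, abs_of_nonneg hst]
    exact div_nonneg (φ.nonneg hst) hst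
  have ht := hs'.trans_le hst
  rw [φ.oddQuot_of_pos hs', φ.oddQuot_of_pos ht, div_le_div_iff₀ hs' ht]
  have := φ.mul_map_le hs hst
  linarith

theorem oddQuot_pos (h : ¬ φ.EquivalentToPow ∞) {t : ℝ} (ht : 0 < t) : 0 < φ.oddQuot t := by
  rw [φ.oddQuot_of_pos ht]
  exact div_pos (φ.pos_of_not_equivalentToPow_top h ht) ht

theorem continuous_oddQuot (h : ¬ φ.EquivalentToPow 1) : Continuous φ.oddQuot := by
  rw [continuous_iff_continuousAt]
  intro x
  rcases eq_or_ne x 0 with rfl | hx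
  · rw [Metric.continuousAt_iff]
    intro ε hε
    obtain ⟨δ, hδ, hd⟩ := φ.exists_map_le_mul h (half_pos hε)
    refine ⟨δ, hδ, fun {t} ht => ?_⟩
    rw [Real.dist_eq, sub_zero] at ht
    rw [Real.dist_eq, oddQuot_zero, sub_zero, oddQuot, abs_div,
      abs_of_nonneg (φ.nonneg (abs_nonneg t))]
    rcases eq_or_ne t 0 with rfl | ht0
    · simpa using hε
    rw [div_lt_iff₀ (abs_pos.2 ht0)]
    have h1 := hd |t| (abs_nonneg t) ht.le
    have := abs_pos.2 ht0
    nlinarith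
  · exact φ.continuous_abs.continuousAt.div continuousAt_id hx

end OrliczFunction

/-! ### Symmetric substochastic matrices contract both norms. -/

theorem summable_of_tsum_ofReal_abs_ne_top {κ : Type*} {f : κ → ℝ}
    (h : ∑' i, ENNReal.ofReal |f i| ≠ ∞) : Summable f := by
  have := ENNReal.summable_toReal h
  simp only [ENNReal.toReal_ofReal (abs_nonneg _)] at this
  exact this.of_abs

theorem ofReal_tsum_le_tsum_ofReal_abs {κ : Type*} {f : κ → ℝ} (h : Summable f) :
    ENNReal.ofReal (∑' i, f i) ≤ ∑' i, ENNReal.ofReal |f i| := by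
  rw [← ENNReal.ofReal_tsum_of_nonneg (fun i => abs_nonneg _) h.abs]
  exact ENNReal.ofReal_le_ofReal (h.tsum_le_tsum (fun i => le_abs_self _) h.abs)

/-- Symmetric matrices with finitely supported rows whose absolute row sums are at most one. -/
structure SymmSubstochastic {ι : Type*} (A : ι → ι → ℝ) : Prop where
  symm : ∀ i j, A i j = A j i
  finite : ∀ i, (Function.support (A i)).Finite
  sum_le : ∀ i, ∑ j ∈ (finite i).toFinset, |A i j| ≤ 1

namespace SymmSubstochastic

variable {ι : Type*} {A : ι → ι → ℝ} (hA : SymmSubstochastic A)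
include hA

theorem tsum_ofReal_abs_le (i : ι) : ∑' j, ENNReal.ofReal |A i j| ≤ 1 := by
  rw [tsum_eq_sum (s := (hA.finite i).toFinset),
    ← ENNReal.ofReal_sum_of_nonneg fun _ _ => abs_nonneg _]
  · exact ENNReal.ofReal_le_one.2 (hA.sum_le i)
  · intro j hj
    simpa using hj

/-- After the sums are interchanged, symmetry turns the bound on row sums into one on column sums.
-/
theorem tsum_tsum_mul_le (θ : ι → ℝ≥0∞) :
    ∑' i, ∑' j, ENNReal.ofReal |A i j| * θ j ≤ ∑' j, θ j := by
  rw [ENNReal.tsum_comm]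
  refine ENNReal.tsum_le_tsum fun j => ?_
  rw [ENNReal.tsum_mul_right]
  simp only [hA.symm _ j]
  exact mul_le_of_le_one_left zero_le (hA.tsum_ofReal_abs_le j)

theorem sum_mul_eq_tsum (x : ι → ℝ) (i : ι) :
    ∑ j ∈ (hA.finite i).toFinset, A i j * x j = ∑' j, A i j * x j := by
  rw [tsum_eq_sum]
  intro j hj
  have : A i j = 0 := by simpa using hj
  rw [this, zero_mul]

/-- A convex gauge is decreased by `A`. -/
theorem tsum_gauge_le (Θ : ℝ → ℝ≥0∞)
    (hΘ : ∀ (s : Finset ι) (w y : ι → ℝ), (∑ j ∈ s, |w j|) ≤ 1 →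
      Θ |∑ j ∈ s, w j * y j| ≤ ∑ j ∈ s, ENNReal.ofReal |w j| * Θ |y j|) (x : ι → ℝ) :
    ∑' i, Θ |∑ j ∈ (hA.finite i).toFinset, A i j * x j| ≤ ∑' j, Θ |x j| := by
  refine le_trans (ENNReal.tsum_le_tsum fun i => ?_) (hA.tsum_tsum_mul_le fun j => Θ |x j|)
  exact (hΘ _ _ _ (hA.sum_le i)).trans (ENNReal.sum_le_tsum _)

end SymmSubstochastic

namespace OrliczFunction

variable (φ : OrliczFunction) {ι : Type*}

theorem abs_sum_mul_le (s : Finset ι) (w y : ι → ℝ) :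
    |∑ j ∈ s, w j * y j| ≤ ∑ j ∈ s, |w j| * |y j| :=
  (Finset.abs_sum_le_sum_abs _ _).trans (by simp [abs_mul])

theorem ofReal_map_abs_sum_le (s : Finset ι) (w y : ι → ℝ) (hw : ∑ j ∈ s, |w j| ≤ 1) :
    ENNReal.ofReal (φ |∑ j ∈ s, w j * y j|) ≤
      ∑ j ∈ s, ENNReal.ofReal |w j| * ENNReal.ofReal (φ |y j|) := by
  have h := (φ.mono (abs_nonneg _) (abs_sum_mul_le s w y)).trans
    (φ.map_sum_le s (fun j => |w j|) (fun j => |y j|) (fun _ _ => abs_nonneg _)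
      (fun _ _ => abs_nonneg _) hw)
  refine (ENNReal.ofReal_le_ofReal h).trans_eq ?_
  rw [ENNReal.ofReal_sum_of_nonneg
    fun j _ => mul_nonneg (abs_nonneg _) (φ.nonneg (abs_nonneg _))]
  simp only [ENNReal.ofReal_mul (abs_nonneg _)]

theorem conj_abs_sum_le (s : Finset ι) (w y : ι → ℝ) (hw : ∑ j ∈ s, |w j| ≤ 1) :
    φ.conj |∑ j ∈ s, w j * y j| ≤ ∑ j ∈ s, ENNReal.ofReal |w j| * φ.conj |y j| :=
  (φ.conj_mono (abs_sum_mul_le s w y)).trans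
    (φ.conj_sum_le s (fun j => |w j|) (fun j => |y j|) (fun _ _ => abs_nonneg _) hw)

theorem modular_mono {x y : ι → ℝ} (h : ∀ i, |x i| ≤ |y i|) : φ.modular x ≤ φ.modular y :=
  ENNReal.tsum_le_tsum fun i => ENNReal.ofReal_le_ofReal (φ.mono (abs_nonneg _) (h i))

theorem modular_smul_le {a : ℝ} (ha : 0 ≤ a) (ha1 : a ≤ 1) (x : ι → ℝ) :
    φ.modular (a • x) ≤ ENNReal.ofReal a * φ.modular x := by
  unfold modular
  rw [← ENNReal.tsum_mul_left]
  refine ENNReal.tsum_le_tsum fun i => ?_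
  rw [← ENNReal.ofReal_mul ha]
  refine ENNReal.ofReal_le_ofReal ?_
  simp only [Pi.smul_apply, smul_eq_mul, abs_mul, abs_of_nonneg ha]
  exact φ.map_mul_le ha ha1 (abs_nonneg _)

theorem modular_convex {a b : ℝ} (ha : 0 ≤ a) (hb : 0 ≤ b) (hab : a + b = 1) (x y : ι → ℝ) :
    φ.modular (a • x + b • y) ≤ ENNReal.ofReal a * φ.modular x + ENNReal.ofReal b * φ.modular y := by
  unfold modular
  rw [← ENNReal.tsum_mul_left, ← ENNReal.tsum_mul_left, ← ENNReal.tsum_add]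
  refine ENNReal.tsum_le_tsum fun i => ?_
  have hx := φ.nonneg (abs_nonneg (x i))
  have hy := φ.nonneg (abs_nonneg (y i))
  rw [← ENNReal.ofReal_mul ha, ← ENNReal.ofReal_mul hb,
    ← ENNReal.ofReal_add (mul_nonneg ha hx) (mul_nonneg hb hy)]
  exact ENNReal.ofReal_le_ofReal
    (φ.convexOn_abs.2 (Set.mem_univ (x i)) (Set.mem_univ (y i)) ha hb hab)

/-- The operator on `ℓ_φ` given by a symmetric substochastic matrix. -/
def matOp {A : ι → ι → ℝ} (hA : SymmSubstochastic A) : φ.space ι →ₗ[ℝ] φ.space ι where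
  toFun x := ⟨fun i => ∑ j ∈ (hA.finite i).toFinset, A i j * (x : ι → ℝ) j, by
    obtain ⟨s, hs, h⟩ := x.2
    refine ⟨s, hs, lt_of_le_of_lt ?_ h⟩
    refine le_trans (le_of_eq ?_)
      (hA.tsum_gauge_le (fun t => ENNReal.ofReal (φ t)) φ.ofReal_map_abs_sum_le _)
    refine tsum_congr fun i => ?_
    simp only [Pi.smul_apply, smul_eq_mul, Finset.mul_sum]
    congr 3
    exact Finset.sum_congr rfl fun j _ => by ring⟩
  map_add' x y := by
    ext i
    simp [mul_add, Finset.sum_add_distrib]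
  map_smul' c x := by
    ext i
    simp only [Submodule.coe_smul, Pi.smul_apply, smul_eq_mul, Finset.mul_sum, RingHom.id_apply]
    exact Finset.sum_congr rfl fun j _ => by ring

theorem matOp_apply {A : ι → ι → ℝ} (hA : SymmSubstochastic A) (x : φ.space ι) (i : ι) :
    (φ.matOp hA x : ι → ℝ) i = ∑ j ∈ (hA.finite i).toFinset, A i j * (x : ι → ℝ) j := rfl

variable {φ}

theorem modular_matOp_le {A : ι → ι → ℝ} (hA : SymmSubstochastic A) (x : φ.space ι) (s : ℝ) :
    φ.modular (s • (φ.matOp hA x : ι → ℝ)) ≤ φ.modular (s • (x : ι → ℝ)) := by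
  rw [← Submodule.coe_smul, ← map_smul, ← Submodule.coe_smul]
  exact hA.tsum_gauge_le (fun t => ENNReal.ofReal (φ t)) φ.ofReal_map_abs_sum_le _

/-- The properties of the Luxemburg norm and of the Orlicz norm that do not distinguish them. -/
structure IsSymmetricNorm (N : φ.space ι → ℝ) : Prop where
  add_le : ∀ x y, N (x + y) ≤ N x + N y
  smul_le : ∀ (c : ℝ) x, N (c • x) ≤ |c| * N x
  abs_le : ∀ (x : φ.space ι) (i : ι), |(x : ι → ℝ) i| ≤ N x
  matOp_le : ∀ {A : ι → ι → ℝ} (hA : SymmSubstochastic A) x, N (φ.matOp hA x) ≤ N x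

theorem luxemburgNorm_le {x : φ.space ι} {s : ℝ} (hs : 0 < s)
    (h : φ.modular (s⁻¹ • (x : ι → ℝ)) ≤ 1) : φ.luxemburgNorm x ≤ s :=
  csInf_le ⟨0, fun _ h => h.1.le⟩ ⟨hs, h⟩

theorem exists_modular_le_one (x : φ.space ι) :
    ∃ s : ℝ, 0 < s ∧ φ.modular (s⁻¹ • (x : ι → ℝ)) ≤ 1 := by
  obtain ⟨s, hs, h⟩ := x.2
  set C := (φ.modular (s⁻¹ • (x : ι → ℝ))).toReal with hC
  have hC0 : 0 ≤ C := ENNReal.toReal_nonneg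
  have hC1 : 0 < C + 1 := by linarith
  refine ⟨s * (C + 1), by positivity, ?_⟩
  have e : (s * (C + 1))⁻¹ • (x : ι → ℝ) = (C + 1)⁻¹ • (s⁻¹ • (x : ι → ℝ)) := by
    rw [smul_smul, mul_inv, mul_comm]
  rw [e]
  refine (φ.modular_smul_le (by positivity) (inv_le_one_of_one_le₀ (by linarith)) _).trans ?_
  rw [← ENNReal.ofReal_toReal h.ne, ← hC, ← ENNReal.ofReal_mul (by positivity)]
  rw [ENNReal.ofReal_le_one, inv_mul_le_one₀ hC1]
  linarith

theorem modular_le_of_luxemburgNorm_lt {x : φ.space ι} {s : ℝ} (h : φ.luxemburgNorm x < s) :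
    0 < s ∧ φ.modular (s⁻¹ • (x : ι → ℝ)) ≤ 1 := by
  obtain ⟨r, ⟨hr, hr1⟩, hrs⟩ := exists_lt_of_csInf_lt (exists_modular_le_one x) h
  refine ⟨hr.trans hrs, (φ.modular_mono fun i => ?_).trans hr1⟩
  have hs := hr.trans hrs
  simp only [Pi.smul_apply, smul_eq_mul, abs_mul, abs_inv, abs_of_pos hr, abs_of_pos hs]
  gcongr

/-- The infimum in the norm is attained: the bound holds for `r • x` with `r < 1`, and every finite
partial sum is continuous in `r`. -/
theorem modular_le_one_of_luxemburgNorm_le_one {x : φ.space ι} (h : φ.luxemburgNorm x ≤ 1) :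
    φ.modular (x : ι → ℝ) ≤ 1 := by
  unfold modular
  rw [ENNReal.tsum_eq_iSup_sum]
  refine iSup_le fun t => ?_
  rw [← ENNReal.ofReal_sum_of_nonneg fun i _ => φ.nonneg (abs_nonneg _), ENNReal.ofReal_le_one]
  have hc : Continuous fun r : ℝ => ∑ i ∈ t, φ |r * (x : ι → ℝ) i| :=
    continuous_finsetSum _ fun i _ => φ.continuous_abs.comp (continuous_mul_const _)
  have hlim : Tendsto (fun r : ℝ => ∑ i ∈ t, φ |r * (x : ι → ℝ) i|) (𝓝[<] 1)
      (𝓝 (∑ i ∈ t, φ |(x : ι → ℝ) i|)) := by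
    simpa using (hc.tendsto 1).mono_left nhdsWithin_le_nhds
  refine le_of_tendsto hlim ?_
  filter_upwards [Ioo_mem_nhdsLT (zero_lt_one' ℝ)] with r hr
  have h1 := (modular_le_of_luxemburgNorm_lt (h.trans_lt (one_lt_inv₀ hr.1 |>.2 hr.2))).2
  rw [inv_inv] at h1
  have h2 := (ENNReal.sum_le_tsum t).trans h1
  rwa [← ENNReal.ofReal_sum_of_nonneg fun i _ => φ.nonneg (abs_nonneg _),
    ENNReal.ofReal_le_one] at h2

theorem isSymmetricNorm_luxemburgNorm : IsSymmetricNorm (φ.luxemburgNorm (ι := ι)) where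
  add_le x y := by
    refine le_of_forall_pos_lt_add fun ε hε => ?_
    obtain ⟨ha, hx⟩ := modular_le_of_luxemburgNorm_lt (lt_add_of_pos_right (φ.luxemburgNorm x)
      (by positivity : 0 < ε / 4))
    obtain ⟨hb, hy⟩ := modular_le_of_luxemburgNorm_lt (lt_add_of_pos_right (φ.luxemburgNorm y)
      (by positivity : 0 < ε / 4))
    set a := φ.luxemburgNorm x + ε / 4
    set b := φ.luxemburgNorm y + ε / 4
    have hab : 0 < a + b := add_pos ha hb
    refine (luxemburgNorm_le hab ?_).trans_lt (by simp only [a, b]; linarith)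
    have e : (a + b)⁻¹ • ((x + y : φ.space ι) : ι → ℝ) =
        (a / (a + b)) • (a⁻¹ • (x : ι → ℝ)) + (b / (a + b)) • (b⁻¹ • (y : ι → ℝ)) := by
      rw [smul_smul, smul_smul, Submodule.coe_add, smul_add]
      congr 2 <;> field_simp
    rw [e]
    refine (φ.modular_convex (by positivity) (by positivity) (by field_simp) _ _).trans ?_
    calc _ ≤ ENNReal.ofReal (a / (a + b)) * 1 + ENNReal.ofReal (b / (a + b)) * 1 := by gcongr
      _ = 1 := by
        rw [mul_one, mul_one, ← ENNReal.ofReal_add (by positivity) (by positivity),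
          ← add_div, div_self hab.ne', ENNReal.ofReal_one]
  smul_le c x := by
    have hN : 0 ≤ φ.luxemburgNorm x := Real.sInf_nonneg fun _ h => h.1.le
    refine le_of_forall_pos_lt_add fun ε hε => ?_
    have hc : 0 < |c| + 1 := by positivity
    set s := φ.luxemburgNorm x + ε / 2 / (|c| + 1)
    obtain ⟨hs, h⟩ := modular_le_of_luxemburgNorm_lt (lt_add_of_pos_right (φ.luxemburgNorm x)
      (by positivity : 0 < ε / 2 / (|c| + 1)))
    have h2 : 0 < |c| * s + ε / 4 := by positivity
    refine (luxemburgNorm_le h2 ?_).trans_lt ?_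
    · refine (φ.modular_mono fun i => ?_).trans h
      simp only [Submodule.coe_smul, Pi.smul_apply, smul_eq_mul, abs_mul, abs_inv, abs_of_pos h2,
        ← mul_assoc]
      refine mul_le_mul_of_nonneg_right ?_ (abs_nonneg _)
      rw [abs_of_pos hs, inv_mul_le_iff₀ h2, ← div_eq_mul_inv, le_div_iff₀ hs]
      linarith
    · have : |c| * (ε / 2 / (|c| + 1)) ≤ ε / 2 := by
        rw [mul_div_assoc', div_le_iff₀ hc]
        nlinarith [abs_nonneg c]
      simp only [s, mul_add]
      linarith
  abs_le x i := by
    refine le_of_forall_gt_imp_ge_of_dense fun s hs => ?_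
    obtain ⟨hs, h⟩ := modular_le_of_luxemburgNorm_lt hs
    have h1 := (ENNReal.le_tsum i).trans h
    rw [ENNReal.ofReal_le_one] at h1
    have h2 := φ.le_one_of_map_le_one h1
    rwa [Pi.smul_apply, smul_eq_mul, abs_mul, abs_inv, abs_of_pos hs, inv_mul_le_one₀ hs] at h2
  matOp_le hA x := by
    refine le_of_forall_gt_imp_ge_of_dense fun s hs => ?_
    obtain ⟨hs, h⟩ := modular_le_of_luxemburgNorm_lt hs
    exact luxemburgNorm_le hs ((modular_matOp_le hA x _).trans h)

theorem tsum_ofReal_abs_mul_le (x y : ι → ℝ) {s : ℝ} (hs : 0 < s) :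
    ∑' i, ENNReal.ofReal |x i * y i| ≤
      ENNReal.ofReal s * (φ.modular (s⁻¹ • x) + φ.conjModular y) := by
  unfold modular conjModular
  rw [← ENNReal.tsum_add, ← ENNReal.tsum_mul_left]
  refine ENNReal.tsum_le_tsum fun i => ?_
  have e : |x i * y i| = s * (|(s⁻¹ • x) i| * |y i|) := by
    simp only [Pi.smul_apply, smul_eq_mul, abs_mul, abs_inv, abs_of_pos hs]
    field_simp
  rw [e, ENNReal.ofReal_mul hs.le]
  gcongr
  exact φ.ofReal_mul_le _ _ (abs_nonneg _)

theorem summable_mul_of_conjModular_le_one (x : φ.space ι) {y : ι → ℝ} (hy : φ.conjModular y ≤ 1) :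
    Summable fun i => (x : ι → ℝ) i * y i := by
  obtain ⟨s, hs, h⟩ := x.2
  refine summable_of_tsum_ofReal_abs_ne_top (ne_top_of_le_ne_top ?_ (tsum_ofReal_abs_mul_le (φ := φ) _ y hs))
  exact ENNReal.mul_ne_top ENNReal.ofReal_ne_top
    (ENNReal.add_ne_top.2 ⟨h.ne, ne_top_of_le_ne_top ENNReal.one_ne_top hy⟩)

theorem bddAbove_orlicz (x : φ.space ι) :
    BddAbove {r : ℝ | ∃ y : ι → ℝ, φ.conjModular y ≤ 1 ∧ r = ∑' i, (x : ι → ℝ) i * y i} := by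
  obtain ⟨s, hs, h⟩ := x.2
  have hfin : ENNReal.ofReal s * (φ.modular (s⁻¹ • (x : ι → ℝ)) + 1) ≠ ∞ :=
    ENNReal.mul_ne_top ENNReal.ofReal_ne_top (ENNReal.add_ne_top.2 ⟨h.ne, ENNReal.one_ne_top⟩)
  refine ⟨(ENNReal.ofReal s * (φ.modular (s⁻¹ • (x : ι → ℝ)) + 1)).toReal, ?_⟩
  rintro r ⟨y, hy, rfl⟩
  rw [← ENNReal.ofReal_le_iff_le_toReal hfin]
  refine (ofReal_tsum_le_tsum_ofReal_abs (summable_mul_of_conjModular_le_one x hy)).trans ?_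
  refine (tsum_ofReal_abs_mul_le (φ := φ) _ y hs).trans ?_
  gcongr

theorem le_orliczNorm (x : φ.space ι) {y : ι → ℝ} (hy : φ.conjModular y ≤ 1) :
    ∑' i, (x : ι → ℝ) i * y i ≤ φ.orliczNorm x :=
  le_csSup (bddAbove_orlicz x) ⟨y, hy, rfl⟩

theorem conjModular_zero : φ.conjModular (0 : ι → ℝ) ≤ 1 := by
  simp [conjModular, φ.conj_zero]

theorem orliczNorm_le {x : φ.space ι} {C : ℝ}
    (h : ∀ y : ι → ℝ, φ.conjModular y ≤ 1 → ∑' i, (x : ι → ℝ) i * y i ≤ C) :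
    φ.orliczNorm x ≤ C := by
  refine csSup_le ⟨_, 0, conjModular_zero, rfl⟩ ?_
  rintro r ⟨y, hy, rfl⟩
  exact h y hy

theorem orliczNorm_nonneg (x : φ.space ι) : 0 ≤ φ.orliczNorm x := by
  simpa using le_orliczNorm x conjModular_zero

/-- The upper half of Amemiya's formula, from Young's inequality. An approximate converse at
suitable vectors is `exists_one_add_modular_le`. -/
theorem ofReal_orliczNorm_le (x : φ.space ι) :
    ENNReal.ofReal (φ.orliczNorm x) ≤ 1 + φ.modular (x : ι → ℝ) := by
  by_cases h : φ.modular (x : ι → ℝ) = ∞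
  · simp [h]
  refine ENNReal.ofReal_le_of_le_toReal (orliczNorm_le fun y hy => ?_)
  rw [← ENNReal.ofReal_le_iff_le_toReal (by simp [h])]
  refine (ofReal_tsum_le_tsum_ofReal_abs (summable_mul_of_conjModular_le_one x hy)).trans ?_
  refine (tsum_ofReal_abs_mul_le (φ := φ) _ y one_pos).trans ?_
  simp only [inv_one, one_smul, ENNReal.ofReal_one, one_mul]
  rw [add_comm]
  gcongr

/-- The matrix is its own adjoint. Young's inequality bounds the double series by the two modulars,
which justifies the interchange. As the matrix also decreases `φ.conjModular`, it contracts the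
Orlicz norm. -/
theorem tsum_matOp_mul {A : ι → ι → ℝ} (hA : SymmSubstochastic A) (x : φ.space ι) {y : ι → ℝ}
    (hy : φ.conjModular y ≤ 1) :
    ∑' i, (φ.matOp hA x : ι → ℝ) i * y i =
      ∑' j, (x : ι → ℝ) j * ∑ i ∈ (hA.finite j).toFinset, A j i * y i := by
  have hs : Summable (Function.uncurry fun i j => A i j * (x : ι → ℝ) j * y i) := by
    obtain ⟨s, hs, h⟩ := x.2
    refine summable_of_tsum_ofReal_abs_ne_top ?_
    rw [ENNReal.tsum_prod']
    have h1 : ∀ i j, ENNReal.ofReal |A i j * (x : ι → ℝ) j * y i| ≤ ENNReal.ofReal s *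
        (ENNReal.ofReal |A i j| * ENNReal.ofReal (φ |(s⁻¹ • (x : ι → ℝ)) j|) +
          ENNReal.ofReal |A i j| * φ.conj |y i|) := fun i j => by
      have e : |A i j * (x : ι → ℝ) j * y i| =
          s * (|A i j| * (|(s⁻¹ • (x : ι → ℝ)) j| * |y i|)) := by
        simp only [Pi.smul_apply, smul_eq_mul, abs_mul, abs_inv, abs_of_pos hs]
        field_simp
      rw [e, ENNReal.ofReal_mul hs.le, ENNReal.ofReal_mul (abs_nonneg _), ← mul_add]
      gcongr
      exact φ.ofReal_mul_le _ _ (abs_nonneg _)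
    refine ne_top_of_le_ne_top ?_ (ENNReal.tsum_le_tsum fun i => ENNReal.tsum_le_tsum (h1 i))
    simp only [ENNReal.tsum_mul_left, ENNReal.tsum_add, ENNReal.tsum_mul_right]
    refine ENNReal.mul_ne_top ENNReal.ofReal_ne_top (ENNReal.add_ne_top.2 ⟨?_, ?_⟩)
    · exact ne_top_of_le_ne_top h.ne (hA.tsum_tsum_mul_le _)
    · refine ne_top_of_le_ne_top (ne_top_of_le_ne_top ENNReal.one_ne_top hy)
        (ENNReal.tsum_le_tsum fun i => ?_)
      exact mul_le_of_le_one_left zero_le (hA.tsum_ofReal_abs_le i)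
  have h1 : ∀ i, (φ.matOp hA x : ι → ℝ) i * y i = ∑' j, A i j * (x : ι → ℝ) j * y i := fun i => by
    rw [matOp_apply, hA.sum_mul_eq_tsum, tsum_mul_right]
  have h2 : ∀ j, (x : ι → ℝ) j * ∑ i ∈ (hA.finite j).toFinset, A j i * y i =
      ∑' i, A i j * (x : ι → ℝ) j * y i := fun j => by
    rw [hA.sum_mul_eq_tsum, ← tsum_mul_left]
    refine tsum_congr fun i => ?_
    rw [hA.symm j i]
    ring
  rw [tsum_congr h1, tsum_congr h2]
  exact hs.tsum_comm.symm

theorem isSymmetricNorm_orliczNorm : IsSymmetricNorm (φ.orliczNorm (ι := ι)) where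
  add_le x y := orliczNorm_le fun z hz => by
    have hx := summable_mul_of_conjModular_le_one x hz
    have hy := summable_mul_of_conjModular_le_one y hz
    simp only [Submodule.coe_add, Pi.add_apply, add_mul]
    rw [hx.tsum_add hy]
    exact add_le_add (le_orliczNorm x hz) (le_orliczNorm y hz)
  smul_le c x := orliczNorm_le fun z hz => by
    simp only [Submodule.coe_smul, Pi.smul_apply, smul_eq_mul, mul_assoc]
    rw [tsum_mul_left]
    refine (le_abs_self _).trans ?_
    rw [abs_mul]
    refine mul_le_mul_of_nonneg_left (abs_le.2 ⟨?_, le_orliczNorm x hz⟩) (abs_nonneg c)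
    have h := le_orliczNorm x (y := -z) (by simpa [conjModular] using hz)
    simp only [Pi.neg_apply, mul_neg, tsum_neg] at h
    linarith
  abs_le x i := by
    classical
    have h : ∀ a : ℝ, |a| = 1 → a * (x : ι → ℝ) i ≤ φ.orliczNorm x := fun a ha => by
      have h := le_orliczNorm x (y := Pi.single i a) (by
        unfold conjModular
        rw [tsum_eq_single i fun j hj => by simp [hj, φ.conj_zero]]
        simpa [ha] using φ.conj_one_le)
      rw [tsum_eq_single i fun j hj => by simp [hj]] at h
      simpa [mul_comm] using h
    have h1 := h 1 (by simp)
    have h2 := h (-1) (by simp)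
    exact abs_le.2 ⟨by linarith, by linarith⟩
  matOp_le hA x := orliczNorm_le fun z hz => by
    rw [tsum_matOp_mul hA x hz]
    exact le_orliczNorm x ((hA.tsum_gauge_le φ.conj φ.conj_abs_sum_le z).trans hz)

end OrliczFunction

open Classical in
-- Applied to sign changes of one coordinate and to restrictions to a set of coordinates.
theorem symmSubstochastic_diag {ι : Type*} {a : ι → ℝ} (ha : ∀ i, |a i| ≤ 1) :
    SymmSubstochastic fun i j => if i = j then a i else 0 where
  symm i j := by
    by_cases h : i = j
    · subst h; rfl
    · simp [h, Ne.symm h]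
  finite i := (Set.finite_singleton i).subset fun j hj => by
    by_contra h
    exact hj (if_neg fun e => h e.symm)
  sum_le i := by
    rw [Finset.sum_subset (s₂ := {i})]
    · simpa using ha i
    · intro j hj
      rw [Set.Finite.mem_toFinset, Function.mem_support] at hj
      by_contra h
      exact hj (if_neg fun e => h (by simp [e]))
    · intro j _ hj
      rw [Set.Finite.mem_toFinset, Function.notMem_support] at hj
      simp [hj]

/-! ### The averaging projection onto a block basis. -/

namespace OrliczFunction

variable {φ : OrliczFunction} {ι : Type*}

/-- Coordinatewise multiplication by a sequence bounded by one. -/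
def diagOp (φ : OrliczFunction) {a : ι → ℝ} (ha : ∀ i, |a i| ≤ 1) : φ.space ι →ₗ[ℝ] φ.space ι :=
  φ.matOp (symmSubstochastic_diag ha)

theorem diagOp_apply {a : ι → ℝ} (ha : ∀ i, |a i| ≤ 1) (x : φ.space ι) (i : ι) :
    (φ.diagOp ha x : ι → ℝ) i = a i * (x : ι → ℝ) i := by
  rw [diagOp, matOp_apply, (symmSubstochastic_diag ha).sum_mul_eq_tsum, tsum_eq_single i]
  · simp
  · intro j hj
    simp [hj.symm]

theorem unitVec_apply_self (i : ι) : (φ.unitVec i : ι → ℝ) i = 1 := by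
  simp [unitVec]

theorem unitVec_apply_of_ne {i j : ι} (h : j ≠ i) : (φ.unitVec i : ι → ℝ) j = 0 := by
  simp [unitVec, h]

namespace IsSymmetricNorm

variable {N : φ.space ι → ℝ} (hN : IsSymmetricNorm N)
include hN

theorem map_neg_le (x : φ.space ι) : N (-x) ≤ N x := by
  have h := hN.smul_le (-1) x
  rwa [show (-1 : ℝ) • x = -x from neg_one_smul ℝ x, abs_neg, abs_one, one_mul] at h

theorem map_sub_comm (x y : φ.space ι) : N (x - y) = N (y - x) :=
  le_antisymm (by simpa using hN.map_neg_le (y - x)) (by simpa using hN.map_neg_le (x - y))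

theorem eq_of_forall_lt {x y : φ.space ι} (h : ∀ ε > 0, N (x - y) < ε) : x = y := by
  ext i
  have h1 : |(x : ι → ℝ) i - (y : ι → ℝ) i| ≤ 0 :=
    le_of_forall_pos_le_add fun ε hε => by
      rw [zero_add]
      exact (hN.abs_le (x - y) i).trans (h ε hε).le
  exact sub_eq_zero.1 (abs_eq_zero.1 (le_antisymm h1 (abs_nonneg _)))

/-- The range of a contractive projection is closed. -/
theorem apply_eq_of_mem_closedSpan {P : φ.space ι →ₗ[ℝ] φ.space ι} (hP : ∀ x, N (P x) ≤ N x)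
    {B : Set (φ.space ι)} (hB : ∀ b ∈ B, P b = b) {x : φ.space ι} (hx : x ∈ closedSpan N B) :
    P x = x := by
  have hspan : ∀ y ∈ Submodule.span ℝ B, P y = y := fun y hy => by
    induction hy using Submodule.span_induction with
    | mem b hb => exact hB b hb
    | zero => simp
    | add u v _ _ hu hv => rw [map_add, hu, hv]
    | smul c u _ hu => rw [map_smul, hu]
  refine hN.eq_of_forall_lt fun ε hε => ?_
  obtain ⟨y, hy, hxy⟩ := hx (ε / 2) (by positivity)
  have e : P x - x = P (x - y) + (y - x) := by rw [map_sub, hspan y hy]; abel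
  calc N (P x - x) ≤ N (P (x - y)) + N (y - x) := by rw [e]; exact hN.add_le _ _
    _ ≤ N (x - y) + N (x - y) := add_le_add (hP _) (hN.map_sub_comm _ _).le
    _ < ε := by linarith

/-- The projection has entries `b_i b_j / ∑ b_k ^ 2` inside a block `b` and `0` elsewhere. Constancy
of `|b_i|` turns the absolute row sum over the block into `∑ b_j ^ 2 / ∑ b_k ^ 2 = 1`. -/
theorem isOneComplemented_of_isConstCoeffBlockBasis
    (hbasis : closedSpan N (Set.range φ.unitVec) = Set.univ) {B : Set (φ.space ι)}
    (hB : IsConstCoeffBlockBasis B) {F : Submodule ℝ (φ.space ι)}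
    (hF : (F : Set (φ.space ι)) = closedSpan N B) : IsOneComplemented N F := by
  classical
  obtain ⟨hB1, hB2⟩ := hB
  -- The block whose support contains `i`, and `0` if there is none.
  let β : ι → φ.space ι := fun i =>
    if h : ∃ b ∈ B, (b : ι → ℝ) i ≠ 0 then h.choose else 0
  have hβ : ∀ i, β i = 0 ∨ (β i ∈ B ∧ (β i : ι → ℝ) i ≠ 0) := fun i => by
    by_cases h : ∃ b ∈ B, (b : ι → ℝ) i ≠ 0
    · right
      simp only [β, dif_pos h]
      exact h.choose_spec
    · left
      simp only [β, dif_neg h]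
  have huniq : ∀ b ∈ B, ∀ c ∈ B, ∀ i, (b : ι → ℝ) i ≠ 0 → (c : ι → ℝ) i ≠ 0 → b = c := by
    intro b hb c hc i hbi hci
    by_contra hne
    exact Set.disjoint_left.1 (hB2 hb hc hne) hbi hci
  have hβeq : ∀ b ∈ B, ∀ i, (b : ι → ℝ) i ≠ 0 → β i = b := by
    intro b hb i hi
    have h : ∃ b ∈ B, (b : ι → ℝ) i ≠ 0 := ⟨b, hb, hi⟩
    have e : β i = h.choose := by simp only [β, dif_pos h]
    rw [e]
    exact huniq _ h.choose_spec.1 b hb i h.choose_spec.2 hi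
  have hβne : ∀ i j, (β i : ι → ℝ) j ≠ 0 → β j = β i := by
    intro i j hij
    rcases hβ i with h | h
    · simp [h] at hij
    · exact hβeq _ h.1 j hij
  have hβself : ∀ i j, (β i : ι → ℝ) j ≠ 0 → (β i : ι → ℝ) i ≠ 0 := by
    intro i j hij
    rcases hβ i with h | h
    · simp [h] at hij
    · exact h.2
  have hβfin : ∀ i, (Function.support (β i : ι → ℝ)).Finite := fun i => by
    rcases hβ i with h | h
    · rw [h]; simp
    · exact (hB1 _ h.1).2.1
  let D : ι → ℝ := fun i => ∑ k ∈ (hβfin i).toFinset, (β i : ι → ℝ) k ^ 2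
  have hD0 : ∀ i, 0 ≤ D i := fun i => Finset.sum_nonneg fun _ _ => sq_nonneg _
  let A : ι → ι → ℝ := fun i j => (β i : ι → ℝ) i * (β i : ι → ℝ) j / D i
  have hAsupp : ∀ i j, (β i : ι → ℝ) j = 0 → A i j = 0 := fun i j h => by simp [A, h]
  have hDeq : ∀ i j, β i = β j → D i = D j := fun i j h => by simp only [D, h]
  have hA : SymmSubstochastic A := by
    refine ⟨fun i j => ?_, fun i => (hβfin i).subset fun j hj h => hj (hAsupp i j h), fun i => ?_⟩
    · by_cases h : (β j : ι → ℝ) i = 0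
      · by_cases h' : (β i : ι → ℝ) j = 0
        · rw [hAsupp _ _ h, hAsupp _ _ h']
        · have := hβself i j h'
          rw [← hβne i j h'] at this
          exact absurd h this
      · have e := hβne j i h
        simp only [A, hDeq i j e, e, mul_comm]
    · rw [Finset.sum_subset (s₂ := (hβfin i).toFinset)]
      · have : ∀ j ∈ (hβfin i).toFinset, |A i j| = (β i : ι → ℝ) j ^ 2 / D i := by
          intro j hj
          have hj' : (β i : ι → ℝ) j ≠ 0 := by simpa using hj
          have hi' := hβself i j hj'
          have habs : |(β i : ι → ℝ) i| = |(β i : ι → ℝ) j| := by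
            rcases hβ i with h | h
            · simp [h] at hj'
            · exact (hB1 _ h.1).2.2 i hi' j hj'
          simp only [A, abs_div, abs_mul, abs_of_nonneg (hD0 i), habs]
          rw [← abs_mul, ← sq, abs_of_nonneg (sq_nonneg _)]
        rw [Finset.sum_congr rfl this, ← Finset.sum_div]
        -- For `i` in no block, `D i = 0` and the quotient is `0 / 0 = 0`.
        exact div_self_le_one _
      · intro j hj
        rw [Set.Finite.mem_toFinset, Function.mem_support] at hj ⊢
        exact fun h => hj (hAsupp i j h)
      · intro j _ hj
        rw [Set.Finite.mem_toFinset, Function.notMem_support] at hj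
        simp [hj]
  have hAB : ∀ b ∈ B, φ.matOp hA b = b := by
    intro b hb
    ext i
    rw [matOp_apply, Finset.sum_subset (s₂ := (hβfin i).toFinset)]
    · by_cases hi : (b : ι → ℝ) i = 0
      · rw [hi]
        refine Finset.sum_eq_zero fun j hj => ?_
        have hj' : (β i : ι → ℝ) j ≠ 0 := by simpa using hj
        by_cases hbj : (b : ι → ℝ) j = 0
        · rw [hbj, mul_zero]
        · have h1 := hβself i j hj'
          rw [← hβne i j hj', hβeq b hb j hbj] at h1
          exact absurd hi h1
      · have e := hβeq b hb i hi
        have : ∀ j ∈ (hβfin i).toFinset, A i j * (b : ι → ℝ) j =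
            (b : ι → ℝ) i * ((β i : ι → ℝ) j ^ 2 / D i) := by
          intro j _
          simp only [A, e]
          ring
        rw [Finset.sum_congr rfl this, ← Finset.mul_sum, ← Finset.sum_div]
        have hpos : 0 < D i := Finset.sum_pos' (fun _ _ => sq_nonneg _)
          ⟨i, by simpa [e] using hi, by rw [e]; positivity⟩
        change (b : ι → ℝ) i * (D i / D i) = (b : ι → ℝ) i
        rw [div_self hpos.ne', mul_one]
    · intro j hj
      rw [Set.Finite.mem_toFinset, Function.mem_support] at hj ⊢
      exact fun h => hj (hAsupp i j h)
    · intro j _ hj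
      rw [Set.Finite.mem_toFinset, Function.notMem_support] at hj
      simp [hj]
  have hAe : ∀ k, φ.matOp hA (φ.unitVec k) ∈ Submodule.span ℝ B := by
    intro k
    have e : φ.matOp hA (φ.unitVec k) = ((β k : ι → ℝ) k / D k) • β k := by
      ext i
      rw [matOp_apply, hA.sum_mul_eq_tsum, tsum_eq_single k]
      · rw [unitVec_apply_self, mul_one, hA.symm]
        simp only [A, Submodule.coe_smul, Pi.smul_apply, smul_eq_mul]
        ring
      · intro j hj
        rw [unitVec_apply_of_ne hj, mul_zero]
    rw [e]
    rcases hβ k with h | h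
    · rw [h]; simp
    · exact Submodule.smul_mem _ _ (Submodule.subset_span h.1)
  -- The density of the span of the unit vectors enters here: finite combinations are mapped into
  -- the span of `B`, and contractivity carries this to limits.
  have hmem : ∀ x, φ.matOp hA x ∈ closedSpan N B := by
    intro x ε hε
    have hx : x ∈ closedSpan N (Set.range φ.unitVec) := by rw [hbasis]; trivial
    obtain ⟨y, hy, hxy⟩ := hx ε hε
    refine ⟨φ.matOp hA y, ?_, ?_⟩
    · have h := Submodule.mem_map_of_mem (f := φ.matOp hA) hy
      rw [Submodule.map_span] at h
      refine Submodule.span_le.2 ?_ h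
      rintro _ ⟨_, ⟨k, rfl⟩, rfl⟩
      exact hAe k
    · rw [← map_sub]
      exact (hN.matOp_le hA _).trans_lt hxy
  refine ⟨φ.matOp hA, ?_, ?_, hN.matOp_le hA⟩
  · ext1 x
    exact hN.apply_eq_of_mem_closedSpan (hN.matOp_le hA) hAB (hmem x)
  · ext x
    rw [← SetLike.mem_coe (p := F), hF]
    constructor
    · rintro ⟨y, rfl⟩
      exact hmem y
    · intro hx
      exact ⟨x, hN.apply_eq_of_mem_closedSpan (hN.matOp_le hA) hAB hx⟩

end IsSymmetricNorm

end OrliczFunction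

/-- A subspace of `ℝ^κ` contains a vector all of whose coordinates are nonzero, except those that
vanish on the whole subspace. -/
theorem exists_mem_forall_apply_ne_zero {κ : Type*} [Finite κ] (V : Submodule ℝ (κ → ℝ)) :
    ∃ v ∈ V, ∀ i, (∃ u ∈ V, u i ≠ 0) → v i ≠ 0 := by
  obtain ⟨v, hv, h⟩ := Module.Dual.exists_forall_mem_ne_zero_of_forall_exists V
    (fun i : {i : κ // ∃ u ∈ V, u i ≠ 0} => LinearMap.proj (R := ℝ) (φ := fun _ : κ => ℝ) i.1)
    (fun i => i.2)
  exact ⟨v, hv, fun i hi => h ⟨i, hi⟩⟩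

/-- Restriction to the support of a generic vector of `V` is injective on `V`. -/
theorem exists_mem_finrank_le_card_support {κ : Type*} [Fintype κ] (V : Submodule ℝ (κ → ℝ)) :
    ∃ v ∈ V, Module.finrank ℝ V ≤ (Finset.univ.filter fun i => v i ≠ 0).card := by
  obtain ⟨v, hv, h⟩ := exists_mem_forall_apply_ne_zero V
  refine ⟨v, hv, ?_⟩
  let r : V →ₗ[ℝ] ({i // v i ≠ 0} → ℝ) :=
    (LinearMap.funLeft ℝ ℝ (Subtype.val : {i // v i ≠ 0} → κ)).domRestrict V
  have hr : Function.Injective r := by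
    rw [injective_iff_map_eq_zero]
    rintro ⟨u, hu⟩ hu0
    ext i
    by_contra hi
    exact hi (congrFun hu0 ⟨i, h i ⟨u, hu, hi⟩⟩)
  have := LinearMap.finrank_le_finrank_of_injective hr
  rwa [Module.finrank_fintype_fun_eq_card, Fintype.card_subtype] at this

/-! ### From the norm inequality to the modular inequality. -/

namespace OrliczFunction

variable {φ : OrliczFunction} {ι : Type*}

/-- The vector of `ℓ_φ` supported on `J` with given coordinates there. -/
def extend (φ : OrliczFunction) (J : Finset ι) : (J → ℝ) →ₗ[ℝ] φ.space ι :=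
  Fintype.linearCombination ℝ fun j : J => φ.unitVec (j : ι)

open Classical in
theorem extend_apply (J : Finset ι) (x : J → ℝ) (i : ι) :
    (φ.extend J x : ι → ℝ) i = if h : i ∈ J then x ⟨i, h⟩ else 0 := by
  rw [extend, Fintype.linearCombination_apply, AddSubmonoidClass.coe_finsetSum, Finset.sum_apply]
  split_ifs with h
  · rw [Finset.sum_eq_single ⟨i, h⟩]
    · simp [unitVec_apply_self]
    · intro j _ hj
      have : i ≠ j := fun e => hj (Subtype.ext e.symm)
      simp [unitVec_apply_of_ne this]
    · simp
  · refine Finset.sum_eq_zero fun j _ => ?_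
    have : i ≠ j := fun e => h (e ▸ j.2)
    simp [unitVec_apply_of_ne this]

theorem extend_apply_coe (J : Finset ι) (x : J → ℝ) (j : J) :
    (φ.extend J x : ι → ℝ) j = x j := by
  rw [extend_apply, dif_pos j.2]

theorem extend_apply_of_notMem (J : Finset ι) (x : J → ℝ) {i : ι} (h : i ∉ J) :
    (φ.extend J x : ι → ℝ) i = 0 := by
  rw [extend_apply, dif_neg h]

/-- The vectors of `F` supported in `J` form the kernel of a map from `ℝ^J` to the `n`-dimensional
quotient. -/
theorem card_le_finrank_comap_extend_add {F : Submodule ℝ (φ.space ι)} {n : ℕ}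
    (hcodim : Module.rank ℝ (φ.space ι ⧸ F) = n) (J : Finset ι) :
    J.card ≤ Module.finrank ℝ (F.comap (φ.extend J)) + n := by
  have hfin : Module.finrank ℝ (φ.space ι ⧸ F) = n := Module.finrank_eq_of_rank_eq hcodim
  have : Module.Finite ℝ (φ.space ι ⧸ F) := by
    rw [← Module.rank_lt_aleph0_iff, hcodim]
    exact Cardinal.natCast_lt_aleph0
  have h := LinearMap.finrank_range_add_finrank_ker (F.mkQ ∘ₗ φ.extend J)
  rw [LinearMap.ker_comp, Submodule.ker_mkQ, Module.finrank_fintype_fun_eq_card,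
    Fintype.card_coe] at h
  have h2 := Submodule.finrank_le (LinearMap.range (F.mkQ ∘ₗ φ.extend J))
  omega

theorem modular_add_of_disjoint {x y : ι → ℝ} (h : ∀ i, x i = 0 ∨ y i = 0) :
    φ.modular (x + y) = φ.modular x + φ.modular y := by
  unfold modular
  rw [← ENNReal.tsum_add]
  refine tsum_congr fun i => ?_
  rcases h i with h | h <;> simp [h, φ.map_zero]

theorem modular_eq_sum {x : ι → ℝ} {s : Finset ι} (hs : ∀ i ∉ s, x i = 0) :
    φ.modular x = ENNReal.ofReal (∑ i ∈ s, φ |x i|) := by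
  unfold modular
  rw [tsum_eq_sum (s := s) fun i hi => by simp [hs i hi, φ.map_zero],
    ENNReal.ofReal_sum_of_nonneg fun i _ => φ.nonneg (abs_nonneg _)]

theorem modular_smul_unitVec (a : ℝ) (i : ι) :
    φ.modular ((a • φ.unitVec i : φ.space ι) : ι → ℝ) = ENNReal.ofReal (φ |a|) := by
  rw [modular_eq_sum (s := {i})]
  · simp [unitVec_apply_self]
  · intro j hj
    simp [unitVec_apply_of_ne (by simpa using hj : j ≠ i)]

/-- The `i`-th coordinate `c` of `z` can be removed. Let `u` be the vector on the right. `P u` is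
`(a - c) e + f`; changing the sign of coordinate `i` before and after `P` gives `(a + c) e + f`.
Their mean is `a e + f`, and neither norm exceeds `N u`. -/
theorem IsSymmetricNorm.norm_le_of_flip {N : φ.space ι → ℝ} (hN : IsSymmetricNorm N)
    {P : φ.space ι →ₗ[ℝ] φ.space ι} (hP : ∀ x, N (P x) ≤ N x) {i : ι}
    (hi : P (φ.unitVec i) = φ.unitVec i) {f z : φ.space ι} (hf : P f = f)
    (hfi : (f : ι → ℝ) i = 0) (hz : P z = 0) (a : ℝ) :
    N (a • φ.unitVec i + f) ≤
      N (a • φ.unitVec i + (f + (z - (z : ι → ℝ) i • φ.unitVec i))) := by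
  classical
  set e := φ.unitVec i with he
  set c := (z : ι → ℝ) i with hc
  set u := a • e + (f + (z - c • e)) with hu
  have hs : ∀ j, |if j = i then (-1 : ℝ) else 1| ≤ 1 := fun j => by split_ifs <;> simp
  have h1 : N ((a - c) • e + f) ≤ N u := by
    have e1 : P u = (a - c) • e + f := by
      rw [hu, map_add, map_add, map_sub, map_smul, map_smul, hi, hf, hz]
      module
    rw [← e1]
    exact hP u
  have h2 : N ((a + c) • e + f) ≤ N u := by
    have e1 : (a + c) • e + f = φ.diagOp hs (P (φ.diagOp hs u)) := by
      have e2 : φ.diagOp hs u = (-a) • e + (f + (z - c • e)) := by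
        ext j
        rw [diagOp_apply]
        by_cases hj : j = i
        · subst hj
          simp [hu, he, hfi, ← hc, unitVec_apply_self]
        · simp [hj, hu, he, unitVec_apply_of_ne hj]
      have e3 : P (φ.diagOp hs u) = (-a - c) • e + f := by
        rw [e2, map_add, map_add, map_sub, map_smul, map_smul, hi, hf, hz]
        module
      rw [e3]
      ext j
      rw [diagOp_apply]
      by_cases hj : j = i
      · subst hj
        simp [he, hfi, unitVec_apply_self]
        ring
      · simp [hj, he, unitVec_apply_of_ne hj]
    rw [e1]
    exact (hN.matOp_le _ _).trans ((hP _).trans (hN.matOp_le _ _))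
  have e3 : a • e + f = (1 / 2 : ℝ) • ((a - c) • e + f) + (1 / 2 : ℝ) • ((a + c) • e + f) := by
    module
  rw [e3]
  refine (hN.add_le _ _).trans ?_
  have h3 := hN.smul_le (1 / 2) ((a - c) • e + f)
  have h4 := hN.smul_le (1 / 2) ((a + c) • e + f)
  rw [abs_of_pos (by norm_num : (0 : ℝ) < 1 / 2)] at h3 h4
  linarith

/-- The free coordinate `i` is used to fill the modular of `g` up to exactly `1`. Then the norm
inequality says that the modular of `a e_i + f` is at most `1`, and the common term `φ |a|` cancels.
-/
theorem modular_le_of_luxemburgNorm_le {i : ι} {f g : φ.space ι} (hf : (f : ι → ℝ) i = 0)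
    (hg : (g : ι → ℝ) i = 0) (hf1 : φ.modular (f : ι → ℝ) ≤ 1)
    (h : ∀ a : ℝ, φ.luxemburgNorm (a • φ.unitVec i + f) ≤
      φ.luxemburgNorm (a • φ.unitVec i + g)) :
    φ.modular (f : ι → ℝ) ≤ φ.modular (g : ι → ℝ) := by
  rcases le_total 1 (φ.modular (g : ι → ℝ)) with hg1 | hg1
  · exact hf1.trans hg1
  have hgt : φ.modular (g : ι → ℝ) ≠ ∞ := ne_top_of_le_ne_top ENNReal.one_ne_top hg1
  have hadd : ∀ (a : ℝ) (x : φ.space ι), (x : ι → ℝ) i = 0 →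
      φ.modular ((a • φ.unitVec i + x : φ.space ι) : ι → ℝ) =
        ENNReal.ofReal (φ |a|) + φ.modular (x : ι → ℝ) := by
    intro a x hx
    rw [Submodule.coe_add, modular_add_of_disjoint, modular_smul_unitVec]
    intro j
    by_cases hj : j = i
    · right; rw [hj, hx]
    · left; simp [unitVec_apply_of_ne hj]
  set m := (φ.modular (g : ι → ℝ)).toReal with hm
  have hm0 : 0 ≤ m := ENNReal.toReal_nonneg
  have hm1 : m ≤ 1 := by
    simpa using ENNReal.toReal_mono ENNReal.one_ne_top hg1
  obtain ⟨a, -, ha⟩ : ∃ a ∈ Set.Icc (0 : ℝ) 1, φ |a| = 1 - m := by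
    have := intermediate_value_Icc zero_le_one (φ.continuous_abs.continuousOn (s := Set.Icc 0 1))
    simp only [abs_zero, φ.map_zero, abs_one, φ.map_one] at this
    exact this ⟨by linarith, by linarith⟩
  have h1 : ENNReal.ofReal (φ |a|) + φ.modular (g : ι → ℝ) = 1 := by
    rw [ha, ← ENNReal.ofReal_toReal hgt, ← hm, ← ENNReal.ofReal_add (by linarith) hm0]
    simp
  have h2 : φ.luxemburgNorm (a • φ.unitVec i + g) ≤ 1 :=
    luxemburgNorm_le one_pos (by rw [inv_one, one_smul, hadd a g hg, h1])
  have h3 := modular_le_one_of_luxemburgNorm_le_one ((h a).trans h2)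
  rw [hadd a f hf, ← h1] at h3
  exact (ENNReal.add_le_add_iff_left ENNReal.ofReal_ne_top).1 h3

/-- If a segment `f + [0, T] g` starts at a small vector and ends at a large one, then the Orlicz
norm is almost one plus the modular somewhere on it. -/
theorem exists_one_add_modular_le {f g : φ.space ι} {s : Finset ι}
    (hf : ∀ i ∉ s, (f : ι → ℝ) i = 0) (hg : ∀ i ∉ s, (g : ι → ℝ) i = 0)
    (hf1 : φ.modular ((2 : ℝ) • (f : ι → ℝ)) < 1) {T : ℝ} (hT : 0 ≤ T)
    (hT1 : 1 ≤ ∑ i ∈ s, (|(f : ι → ℝ) i + T * (g : ι → ℝ) i| *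
      φ.subgrad |(f : ι → ℝ) i + T * (g : ι → ℝ) i| - φ |(f : ι → ℝ) i + T * (g : ι → ℝ) i|))
    {η : ℝ} (hη : 0 < η) :
    ∃ t : ℝ, 1 + φ.modular ((f + t • g : φ.space ι) : ι → ℝ) ≤
      ENNReal.ofReal (φ.orliczNorm (f + t • g)) + ENNReal.ofReal η := by
  let h : ℝ → ι → ℝ := fun t i => (f : ι → ℝ) i + t * (g : ι → ℝ) i
  let p : ℝ → ι → ℝ := fun t i => φ.subgrad |h t i|
  -- `A t` bounds the conjugate modular of the subgradients at `h t`. Where it equals `1`, the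
  -- subgradients (with signs) are admissible in the Orlicz norm and give `1` plus the modular. As
  -- `A` may jump, the value `1` is only bracketed between two close points and reached by
  -- interpolation.
  let A : ℝ → ℝ := fun t => ∑ i ∈ s, (|h t i| * p t i - φ |h t i|)
  have hA0 : A 0 < 1 := by
    rw [modular_eq_sum (s := s) (fun i hi => by simp [hf i hi]), ENNReal.ofReal_lt_one] at hf1
    refine lt_of_le_of_lt (Finset.sum_le_sum fun i _ => ?_) hf1
    simp only [h, p, zero_mul, add_zero, Pi.smul_apply, smul_eq_mul, abs_mul, abs_two]
    -- The factor `2` in `hf1` comes from this bound of the subgradient term by `φ (2 t)`.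
    have h1 := φ.mul_subgrad_le (abs_nonneg ((f : ι → ℝ) i))
    have h2 := φ.nonneg (abs_nonneg ((f : ι → ℝ) i))
    linarith
  -- With mesh `δ`, the error is at most `δ * C`: moving from `t₂` to `t₁` changes both `φ |h i|`
  -- and `|h i| * p t₂ i` unfavourably by at most `δ * |g i|` times a bound on the slopes, whence
  -- the factor `2`.
  set C := ∑ i ∈ s, 2 * |(g : ι → ℝ) i| * φ (|(f : ι → ℝ) i| + T * |(g : ι → ℝ) i| + 1) with hC
  have hC0 : 0 ≤ C := Finset.sum_nonneg fun i _ =>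
    mul_nonneg (by positivity) (φ.nonneg (by positivity))
  obtain ⟨n, hn⟩ := exists_nat_gt (T * C / η)
  have hn0 : 0 < (n : ℝ) := lt_of_le_of_lt (by positivity) hn
  have hn0' : n ≠ 0 := by rintro rfl; simp at hn0
  have hex : ∃ k : ℕ, 1 ≤ A (k * (T / n)) := ⟨n, by rwa [mul_div_cancel₀ _ hn0.ne']⟩
  classical
  set k := Nat.find hex with hk
  have hk1 : 1 ≤ A (k * (T / n)) := Nat.find_spec hex
  have hk0 : k ≠ 0 := by
    intro h0
    rw [h0] at hk1
    simp only [Nat.cast_zero, zero_mul] at hk1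
    linarith
  obtain ⟨l, hl⟩ := Nat.exists_eq_succ_of_ne_zero hk0
  have hkn : k ≤ n := Nat.find_min' hex (by rwa [mul_div_cancel₀ _ hn0.ne'])
  have hl1 : A (l * (T / n)) < 1 := not_le.1 (Nat.find_min hex (by omega))
  set δ := T / n with hδ
  have hδ0 : 0 ≤ δ := by positivity
  set t₁ := (l : ℝ) * δ with ht₁
  set t₂ := (k : ℝ) * δ with ht₂
  have ht₁0 : 0 ≤ t₁ := by positivity
  have ht : t₂ = t₁ + δ := by
    rw [ht₂, ht₁, hl]
    push_cast
    ring
  have ht₂T : t₂ ≤ T := by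
    rw [ht₂, hδ, mul_div_assoc', div_le_iff₀ hn0, mul_comm]
    have : (k : ℝ) ≤ n := by exact_mod_cast hkn
    gcongr
  have hpC : ∀ t, 0 ≤ t → t ≤ T → ∀ i,
      p t i ≤ φ (|(f : ι → ℝ) i| + T * |(g : ι → ℝ) i| + 1) := by
    intro t h0 h1 i
    refine (φ.subgrad_le (abs_nonneg _)).trans (φ.mono (by positivity) ?_)
    gcongr
    refine (abs_add_le _ _).trans ?_
    rw [abs_mul, abs_of_nonneg h0]
    gcongr
  have hstep : ∀ i, |h t₂ i - h t₁ i| = δ * |(g : ι → ℝ) i| := by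
    intro i
    have : h t₂ i - h t₁ i = δ * (g : ι → ℝ) i := by
      simp only [h, ht]
      ring
    rw [this, abs_mul, abs_of_nonneg hδ0]
  have hδC : δ * C < η := by
    rw [hδ, div_mul_eq_mul_div, div_lt_iff₀ hn0]
    rwa [div_lt_iff₀ hη, mul_comm (n : ℝ)] at hn
  have hd : 0 < A t₂ - A t₁ := by linarith
  -- The weight for which the interpolated value of `A` is exactly `1`. Convexity of `φ*` then makes
  -- the interpolated subgradients admissible.
  set θ := (1 - A t₁) / (A t₂ - A t₁) with hθ
  have hθ0 : 0 ≤ θ := div_nonneg (by linarith) hd.le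
  have hθ1 : θ ≤ 1 := (div_le_one hd).2 (by linarith)
  have hθA : (1 - θ) * A t₁ + θ * A t₂ = 1 := by
    have : θ * (A t₂ - A t₁) = 1 - A t₁ := div_mul_cancel₀ _ hd.ne'
    linarith
  let r : ι → ℝ := fun i => (1 - θ) * p t₁ i + θ * p t₂ i
  have hr : ∀ i, 0 ≤ r i := fun i => add_nonneg
    (mul_nonneg (by linarith) (φ.subgrad_nonneg _)) (mul_nonneg hθ0 (φ.subgrad_nonneg _))
  let y : ι → ℝ := fun i => if i ∈ s then (if 0 ≤ h t₁ i then r i else -r i) else 0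
  have hy_abs : ∀ i ∈ s, |y i| = r i := by
    intro i hi
    simp only [y, if_pos hi]
    split_ifs
    · exact abs_of_nonneg (hr i)
    · rw [abs_neg]; exact abs_of_nonneg (hr i)
  have hgap : ∀ t i, 0 ≤ |h t i| * p t i - φ |h t i| := fun t i =>
    sub_nonneg.2 (φ.map_le_mul_subgrad (abs_nonneg _))
  have hy : φ.conjModular y ≤ 1 := by
    unfold conjModular
    rw [tsum_eq_sum (s := s) fun i hi => by simp [y, hi, φ.conj_zero]]
    have h1 : ∀ i ∈ s, φ.conj |y i| ≤ ENNReal.ofReal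
        ((1 - θ) * (|h t₁ i| * p t₁ i - φ |h t₁ i|) + θ * (|h t₂ i| * p t₂ i - φ |h t₂ i|)) := by
      intro i hi
      rw [hy_abs i hi]
      have h2 := φ.conj_sum_le Finset.univ ![1 - θ, θ] ![p t₁ i, p t₂ i]
        (by intro j _; fin_cases j <;> simp [hθ0, hθ1]) (by simp)
      simp only [Fin.sum_univ_two, Matrix.cons_val_zero, Matrix.cons_val_one] at h2
      refine h2.trans ?_
      rw [ENNReal.ofReal_add (mul_nonneg (by linarith) (hgap _ _)) (mul_nonneg hθ0 (hgap _ _)),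
        ENNReal.ofReal_mul (by linarith), ENNReal.ofReal_mul hθ0]
      gcongr
      · exact φ.conj_subgrad_le (abs_nonneg _)
      · exact φ.conj_subgrad_le (abs_nonneg _)
    refine (Finset.sum_le_sum h1).trans ?_
    rw [← ENNReal.ofReal_sum_of_nonneg fun i _ =>
        add_nonneg (mul_nonneg (by linarith) (hgap _ _)) (mul_nonneg hθ0 (hgap _ _)),
      Finset.sum_add_distrib, ← Finset.mul_sum, ← Finset.mul_sum]
    change ENNReal.ofReal ((1 - θ) * A t₁ + θ * A t₂) ≤ 1
    rw [hθA, ENNReal.ofReal_one]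
  have hcoe : ∀ i, ((f + t₁ • g : φ.space ι) : ι → ℝ) i = h t₁ i := fun i => by simp [h]
  have hsupp : ∀ i ∉ s, ((f + t₁ • g : φ.space ι) : ι → ℝ) i = 0 := fun i hi => by
    simp [hf i hi, hg i hi]
  refine ⟨t₁, ?_⟩
  have hle := le_orliczNorm (f + t₁ • g) hy
  have hpair : ∑' i, ((f + t₁ • g : φ.space ι) : ι → ℝ) i * y i = ∑ i ∈ s, |h t₁ i| * r i := by
    rw [tsum_eq_sum (s := s) fun i hi => by rw [hsupp i hi, zero_mul]]
    refine Finset.sum_congr rfl fun i hi => ?_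
    rw [hcoe]
    simp only [y, if_pos hi]
    split_ifs with h0
    · rw [abs_of_nonneg h0]
    · rw [abs_of_neg (not_le.1 h0)]; ring
  have hlow : 1 + ∑ i ∈ s, φ |h t₁ i| - δ * C ≤ ∑ i ∈ s, |h t₁ i| * r i := by
    have hterm : ∀ i ∈ s, (1 - θ) * (|h t₁ i| * p t₁ i - φ |h t₁ i|) +
        θ * (|h t₂ i| * p t₂ i - φ |h t₂ i|) + φ |h t₁ i| -
        δ * (2 * |(g : ι → ℝ) i| * φ (|(f : ι → ℝ) i| + T * |(g : ι → ℝ) i| + 1)) ≤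
        |h t₁ i| * r i := by
      intro i _
      have b1 := hpC t₁ ht₁0 (by linarith) i
      have b2 := hpC t₂ (by linarith) ht₂T i
      have p1 : 0 ≤ p t₁ i := φ.subgrad_nonneg _
      have p2 : 0 ≤ p t₂ i := φ.subgrad_nonneg _
      set K := φ (|(f : ι → ℝ) i| + T * |(g : ι → ℝ) i| + 1)
      have hK : 0 ≤ K := p1.trans b1
      have d1 := abs_le.1 ((abs_abs_sub_abs_le (h t₂ i) (h t₁ i)).trans_eq (hstep i))
      have s1 : φ |h t₁ i| + p t₁ i * (|h t₂ i| - |h t₁ i|) ≤ φ |h t₂ i| :=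
        φ.map_add_subgrad_le (abs_nonneg (h t₁ i)) (abs_nonneg (h t₂ i))
      set G := δ * |(g : ι → ℝ) i|
      have hG : 0 ≤ G := by positivity
      have e1 : -(G * K) ≤ p t₁ i * (|h t₂ i| - |h t₁ i|) := by nlinarith
      have e2 : (|h t₂ i| - |h t₁ i|) * p t₂ i ≤ G * K := by nlinarith
      have e3 : |h t₂ i| * p t₂ i - φ |h t₂ i| + φ |h t₁ i| - 2 * (G * K) ≤ |h t₁ i| * p t₂ i := by
        linarith
      have e4 : θ * (|h t₂ i| * p t₂ i - φ |h t₂ i| + φ |h t₁ i| - 2 * (G * K)) ≤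
          θ * (|h t₁ i| * p t₂ i) := mul_le_mul_of_nonneg_left e3 hθ0
      have e5 : θ * (2 * (G * K)) ≤ 2 * (G * K) := mul_le_of_le_one_left (by positivity) hθ1
      have e6 : δ * (2 * |(g : ι → ℝ) i| * K) = 2 * (G * K) := by simp only [G]; ring
      rw [e6]
      simp only [r]
      linarith
    have hsum := Finset.sum_le_sum hterm
    rw [Finset.sum_sub_distrib, Finset.sum_add_distrib, Finset.sum_add_distrib, ← Finset.mul_sum,
      ← Finset.mul_sum, ← Finset.mul_sum, ← hC] at hsum
    change (1 - θ) * A t₁ + θ * A t₂ + _ - _ ≤ _ at hsum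
    rwa [hθA] at hsum
  rw [modular_eq_sum hsupp, ← ENNReal.ofReal_add (orliczNorm_nonneg _) hη.le, ← ENNReal.ofReal_one,
    ← ENNReal.ofReal_add zero_le_one (Finset.sum_nonneg fun i _ => φ.nonneg (abs_nonneg _))]
  refine ENNReal.ofReal_le_ofReal ?_
  simp only [hcoe]
  linarith

end OrliczFunction

namespace OrliczFunction

variable {φ : OrliczFunction} {ι : Type*}

/-- If `φ*` is finite, `φ` is superlinear, so the slope `p` at some `T` exceeds `u = (1 + φ 2) / 2`.
The supporting line at `T`, evaluated at `2`, gives `T p - φ T ≥ 2 p - φ 2 ≥ 1`. -/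
theorem exists_one_le_mul_subgrad_sub (h : ∀ u : ℝ, φ.conj u < ∞) :
    ∃ T : ℝ, 0 ≤ T ∧ 1 ≤ T * φ.subgrad T - φ T := by
  set u := (1 + φ 2) / 2
  obtain ⟨T, hT, hu⟩ : ∃ T : ℝ, 0 < T ∧ u * T < φ T := by
    by_contra! hc
    refine (h (u + 1)).ne (ENNReal.eq_top_of_forall_nnreal_le fun r => ?_)
    refine le_trans ?_ (le_iSup (fun t : Set.Ioi (0 : ℝ) => ENNReal.ofReal (t * (u + 1) - φ t))
      ⟨(r : ℝ) + 1, Set.mem_Ioi.2 (by positivity)⟩)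
    rw [← ENNReal.ofReal_coe_nnreal]
    refine ENNReal.ofReal_le_ofReal ?_
    have := hc ((r : ℝ) + 1) (by positivity)
    simp only
    nlinarith [r.2]
  refine ⟨T, hT.le, ?_⟩
  have h1 := φ.map_le_mul_subgrad hT.le
  have h2 := φ.map_add_subgrad_le hT.le zero_le_two
  have h3 : u < φ.subgrad T := lt_of_mul_lt_mul_left (by linarith) hT.le
  have h4 : u * 2 = 1 + φ 2 := by simp only [u]; ring
  nlinarith

/-- If `φ t > u t` for one `t`, this persists beyond `t` because `φ t / t` is non-decreasing. Then
only arguments up to `t` contribute to `φ* u`, which would be finite. -/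
theorem map_le_mul_of_conj_eq_top {u : ℝ} (h : φ.conj u = ∞) {t : ℝ} (ht : 0 ≤ t) :
    φ t ≤ u * t := by
  by_contra! hc
  have ht0 : 0 < t := by
    rcases ht.eq_or_lt with rfl | h
    · simp [φ.map_zero] at hc
    · exact h
  have : φ.conj u ≤ ENNReal.ofReal (t * |u|) := by
    refine iSup_le fun s => ?_
    have hs : (0 : ℝ) < s := s.2
    rcases le_total (s : ℝ) t with hst | hst
    · refine ENNReal.ofReal_le_ofReal ?_
      have h1 := φ.nonneg hs.le
      have h2 : (s : ℝ) * u ≤ t * |u| :=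
        (mul_le_mul_of_nonneg_left (le_abs_self u) hs.le).trans
          (mul_le_mul_of_nonneg_right hst (abs_nonneg u))
      linarith
    · have h1 := φ.mul_map_le ht hst
      have h2 : s * u - φ s ≤ 0 := by
        have h3 : t * (s * u) ≤ t * φ s := by
          have : s * (u * t) ≤ s * φ t := mul_le_mul_of_nonneg_left hc.le hs.le
          linarith
        linarith [le_of_mul_le_mul_left h3 ht0]
      rw [ENNReal.ofReal_of_nonpos h2]
      exact zero_le
  exact absurd (h ▸ this) (by simp)

/-- No slope of `φ` can exceed `u`, since a steeper supporting line would eventually lie above `u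
s`. -/
theorem map_add_le_of_conj_eq_top {u : ℝ} (h : φ.conj u = ∞) {a b : ℝ} (ha : 0 ≤ a) (hb : 0 ≤ b) :
    φ (a + b) ≤ φ a + u * b := by
  set t := a + b
  have ht : 0 ≤ t := add_nonneg ha hb
  set p := φ.subgrad t
  have hp : p ≤ u := by
    by_contra! hc
    have hd : 0 < p - u := sub_pos.2 hc
    -- Just beyond the point where `p (s - t)` overtakes `u s`.
    set s := p * t / (p - u) + 1
    have hp0 : 0 ≤ p := φ.subgrad_nonneg _
    have hs : 0 ≤ s := by positivity
    have h1 := φ.map_add_subgrad_le ht hs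
    have h2 := φ.map_le_mul_of_conj_eq_top h hs
    have h3 := φ.nonneg ht
    have h4 : (p - u) * s = p * t + (p - u) := by
      simp only [s, mul_add, mul_one]
      rw [mul_div_cancel₀ _ hd.ne']
    change φ t + p * (s - t) ≤ φ s at h1
    nlinarith
  have h1 := φ.map_add_subgrad_le ht ha
  have h2 : a - t = -b := by simp [t]
  rw [h2] at h1
  nlinarith

theorem finite_setOf_le_abs (htop : ¬ φ.EquivalentToPow ∞) (z : φ.space ι) {ε : ℝ} (hε : 0 < ε) :
    {i | ε ≤ |(z : ι → ℝ) i|}.Finite := by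
  obtain ⟨s, hs, h⟩ := z.2
  have hpos : 0 < φ (s⁻¹ * ε) := φ.pos_of_not_equivalentToPow_top htop (by positivity)
  refine (ENNReal.finite_const_le_of_tsum_ne_top h.ne
    (ENNReal.ofReal_pos.2 hpos).ne').subset fun i hi => ?_
  refine ENNReal.ofReal_le_ofReal (φ.mono (by positivity) ?_)
  simp only [Pi.smul_apply, smul_eq_mul, abs_mul, abs_inv, abs_of_pos hs]
  gcongr
  exact hi

/-- This replaces large multiples of `e_i` when `φ*` is not finite, since one coordinate may then
never contribute `1`. A coordinate of modulus at least `1` contributes at least `δ / 2`, where `φ δ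
≤ δ / 2`, and any `n + m` coordinates carry a vector of `F` with at least `m` nonzero entries. The
size of `J` does not depend on `S`. -/
theorem exists_far_vector (h1 : ¬ φ.EquivalentToPow 1) [Infinite ι]
    {F : Submodule ℝ (φ.space ι)} {n : ℕ} (hcodim : Module.rank ℝ (φ.space ι ⧸ F) = n) :
    ∃ m : ℕ, ∀ S : Set ι, S.Finite → ∃ (J : Finset ι) (g : φ.space ι), J.card = m ∧
      Disjoint (J : Set ι) S ∧ g ∈ F ∧ (∀ i ∉ J, (g : ι → ℝ) i = 0) ∧
      ∃ T : ℝ, 0 ≤ T ∧ 1 ≤ ∑ i ∈ J, (|T * (g : ι → ℝ) i| * φ.subgrad |T * (g : ι → ℝ) i| -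
        φ |T * (g : ι → ℝ) i|) := by
  obtain ⟨δ, hδ, hd⟩ := φ.exists_map_le_mul h1 (half_pos one_pos)
  obtain ⟨m, hm⟩ := exists_nat_gt (2 / δ)
  refine ⟨n + m, fun S hS => ?_⟩
  obtain ⟨J, hJS, hJ⟩ := hS.infinite_compl.exists_subset_card_eq (n + m)
  obtain ⟨v, hv, hcard⟩ := exists_mem_finrank_le_card_support (F.comap (φ.extend J))
  have hr := card_le_finrank_comap_extend_add hcodim J
  refine ⟨J, φ.extend J v, hJ, Set.disjoint_left.2 fun i hi => hJS hi, hv,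
    fun i hi => extend_apply_of_notMem J v hi, ?_⟩
  obtain ⟨T, hT⟩ : ∃ T : ℝ, ∀ j : J, v j ≠ 0 → 1 / |v j| ≤ T := by
    obtain ⟨T, hT⟩ := (Set.finite_range fun j : J => 1 / |v j|).bddAbove
    exact ⟨T, fun j _ => hT ⟨j, rfl⟩⟩
  refine ⟨max T 0, le_max_right _ _, ?_⟩
  rw [← Finset.sum_coe_sort J]
  simp only [extend_apply_coe]
  have hgap : ∀ t : ℝ, 0 ≤ |t| * φ.subgrad |t| - φ |t| := fun t =>
    sub_nonneg.2 (φ.map_le_mul_subgrad (abs_nonneg _))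
  have hlow : ∀ t : ℝ, 1 ≤ |t| → δ / 2 ≤ |t| * φ.subgrad |t| - φ |t| := fun t ht => by
    have h0 := φ.map_add_subgrad_le (abs_nonneg t) hδ.le
    have h2 := hd δ hδ.le le_rfl
    have h3 : 1 ≤ φ.subgrad |t| := by
      have h4 := φ.map_le_mul_subgrad (abs_nonneg t)
      have h5 := φ.self_le_map ht
      exact le_of_mul_le_mul_left (by linarith) (by linarith : 0 < |t|)
    nlinarith
  calc (1 : ℝ) ≤ (Finset.univ.filter fun j : J => v j ≠ 0).card • (δ / 2) := by
        have : (m : ℝ) ≤ ((Finset.univ.filter fun j : J => v j ≠ 0).card : ℝ) := by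
          have : m ≤ (Finset.univ.filter fun j : J => v j ≠ 0).card := by omega
          exact_mod_cast this
        rw [nsmul_eq_mul]
        rw [div_lt_iff₀ hδ] at hm
        nlinarith
    _ ≤ ∑ j ∈ Finset.univ.filter fun j : J => v j ≠ 0, _ := by
        refine Finset.card_nsmul_le_sum _
          (fun j : J => |max T 0 * v j| * φ.subgrad |max T 0 * v j| - φ |max T 0 * v j|) _
          fun j hj => hlow _ ?_
        have hj' : v j ≠ 0 := by simpa using hj
        have h3 := (hT j hj').trans (le_max_left T 0)
        rw [div_le_iff₀ (abs_pos.2 hj')] at h3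
        rwa [abs_mul, abs_of_nonneg (le_max_right T 0)]
    _ ≤ _ := Finset.sum_le_sum_of_subset_of_nonneg (Finset.subset_univ _) fun j _ _ => hgap _

/-- On small finitely supported vectors `f` of a 1-complemented subspace, the modular satisfies the
same orthogonality relation `φ(f) ≤ φ(f + z)` as the norm. -/
theorem modular_le_modular_add (htop : ¬ φ.EquivalentToPow ∞) (h1 : ¬ φ.EquivalentToPow 1)
    {N : φ.space ι → ℝ}
    (hN : N = φ.luxemburgNorm ∨ (N = φ.orliczNorm ∧ (Finite ι → ∀ u : ℝ, φ.conj u < ∞)))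
    {F : Submodule ℝ (φ.space ι)} {n : ℕ} (hcodim : Module.rank ℝ (φ.space ι ⧸ F) = n)
    {P : φ.space ι →ₗ[ℝ] φ.space ι} (hPF : ∀ f ∈ F, P f = f) (hP : ∀ x, N (P x) ≤ N x)
    {i : ι} (hi : φ.unitVec i ∈ F) {f : φ.space ι} (hf : f ∈ F) (hfi : (f : ι → ℝ) i = 0)
    (hfin : (Function.support (f : ι → ℝ)).Finite)
    (hf1 : φ.modular ((2 : ℝ) • (f : ι → ℝ)) < 1) {z : φ.space ι} (hz : P z = 0) :
    φ.modular (f : ι → ℝ) ≤ φ.modular ((f + z : φ.space ι) : ι → ℝ) := by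
  classical
  have hsym : IsSymmetricNorm N := by
    rcases hN with rfl | ⟨rfl, -⟩
    · exact isSymmetricNorm_luxemburgNorm
    · exact isSymmetricNorm_orliczNorm
  have hflip := hsym.norm_le_of_flip hP (hPF _ hi) (hPF f hf) hfi hz
  set z' := z - (z : ι → ℝ) i • φ.unitVec i with hz'
  have hz'i : ((f + z' : φ.space ι) : ι → ℝ) i = 0 := by
    simp [hz', hfi, unitVec_apply_self]
  have hmono : φ.modular ((f + z' : φ.space ι) : ι → ℝ) ≤
      φ.modular ((f + z : φ.space ι) : ι → ℝ) := by
    refine φ.modular_mono fun j => ?_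
    by_cases hj : j = i
    · subst hj
      rw [hz'i]
      simp
    · simp [hz', unitVec_apply_of_ne hj]
  have hf_le : φ.modular (f : ι → ℝ) ≤ 1 := by
    refine (φ.modular_mono fun j => ?_).trans hf1.le
    simp only [Pi.smul_apply, smul_eq_mul, abs_mul, abs_two]
    linarith [abs_nonneg ((f : ι → ℝ) j)]
  rcases hN with rfl | ⟨rfl, hconj⟩
  · exact (modular_le_of_luxemburgNorm_le hfi hz'i hf_le hflip).trans hmono
  -- If `φ*` is finite, a multiple of `e_i` brings the Orlicz norm close to `1` plus the modular.
  -- Both vectors compared vanish at `i` apart from it, so its modular cancels.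
  by_cases hc : ∀ u : ℝ, φ.conj u < ∞
  · refine le_trans ?_ hmono
    refine ENNReal.le_of_forall_pos_le_add fun η hη _ => ?_
    obtain ⟨T, hT, hT1⟩ := exists_one_le_mul_subgrad_sub hc
    obtain ⟨t, ht⟩ := exists_one_add_modular_le (f := f) (g := φ.unitVec i)
      (s := insert i hfin.toFinset) (by
        intro j hj
        simpa using (Finset.mem_insert.not.1 hj ∘ Or.inr))
      (by
        intro j hj
        exact unitVec_apply_of_ne fun e => hj (by simp [e]))
      hf1 hT (by
        refine hT1.trans (le_trans (le_of_eq ?_) (Finset.single_le_sum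
          (f := fun j => |(f : ι → ℝ) j + T * (φ.unitVec i : ι → ℝ) j| *
            φ.subgrad |(f : ι → ℝ) j + T * (φ.unitVec i : ι → ℝ) j| -
            φ |(f : ι → ℝ) j + T * (φ.unitVec i : ι → ℝ) j|)
          (fun j _ => sub_nonneg.2 (φ.map_le_mul_subgrad (abs_nonneg _)))
          (Finset.mem_insert_self i _)))
        simp [hfi, unitVec_apply_self, abs_of_nonneg hT]) (η := η) hη
    have hadd : ∀ x : φ.space ι, (x : ι → ℝ) i = 0 →
        φ.modular ((t • φ.unitVec i + x : φ.space ι) : ι → ℝ) =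
          ENNReal.ofReal (φ |t|) + φ.modular (x : ι → ℝ) := by
      intro x hx
      rw [Submodule.coe_add, modular_add_of_disjoint, modular_smul_unitVec]
      intro j
      by_cases hj : j = i
      · right; rw [hj, hx]
      · left; simp [unitVec_apply_of_ne hj]
    rw [add_comm f] at ht
    have h2 := (ENNReal.ofReal_le_ofReal (hflip t)).trans (ofReal_orliczNorm_le _)
    have h3 := ht.trans (add_le_add_left h2 _)
    rw [hadd _ hfi, hadd _ hz'i, ENNReal.ofReal_coe_nnreal] at h3
    exact ENNReal.le_add_of_one_add_add_le ENNReal.ofReal_ne_top h3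
  · push Not at hc
    obtain ⟨u, hu⟩ := hc
    rw [top_le_iff] at hu
    have hinf : Infinite ι := not_finite_iff_infinite.1 fun hfin =>
      absurd hu (hconj hfin u).ne
    have hu0 : 0 ≤ u := by
      have := φ.map_le_mul_of_conj_eq_top hu zero_le_one
      rw [φ.map_one] at this
      linarith
    refine ENNReal.le_of_forall_pos_le_add fun η hη _ => ?_
    obtain ⟨m, hm⟩ := exists_far_vector h1 hcodim
    have hη2 : (0 : ℝ) < η / 2 := by positivity
    -- Now `φ` is `u`-Lipschitz. On the `m` coordinates of `J` the vector `z` will be at most `ε`,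
    -- so it changes the modular there by at most `m u ε ≤ η / 2`.
    set ε : ℝ := η / 2 / (u * m + 1) with hε
    have hε0 : 0 < ε := by positivity
    obtain ⟨J, g, hJm, hJ, hgF, hg, T, hT, hT1⟩ := hm _
      (hfin.union (finite_setOf_le_abs htop z hε0))
    have hfJ : ∀ j ∈ J, (f : ι → ℝ) j = 0 := fun j hj => by
      by_contra h
      exact Set.disjoint_left.1 hJ hj (Or.inl h)
    have hzJ : ∀ j ∈ J, |(z : ι → ℝ) j| ≤ ε := fun j hj => by
      by_contra! h
      exact Set.disjoint_left.1 hJ hj (Or.inr h.le)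
    obtain ⟨t, ht⟩ := exists_one_add_modular_le (f := f) (g := g)
      (s := J ∪ hfin.toFinset) (by
        intro j hj
        simpa using (Finset.mem_union.not.1 hj ∘ Or.inr))
      (fun j hj => hg j fun h => hj (Finset.mem_union_left _ h))
      hf1 hT (by
        refine hT1.trans (le_trans (le_of_eq ?_) (Finset.sum_le_sum_of_subset_of_nonneg
          (Finset.subset_union_left (s₁ := J))
          (fun j _ _ => sub_nonneg.2 (φ.map_le_mul_subgrad (abs_nonneg _)))))
        refine Finset.sum_congr rfl fun j hj => ?_
        rw [hfJ j hj, zero_add]) hη2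
    -- Since `g ∈ F`, contractivity of `P` applies directly; no sign change is needed.
    have hPg : P (f + t • g + z) = f + t • g := by
      rw [map_add, map_add, map_smul, hPF f hf, hPF g hgF, hz, add_zero]
    have h2 := hP (f + t • g + z)
    rw [hPg] at h2
    have h3 := (ENNReal.ofReal_le_ofReal h2).trans (ofReal_orliczNorm_le _)
    have h4 := ht.trans (add_le_add_left h3 _)
    have h5 : φ.modular ((f + t • g : φ.space ι) : ι → ℝ) =
        φ.modular ((t • g : φ.space ι) : ι → ℝ) + φ.modular (f : ι → ℝ) := by
      rw [Submodule.coe_add, modular_add_of_disjoint, add_comm]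
      intro j
      by_cases hj : j ∈ J
      · left; exact hfJ j hj
      · right; simp [hg j hj]
    have h6 : φ.modular ((f + t • g + z : φ.space ι) : ι → ℝ) ≤
        φ.modular ((t • g : φ.space ι) : ι → ℝ) +
          (φ.modular ((f + z : φ.space ι) : ι → ℝ) + ENNReal.ofReal (η / 2)) := by
      have hsum : ∑' j, (if j ∈ J then ENNReal.ofReal (u * ε) else 0) ≤ ENNReal.ofReal (η / 2) := by
        rw [tsum_eq_sum (s := J) fun j hj => by simp [hj]]
        rw [Finset.sum_congr rfl fun j hj => if_pos hj, Finset.sum_const, hJm, nsmul_eq_mul,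
          ← ENNReal.ofReal_natCast, ← ENNReal.ofReal_mul (by positivity)]
        refine ENNReal.ofReal_le_ofReal ?_
        rw [hε, mul_div_assoc', mul_div_assoc', div_le_iff₀ (by positivity)]
        nlinarith
      refine le_trans ?_ (add_le_add_right (add_le_add_right hsum _) _)
      unfold modular
      rw [← ENNReal.tsum_add, ← ENNReal.tsum_add]
      refine ENNReal.tsum_le_tsum fun j => ?_
      by_cases hj : j ∈ J
      · rw [if_pos hj]
        have h7 : |((f + t • g + z : φ.space ι) : ι → ℝ) j| ≤
            |((t • g : φ.space ι) : ι → ℝ) j| + |(z : ι → ℝ) j| := by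
          refine le_trans (le_of_eq ?_) (abs_add_le _ _)
          simp [hfJ j hj]
        have h8 := (φ.mono (abs_nonneg _) h7).trans
          (φ.map_add_le_of_conj_eq_top hu (abs_nonneg _) (abs_nonneg _))
        have h9 : u * |(z : ι → ℝ) j| ≤ u * ε := mul_le_mul_of_nonneg_left (hzJ j hj) hu0
        refine (ENNReal.ofReal_le_ofReal (h8.trans (add_le_add_right h9 _))).trans ?_
        rw [ENNReal.ofReal_add (φ.nonneg (abs_nonneg _)) (by positivity)]
        gcongr
        exact le_add_self
      · rw [if_neg hj, add_zero]
        refine le_trans (le_of_eq ?_) le_add_self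
        simp [hg j hj]
    rw [h5] at h4
    have hfin' : φ.modular ((t • g : φ.space ι) : ι → ℝ) ≠ ∞ := by
      rw [modular_eq_sum (s := J) fun j hj => by simp [hg j hj]]
      exact ENNReal.ofReal_ne_top
    have h10 := ENNReal.le_add_of_one_add_add_le hfin'
      (h4.trans (add_le_add_left (add_le_add_right h6 _) _))
    refine h10.trans (le_of_eq ?_)
    rw [add_assoc, ← ENNReal.ofReal_add hη2.le hη2.le, add_halves, ENNReal.ofReal_coe_nnreal]

end OrliczFunction

/-! ### Differentiating the modular inequality. -/

namespace OrliczFunction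

variable {φ : OrliczFunction} {ι : Type*}

theorem map_abs_mul_div (s b : ℝ) : φ |s * b| / s = b * φ.oddQuot (s * b) := by
  rcases eq_or_ne b 0 with rfl | hb
  · simp [φ.map_zero]
  · rw [oddQuot]
    field_simp

theorem tendsto_map_abs_mul_div (h1 : ¬ φ.EquivalentToPow 1) (b : ℝ) :
    Tendsto (fun s : ℝ => φ |s * b| / s) (𝓝[≠] 0) (𝓝 0) := by
  simp only [map_abs_mul_div]
  have hc : Continuous fun s : ℝ => b * φ.oddQuot (s * b) :=
    continuous_const.mul ((φ.continuous_oddQuot h1).comp (continuous_mul_const b))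
  simpa [φ.oddQuot_zero] using (hc.tendsto 0).mono_left nhdsWithin_le_nhds

theorem hasDerivAt_map_abs_mul (h1 : ¬ φ.EquivalentToPow 1) (b : ℝ) :
    HasDerivAt (fun s : ℝ => φ |s * b|) 0 0 := by
  rw [hasDerivAt_iff_tendsto_slope]
  refine (tendsto_map_abs_mul_div h1 b).congr fun s => ?_
  simp [slope_def_field, φ.map_zero]

/-- The average over `t` is differentiable even where `φ` is not: with `Ψ` an antiderivative of `φ
|·|` it equals `(Ψ (a + s b) - Ψ (s b)) / a` for `a ≠ 0`. -/
theorem hasDerivAt_integral_map_abs (h1 : ¬ φ.EquivalentToPow 1) (a b : ℝ) :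
    HasDerivAt (fun s : ℝ => ∫ t in (0 : ℝ)..1, φ |t * a + s * b|) (b * φ.oddQuot a) 0 := by
  rcases eq_or_ne a 0 with rfl | ha
  · simpa [φ.oddQuot_zero] using hasDerivAt_map_abs_mul h1 b
  have hΨ : ∀ x : ℝ, HasDerivAt (fun x : ℝ => ∫ t in (0 : ℝ)..x, φ |t|) (φ |x|) x := fun x =>
    φ.continuous_abs.integral_hasStrictDerivAt 0 x |>.hasDerivAt
  have hform : ∀ s : ℝ, ∫ t in (0 : ℝ)..1, φ |t * a + s * b| =
      a⁻¹ * ((∫ t in (0 : ℝ)..(a + s * b), φ |t|) - ∫ t in (0 : ℝ)..(s * b), φ |t|) := by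
    intro s
    simp only [fun t : ℝ => mul_comm t a]
    rw [intervalIntegral.integral_comp_mul_add (fun t => φ |t|) ha (s * b), mul_zero, mul_one,
      zero_add, smul_eq_mul, intervalIntegral.integral_interval_sub_left
        (φ.continuous_abs.intervalIntegrable _ _) (φ.continuous_abs.intervalIntegrable _ _)]
  simp only [hform]
  have hlin : HasDerivAt (fun s : ℝ => s * b) b 0 := by
    simpa using (hasDerivAt_id (0 : ℝ)).mul_const b
  have d1 : HasDerivAt (fun s : ℝ => ∫ t in (0 : ℝ)..(a + s * b), φ |t|) (φ |a| * b) 0 := by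
    have h := hΨ (a + 0 * b)
    refine (HasDerivAt.comp (0 : ℝ) h (hlin.const_add a)).congr_deriv ?_
    simp
  have d2 : HasDerivAt (fun s : ℝ => ∫ t in (0 : ℝ)..(s * b), φ |t|) 0 0 := by
    have h := hΨ (0 * b)
    refine (HasDerivAt.comp (0 : ℝ) h hlin).congr_deriv ?_
    simp [φ.map_zero]
  refine ((d1.sub d2).const_mul a⁻¹).congr_deriv ?_
  simp only [oddQuot, sub_zero]
  field_simp

/-- Integrated over `t`, the hypothesis says that `D` below has a minimum at `s = 0`; the claim is
`D' 0 = 0`. -/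
theorem sum_mul_oddQuot_eq_zero (h1 : ¬ φ.EquivalentToPow 1) {J : Finset ι} {f z : φ.space ι}
    (hf : ∀ i ∉ J, (f : ι → ℝ) i = 0)
    (h : ∀ t s : ℝ, 0 ≤ t → t ≤ 1 → φ.modular ((t • f : φ.space ι) : ι → ℝ) ≤
      φ.modular ((t • f + s • z : φ.space ι) : ι → ℝ)) :
    ∑ j ∈ J, (z : ι → ℝ) j * φ.oddQuot ((f : ι → ℝ) j) = 0 := by
  classical
  obtain ⟨r, hr, hz⟩ := z.2
  set s₀ := r⁻¹ with hs₀
  have hs₀' : 0 < s₀ := inv_pos.2 hr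
  -- The part of the modular off `J`. It does not involve `t`, because `f` vanishes there, and its
  -- sum is `o(s)` because `φ t / t → 0`.
  let R : ℝ → ι → ℝ := fun s i => if i ∈ J then 0 else φ |s * (z : ι → ℝ) i|
  have hR0 : ∀ s i, 0 ≤ R s i := fun s i => by
    simp only [R]
    split_ifs
    · exact le_rfl
    · exact φ.nonneg (abs_nonneg _)
  have hsum0 : Summable fun i => φ |s₀ * (z : ι → ℝ) i| := by
    refine summable_of_tsum_ofReal_abs_ne_top (ne_top_of_le_ne_top hz.ne (le_of_eq ?_))
    refine tsum_congr fun i => ?_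
    rw [abs_of_nonneg (φ.nonneg (abs_nonneg _))]
    rfl
  have hRle : ∀ s, |s| ≤ s₀ → ∀ i, R s i ≤ φ |s₀ * (z : ι → ℝ) i| := fun s hs i => by
    simp only [R]
    split_ifs
    · exact φ.nonneg (abs_nonneg _)
    · refine φ.mono (abs_nonneg _) ?_
      rw [abs_mul, abs_mul, abs_of_pos hs₀']
      gcongr
  have hRsum : ∀ s, |s| ≤ s₀ → Summable (R s) := fun s hs =>
    Summable.of_nonneg_of_le (hR0 s) (hRle s hs) hsum0
  have hineq : ∀ s, |s| ≤ s₀ → ∀ t, 0 ≤ t → t ≤ 1 →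
      ∑ j ∈ J, φ |t * (f : ι → ℝ) j| ≤
        ∑ j ∈ J, φ |t * (f : ι → ℝ) j + s * (z : ι → ℝ) j| + ∑' i, R s i := by
    intro s hs t ht0 ht1
    have h2 := h t s ht0 ht1
    rw [modular_eq_sum (s := J) fun i hi => by simp [hf i hi]] at h2
    have h3 : φ.modular ((t • f + s • z : φ.space ι) : ι → ℝ) = ENNReal.ofReal
        (∑ j ∈ J, φ |t * (f : ι → ℝ) j + s * (z : ι → ℝ) j| + ∑' i, R s i) := by
      rw [ENNReal.ofReal_add (Finset.sum_nonneg fun i _ => φ.nonneg (abs_nonneg _))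
        (tsum_nonneg (hR0 s)), ENNReal.ofReal_tsum_of_nonneg (hR0 s) (hRsum s hs),
        ENNReal.ofReal_sum_of_nonneg fun i _ => φ.nonneg (abs_nonneg _)]
      have h4 : ∑ j ∈ J, ENNReal.ofReal (φ |t * (f : ι → ℝ) j + s * (z : ι → ℝ) j|) =
          ∑' j, if j ∈ J then ENNReal.ofReal (φ |t * (f : ι → ℝ) j + s * (z : ι → ℝ) j|) else 0 := by
        rw [tsum_eq_sum (s := J) fun j hj => by simp [hj]]
        exact Finset.sum_congr rfl fun j hj => by rw [if_pos hj]
      rw [h4, ← ENNReal.tsum_add]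
      refine tsum_congr fun j => ?_
      by_cases hj : j ∈ J
      · simp [R, hj]
      · simp [R, hj, hf j hj]
    rw [h3] at h2
    have := (ENNReal.ofReal_le_ofReal_iff (add_nonneg
      (Finset.sum_nonneg fun i _ => φ.nonneg (abs_nonneg _)) (tsum_nonneg (hR0 s)))).1 h2
    simpa using this
  let D : ℝ → ℝ := fun s => (∑ j ∈ J, ∫ t in (0 : ℝ)..1,
    φ |t * (f : ι → ℝ) j + s * (z : ι → ℝ) j|) + ∑' i, R s i
  have hRd : HasDerivAt (fun s => ∑' i, R s i) 0 0 := by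
    rw [hasDerivAt_iff_tendsto_slope]
    have h0 : ∑' i, R 0 i = 0 := by simp [R, φ.map_zero]
    have hlim : Tendsto (fun s : ℝ => ∑' i, R s i / s) (𝓝[≠] 0) (𝓝 (∑' _ : ι, (0 : ℝ))) := by
      refine tendsto_tsum_of_dominated_convergence
        -- By monotonicity of `φ t / t`, the quotients for `|s| ≤ s₀` are dominated by the one at
        -- `s₀`, which is summable by the choice of `s₀`.
        (bound := fun i => φ |s₀ * (z : ι → ℝ) i| / s₀) (hsum0.div_const _) (fun i => ?_) ?_
      · by_cases hi : i ∈ J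
        · simp [R, hi]
        · simpa only [R, if_neg hi] using tendsto_map_abs_mul_div h1 ((z : ι → ℝ) i)
      · have hev : ∀ᶠ s : ℝ in 𝓝[≠] 0, |s| ≤ s₀ := by
          refine nhdsWithin_le_nhds ?_
          filter_upwards [Metric.ball_mem_nhds (0 : ℝ) hs₀'] with s hs
          rw [Metric.mem_ball, Real.dist_eq, sub_zero] at hs
          exact hs.le
        filter_upwards [hev, self_mem_nhdsWithin] with s hs hs0 i
        rw [Real.norm_eq_abs, abs_div, abs_of_nonneg (hR0 s i),
          div_le_div_iff₀ (abs_pos.2 hs0) hs₀']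
        by_cases hi : i ∈ J
        · simp only [R, if_pos hi, zero_mul]
          exact mul_nonneg (φ.nonneg (abs_nonneg _)) (abs_nonneg _)
        · simp only [R, if_neg hi, abs_mul, abs_of_pos hs₀']
          rcases eq_or_ne ((z : ι → ℝ) i) 0 with hzi | hzi
          · simp [hzi, φ.map_zero]
          have h2 := φ.mul_map_le (s := |s| * |(z : ι → ℝ) i|) (t := s₀ * |(z : ι → ℝ) i|)
            (by positivity) (by gcongr)
          have h3 : 0 < |(z : ι → ℝ) i| := abs_pos.2 hzi
          nlinarith
    rw [tsum_zero] at hlim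
    refine hlim.congr fun s => ?_
    rw [slope_def_field, h0, sub_zero, sub_zero, tsum_div_const]
  have hD : HasDerivAt D (∑ j ∈ J, (z : ι → ℝ) j * φ.oddQuot ((f : ι → ℝ) j)) 0 := by
    refine ((HasDerivAt.fun_sum fun j (_ : j ∈ J) =>
      hasDerivAt_integral_map_abs h1 ((f : ι → ℝ) j) ((z : ι → ℝ) j)).add hRd).congr_deriv ?_
    rw [add_zero]
  have hcont : ∀ s j, Continuous fun t : ℝ => φ |t * (f : ι → ℝ) j + s * (z : ι → ℝ) j| :=
    fun s j => φ.continuous_abs.comp ((continuous_mul_const _).add continuous_const)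
  have hint : ∀ s j, IntervalIntegrable
      (fun t : ℝ => φ |t * (f : ι → ℝ) j + s * (z : ι → ℝ) j|) MeasureTheory.volume 0 1 := fun s j =>
    (hcont s j).intervalIntegrable _ _
  have hint' : ∀ s, IntervalIntegrable (fun t : ℝ => ∑ j ∈ J,
      φ |t * (f : ι → ℝ) j + s * (z : ι → ℝ) j|) MeasureTheory.volume 0 1 := fun s =>
    (continuous_finsetSum J fun j _ => hcont s j).intervalIntegrable _ _
  have hmin : IsLocalMin D 0 := by
    filter_upwards [Metric.ball_mem_nhds (0 : ℝ) hs₀'] with s hs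
    rw [Metric.mem_ball, Real.dist_eq, sub_zero] at hs
    have e0 : D 0 = ∫ t in (0 : ℝ)..1, ∑ j ∈ J, φ |t * (f : ι → ℝ) j| := by
      rw [intervalIntegral.integral_finsetSum]
      · simp [D, R, φ.map_zero]
      · intro j _
        simpa only [zero_mul, add_zero] using hint 0 j
    have e1 : D s = ∫ t in (0 : ℝ)..1,
        (∑ j ∈ J, φ |t * (f : ι → ℝ) j + s * (z : ι → ℝ) j| + ∑' i, R s i) := by
      rw [intervalIntegral.integral_add, intervalIntegral.integral_finsetSum]
      · simp [D]
      · exact fun j _ => hint s j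
      · exact hint' s
      · exact intervalIntegrable_const
    rw [e0, e1]
    refine intervalIntegral.integral_mono_on zero_le_one ?_ ?_ fun t ht =>
      hineq s hs.le t ht.1 ht.2
    · simpa only [zero_mul, add_zero] using hint' 0
    · exact (hint' s).add intervalIntegrable_const
  exact hmin.hasDerivAt_eq_zero hD

end OrliczFunction

/-! ### Vanishing differences, polynomials, elimination of terms. -/

/-- All `m`-fold differences of `S` with base point and steps of size at most `δ` vanish. -/
def DiffsVanish : ℕ → ℝ → (ℝ → ℝ) → Prop
  | 0, δ, S => ∀ τ, |τ| ≤ δ → S τ = 0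
  | m + 1, δ, S => ∀ s, |s| ≤ δ → DiffsVanish m δ fun τ => S (τ + s) - S τ

namespace DiffsVanish

theorem const_mul {δ : ℝ} (c : ℝ) : ∀ {m : ℕ} {S : ℝ → ℝ}, DiffsVanish m δ S →
    DiffsVanish m δ fun τ => c * S τ
  | 0, S, h => fun τ hτ => by simp [h τ hτ]
  | m + 1, S, h => fun s hs => by
    simpa only [mul_sub] using const_mul c (h s hs)

theorem of_le {δ δ' : ℝ} (hδ : δ' ≤ δ) : ∀ {m : ℕ} {S : ℝ → ℝ}, DiffsVanish m δ S →
    DiffsVanish m δ' S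
  | 0, _, h => fun τ hτ => h τ (hτ.trans hδ)
  | _ + 1, _, h => fun s hs => of_le hδ (h s (hs.trans hδ))

theorem intervalIntegral {δ a b : ℝ} : ∀ {m : ℕ} {G : ℝ → ℝ → ℝ},
    Continuous (Function.uncurry G) → (∀ s ∈ Set.uIcc a b, DiffsVanish m δ (G s)) →
    DiffsVanish m δ fun τ => ∫ s in a..b, G s τ
  | 0, G, _, h => fun τ hτ => by
    have : ∫ s in a..b, G s τ = ∫ _ in a..b, (0 : ℝ) :=
      intervalIntegral.integral_congr fun s hs => h s hs τ hτ
    simpa using this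
  | m + 1, G, hG, h => fun r hr => by
    have hc : ∀ τ, Continuous fun s => G s τ := fun τ =>
      hG.comp (continuous_id.prodMk continuous_const)
    have e : ∀ τ, (∫ s in a..b, G s (τ + r)) - ∫ s in a..b, G s τ =
        ∫ s in a..b, (G s (τ + r) - G s τ) := fun τ =>
      (intervalIntegral.integral_sub ((hc _).intervalIntegrable _ _)
        ((hc _).intervalIntegrable _ _)).symm
    simp only [e]
    refine intervalIntegral ?_ fun s hs => h s hs r hr
    exact (hG.comp (continuous_fst.prodMk (continuous_snd.add continuous_const))).sub hG

/-- An `m`-fold difference looks at most `m` steps beyond its base point, hence the range `(m + 1) *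
δ`. -/
theorem of_tendsto {δ : ℝ} (hδ : 0 ≤ δ) : ∀ {m : ℕ} {G : ℕ → ℝ → ℝ} {S : ℝ → ℝ},
    (∀ k, DiffsVanish m δ (G k)) →
    (∀ τ, |τ| ≤ (m + 1) * δ → Tendsto (fun k => G k τ) atTop (𝓝 (S τ))) → DiffsVanish m δ S
  | 0, G, S, h, hlim => fun τ hτ => by
    refine tendsto_nhds_unique (hlim τ (by simpa using hτ)) ?_
    simp [fun k => h k τ hτ]
  | m + 1, G, S, h, hlim => fun s hs => by
    refine of_tendsto hδ (fun k => h k s hs) fun τ hτ => ?_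
    refine (hlim _ ?_).sub (hlim _ ?_)
    · push_cast
      linarith [abs_add_le τ s]
    · push_cast
      linarith

theorem exists_derivative_eq (p : Polynomial ℝ) : ∃ q : Polynomial ℝ, q.derivative = p := by
  induction p using Polynomial.induction_on' with
  | add p q hp hq =>
    obtain ⟨p', rfl⟩ := hp
    obtain ⟨q', rfl⟩ := hq
    exact ⟨p' + q', Polynomial.derivative_add⟩
  | monomial n a =>
    refine ⟨Polynomial.monomial (n + 1) (a / (n + 1)), ?_⟩
    rw [Polynomial.derivative_monomial]
    have : (n : ℝ) + 1 ≠ 0 := by positivity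
    simp [div_mul_cancel₀ _ this]

/-- A local version of Fréchet's theorem on functions with vanishing differences. -/
theorem exists_polynomial : ∀ {m : ℕ} {δ : ℝ} {S : ℝ → ℝ}, 0 < δ → Continuous S →
    DiffsVanish m δ S → ∃ p : Polynomial ℝ, ∃ ε > 0, ∀ τ, |τ| ≤ ε → S τ = p.eval τ
  | 0, δ, S, hδ, _, h => ⟨0, δ, hδ, fun τ hτ => by simpa using h τ hτ⟩
  | m + 1, δ, S, hδ, hS, h => by
    let T : ℝ → ℝ := fun x => ∫ s in (0 : ℝ)..x, S s
    have hT : ∀ x, HasDerivAt T (S x) x := fun x =>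
      (hS.integral_hasStrictDerivAt 0 x).hasDerivAt
    -- This is the integral of `S (τ + s) - S τ` over `s ∈ [0, δ]`, so its `m`-fold differences
    -- vanish and it is a polynomial `p` near `0`. Solving for `S` shows that `S` is differentiable
    -- there.
    let U : ℝ → ℝ := fun τ => T (τ + δ) - T τ - δ * S τ
    have hTc : Continuous T := continuous_iff_continuousAt.2 fun x => (hT x).continuousAt
    have hU : Continuous U :=
      ((hTc.comp (continuous_add_const δ)).sub hTc).sub (continuous_const.mul hS)
    have hUv : DiffsVanish m δ U := by
      have h1 : DiffsVanish m δ fun τ => ∫ s in (0 : ℝ)..δ, (S (τ + s) - S τ) := by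
        refine intervalIntegral (G := fun s τ => S (τ + s) - S τ) ?_ fun s hs => h s ?_
        · exact (hS.comp (continuous_snd.add continuous_fst)).sub (hS.comp continuous_snd)
        · rw [Set.uIcc_of_le hδ.le] at hs
          rw [abs_of_nonneg hs.1]
          exact hs.2
      have e : (fun τ => ∫ s in (0 : ℝ)..δ, (S (τ + s) - S τ)) = U := by
        funext τ
        have hi : IntervalIntegrable (fun s => S (τ + s)) MeasureTheory.volume 0 δ :=
          (hS.comp (continuous_const_add τ)).intervalIntegrable _ _
        rw [intervalIntegral.integral_sub hi intervalIntegrable_const,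
          intervalIntegral.integral_comp_add_left, intervalIntegral.integral_const, add_zero,
          ← intervalIntegral.integral_interval_sub_left (hS.intervalIntegrable 0 (τ + δ))
            (hS.intervalIntegrable 0 τ)]
        simp [U, T]
      rwa [e] at h1
    obtain ⟨p, ε₁, hε₁, hp⟩ := exists_polynomial hδ hU hUv
    -- The derivative of `S` near `0`. As a limit of difference quotients of `S`, it too has
    -- vanishing `m`-fold differences, so it is a polynomial near `0`.
    let D : ℝ → ℝ := fun τ => (S (τ + δ) - S τ - p.derivative.eval τ) / δ
    have hD : Continuous D :=
      (((hS.comp (continuous_add_const δ)).sub hS).sub p.derivative.continuous).div_const δ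
    have hderiv : ∀ τ, |τ| < ε₁ → HasDerivAt S (D τ) τ := by
      intro τ hτ
      have h1 : HasDerivAt (fun x => (T (x + δ) - T x - p.eval x) / δ) (D τ) τ :=
        ((((hT (τ + δ)).comp_add_const τ δ).sub (hT τ)).sub (p.hasDerivAt τ)).div_const δ
      refine h1.congr_of_eventuallyEq ?_
      have hn : {x : ℝ | |x| < ε₁} ∈ 𝓝 τ :=
        (isOpen_lt continuous_abs continuous_const).mem_nhds hτ
      filter_upwards [hn] with x hx
      rw [← hp x (le_of_lt hx)]
      simp only [U]
      field_simp
      ring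
    -- Keeps the range `(m + 1) * δ'` of `of_tendsto` strictly inside the interval where `S` is
    -- differentiable.
    set δ' := min δ (ε₁ / (m + 2)) with hδ'
    have hm : (0 : ℝ) < m + 2 := by positivity
    have hδ'0 : 0 < δ' := lt_min hδ (by positivity)
    have hDv : DiffsVanish m δ' D := by
      refine of_tendsto hδ'0.le (G := fun k τ => (δ' / (k + 1))⁻¹ * (S (τ + δ' / (k + 1)) - S τ))
        (fun k => (((h _ ?_)).of_le (min_le_left _ _)).const_mul _) fun τ hτ => ?_
      · have : (1 : ℝ) ≤ k + 1 := by simp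
        rw [abs_of_nonneg (by positivity)]
        exact (div_le_self hδ'0.le this).trans (min_le_left _ _)
      · have hτ' : |τ| < ε₁ := by
          have h1 : δ' ≤ ε₁ / (m + 2) := min_le_right _ _
          rw [le_div_iff₀ hm] at h1
          nlinarith
        have h2 := (hderiv τ hτ').tendsto_slope_zero
        have h3 : Tendsto (fun k : ℕ => δ' / ((k : ℝ) + 1)) atTop (𝓝[≠] 0) := by
          rw [tendsto_nhdsWithin_iff]
          refine ⟨tendsto_const_nhds.div_atTop
            (tendsto_atTop_add_const_right _ _ tendsto_natCast_atTop_atTop), ?_⟩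
          exact Eventually.of_forall fun k => (by positivity : δ' / ((k : ℝ) + 1) ≠ 0)
        exact h2.comp h3
    obtain ⟨p₂, ε₂, hε₂, hp₂⟩ := exists_polynomial hδ'0 hD hDv
    obtain ⟨q, hq⟩ := exists_derivative_eq p₂
    set ε := min (ε₁ / 2) ε₂ with hε
    have hε0 : 0 < ε := lt_min (by positivity) hε₂
    refine ⟨q + Polynomial.C (S 0 - q.eval 0), ε, hε0, fun τ hτ => ?_⟩
    have hd : ∀ x ∈ Set.Icc (-ε) ε, HasDerivWithinAt (fun x => S x - q.eval x) 0
        (Set.Icc (-ε) ε) x := by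
      intro x hx
      have hx' : |x| ≤ ε := abs_le.2 hx
      have h1 : |x| < ε₁ := lt_of_le_of_lt (hx'.trans (min_le_left _ _)) (by linarith)
      have h2 := (hderiv x h1).sub (q.hasDerivAt x)
      rw [hq, hp₂ x (hx'.trans (min_le_right _ _)), sub_self] at h2
      exact h2.hasDerivWithinAt
    have h1 := (convex_Icc (-ε) ε).norm_image_sub_le_of_norm_hasDerivWithin_le (C := 0)
      hd (fun x _ => by simp) (⟨by linarith, hε0.le⟩ : (0 : ℝ) ∈ Set.Icc (-ε) ε) (abs_le.1 hτ)
    rw [zero_mul, norm_le_zero_iff] at h1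
    rw [Polynomial.eval_add, Polynomial.eval_C]
    linarith

end DiffsVanish

/-- A polynomial which is positive to the right of zero behaves there like a power. -/
theorem exists_pow_bounds_of_eval_pos {p : Polynomial ℝ} {ε : ℝ} (hε : 0 < ε)
    (hp : ∀ t, 0 < t → t ≤ ε → 0 < p.eval t) :
    ∃ k : ℕ, ∃ c > 0, ∃ C > 0, ∃ t₀ > 0, ∀ t, 0 < t → t < t₀ →
      c * t ^ k ≤ p.eval t ∧ p.eval t ≤ C * t ^ k := by
  have hp0 : p ≠ 0 := by
    rintro rfl
    simpa using hp ε hε le_rfl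
  obtain ⟨r, hr, hnr⟩ := Polynomial.exists_eq_pow_rootMultiplicity_mul_and_not_dvd p hp0 0
  set k := p.rootMultiplicity 0
  have hr0 : r.eval 0 ≠ 0 := by
    intro h
    exact hnr (Polynomial.dvd_iff_isRoot.2 h)
  have hev : ∀ t, p.eval t = t ^ k * r.eval t := fun t => by
    conv_lhs => rw [hr]
    simp
  have hlim : Tendsto (fun t => r.eval t) (𝓝[>] 0) (𝓝 (r.eval 0)) :=
    (r.continuous.tendsto 0).mono_left nhdsWithin_le_nhds
  have hrpos : 0 < r.eval 0 := by
    refine lt_of_le_of_ne (ge_of_tendsto hlim ?_) hr0.symm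
    filter_upwards [Ioo_mem_nhdsGT hε] with t ht
    have h1 := hp t ht.1 ht.2.le
    rw [hev] at h1
    exact (pos_of_mul_pos_right h1 (pow_nonneg ht.1.le k)).le
  have h2 : ∀ᶠ t in 𝓝[>] (0 : ℝ), r.eval 0 / 2 < r.eval t ∧ r.eval t < 2 * r.eval 0 :=
    (hlim.eventually_const_lt (by linarith)).and (hlim.eventually_lt_const (by linarith))
  obtain ⟨t₀, ht₀, hsub⟩ := mem_nhdsGT_iff_exists_Ioo_subset.1 h2
  refine ⟨k, r.eval 0 / 2, by positivity, 2 * r.eval 0, by positivity, t₀, ht₀, fun t h0 ht => ?_⟩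
  obtain ⟨h3, h4⟩ := hsub ⟨h0, ht⟩
  rw [hev, mul_comm (t ^ k)]
  have : 0 < t ^ k := pow_pos h0 k
  exact ⟨mul_le_mul_of_nonneg_right h3.le this.le, mul_le_mul_of_nonneg_right h4.le this.le⟩

/-- Elimination of all but one term from a relation between functions of linear functionals. -/
theorem exists_diffsVanish_of_sum_eq_zero {M α : Type*} [NormedAddCommGroup M] [NormedSpace ℝ M]
    (ℓ₀ : M →ₗ[ℝ] ℝ) (ℓ : α → M →ₗ[ℝ] ℝ) {v : M} (hv : ℓ₀ v = 1) (E : Finset α)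
    (hE : ∀ d ∈ E, ∃ h, ℓ d h = 0 ∧ ℓ₀ h = 1) {ε : ℝ} (hε : 0 < ε) :
    ∃ δ > 0, ∀ (g₀ : ℝ → ℝ) (g : α → ℝ → ℝ),
      (∀ f : M, ‖f‖ ≤ ε → g₀ (ℓ₀ f) + ∑ d ∈ E, g d (ℓ d f) = 0) →
      DiffsVanish E.card δ g₀ := by
  classical
  induction E using Finset.induction_on generalizing ε with
  | empty =>
    refine ⟨ε / (‖v‖ + 1), by positivity, fun g₀ g hg τ hτ => ?_⟩
    have h := hg (τ • v) (by
      rw [norm_smul, Real.norm_eq_abs]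
      rw [le_div_iff₀ (by positivity)] at hτ
      nlinarith [abs_nonneg τ])
    simpa [hv] using h
  | insert d E hd ih =>
    obtain ⟨h, hh0, hh1⟩ := hE d (Finset.mem_insert_self _ _)
    obtain ⟨δ, hδ, hrec⟩ := ih (fun e he => hE e (Finset.mem_insert_of_mem he)) (half_pos hε)
    refine ⟨min δ (ε / 2 / (‖h‖ + 1)), lt_min hδ (by positivity), fun g₀ g hg => ?_⟩
    rw [Finset.card_insert_of_notMem hd]
    intro s hs
    -- Subtracting the relation at `f` from that at `f + s • h`, where `ℓ d h = 0` and `ℓ₀ h = 1`,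
    -- cancels the term of `d` and replaces `g₀` by its difference with step `s`. The bound `δ` must
    -- not depend on the functions, since they now vary with `s`.
    refine DiffsVanish.of_le (min_le_left _ _) (hrec (fun x => g₀ (x + s) - g₀ x)
      (fun e x => g e (x + s * ℓ e h) - g e x) fun f hf => ?_)
    have hs' := hs.trans (min_le_right _ _)
    rw [le_div_iff₀ (by positivity)] at hs'
    have hsh : ‖s • h‖ ≤ ε / 2 := by
      rw [norm_smul, Real.norm_eq_abs]
      nlinarith [abs_nonneg s]
    have h1 := hg (f + s • h) (by linarith [norm_add_le f (s • h)])
    have h2 := hg f (by linarith)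
    rw [Finset.sum_insert hd] at h1 h2
    simp only [map_add, map_smul, smul_eq_mul, hh0, hh1, mul_zero, add_zero, mul_one] at h1
    rw [Finset.sum_sub_distrib]
    linarith

/-! ### Blocks in a finite-dimensional section. -/

namespace OrliczFunction

variable {φ : OrliczFunction}

theorem mul_oddQuot_mul (τ x : ℝ) : x * φ.oddQuot (τ * x) = |x| * φ.oddQuot (τ * |x|) := by
  rcases abs_cases x with ⟨h, -⟩ | ⟨h, -⟩
  · rw [h]
  · rw [h, mul_neg, φ.oddQuot_neg]
    ring

/-- The equation determines `φ t / t` along `r ^ n * t₀` as a power with exponent `σ = log κ / log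
r`. Monotonicity fills the gaps up to a factor `κ`. -/
theorem equivalentToPow_of_scaling (htop : ¬ φ.EquivalentToPow ∞) {r κ t₀ : ℝ} (hr : 0 < r)
    (hr1 : r < 1) (ht₀ : 0 < t₀)
    (h : ∀ t, 0 < t → t ≤ t₀ → φ.oddQuot (r * t) = κ * φ.oddQuot t) :
    ∃ p : ℝ≥0∞, 1 ≤ p ∧ φ.EquivalentToPow p := by
  have hq0 : 0 < φ.oddQuot t₀ := φ.oddQuot_pos htop ht₀
  have hκ : 0 < κ := by
    have h1 := φ.oddQuot_pos htop (mul_pos hr ht₀)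
    rw [h t₀ ht₀ le_rfl] at h1
    exact pos_of_mul_pos_left h1 hq0.le
  have hκ1 : κ ≤ 1 := by
    have h1 := φ.oddQuot_mono (mul_pos hr ht₀).le (mul_le_of_le_one_left ht₀.le hr1.le)
    rw [h t₀ ht₀ le_rfl] at h1
    exact le_of_mul_le_mul_right (by linarith) hq0
  set σ := Real.log κ / Real.log r with hσ
  have hlr : Real.log r < 0 := Real.log_neg hr hr1
  have hσ0 : 0 ≤ σ := div_nonneg_of_nonpos (Real.log_nonpos hκ.le hκ1) hlr.le
  have hrσ : r ^ σ = κ := by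
    rw [Real.rpow_def_of_pos hr, hσ, mul_div_cancel₀ _ hlr.ne, Real.exp_log hκ]
  have hpow : ∀ n : ℕ, φ.oddQuot (r ^ n * t₀) = (r ^ n) ^ σ * φ.oddQuot t₀ := by
    intro n
    induction n with
    | zero => simp
    | succ n ih =>
      have h1 : r ^ (n + 1) * t₀ = r * (r ^ n * t₀) := by ring
      rw [h1, h _ (by positivity) (mul_le_of_le_one_left ht₀.le (pow_le_one₀ hr.le hr1.le)), ih,
        pow_succ, Real.mul_rpow (by positivity) hr.le, hrσ]
      ring
  refine ⟨ENNReal.ofReal (σ + 1), by simpa using hσ0,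
    φ.equivalentToPow_of_quotient hσ0 (c := κ * φ.oddQuot t₀ / t₀ ^ σ)
      (C := κ⁻¹ * φ.oddQuot t₀ / t₀ ^ σ) (by positivity) (by positivity) ht₀ fun t ht htt => ?_⟩
  obtain ⟨n, hn1, hn2⟩ := exists_nat_pow_near_of_lt_one (div_pos ht ht₀)
    ((div_le_one ht₀).2 htt.le) hr hr1
  have e : ∀ c : ℝ, c * φ.oddQuot t₀ / t₀ ^ σ * t ^ σ = c * (t / t₀) ^ σ * φ.oddQuot t₀ := by
    intro c
    rw [Real.div_rpow ht.le ht₀.le]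
    ring
  rw [← φ.oddQuot_of_pos ht, e, e]
  have hs : (r ^ (n + 1)) ^ σ = κ * (r ^ n) ^ σ := by
    rw [pow_succ, Real.mul_rpow (by positivity) hr.le, hrσ, mul_comm]
  constructor
  · have h1 : r ^ (n + 1) * t₀ ≤ t := by
      rw [lt_div_iff₀ ht₀] at hn1
      exact hn1.le
    have h2 := φ.oddQuot_mono (by positivity) h1
    rw [hpow, hs] at h2
    refine le_trans ?_ h2
    gcongr
  · have h1 : t ≤ r ^ n * t₀ := by
      rwa [div_le_iff₀ ht₀] at hn2
    have h2 := φ.oddQuot_mono ht.le h1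
    rw [hpow] at h2
    refine h2.trans ?_
    gcongr
    rw [← div_eq_inv_mul, le_div_iff₀ hκ, mul_comm, ← hs]
    gcongr

section Blocks

variable {κ : Type*} {V W : Submodule ℝ (κ → ℝ)} (v : κ → ℝ)

/-- The coordinates on `V`, relative to a fixed vector `v`. -/
def relCoord (V : Submodule ℝ (κ → ℝ)) (v : κ → ℝ) (i : κ) : V →ₗ[ℝ] ℝ :=
  (v i)⁻¹ • (LinearMap.proj i ∘ₗ V.subtype)

theorem relCoord_apply (i : κ) (u : V) : relCoord V v i u = (u : κ → ℝ) i / v i := by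
  simp [relCoord, div_eq_inv_mul]

open Classical in
/-- The restriction of `v` to a class of coordinates that are proportional on `V`. -/
def block (V : Submodule ℝ (κ → ℝ)) (v : κ → ℝ) (c : V →ₗ[ℝ] ℝ) (i : κ) : ℝ :=
  if relCoord V v i = c then v i else 0

variable {v}

theorem relCoord_self (hv : v ∈ V) {i : κ} (hi : v i ≠ 0) : relCoord V v i ⟨v, hv⟩ = 1 := by
  rw [relCoord_apply, div_self hi]

theorem ne_zero_of_relCoord_eq (hv : v ∈ V) {i j : κ} (hi : v i ≠ 0)
    (h : relCoord V v j = relCoord V v i) : v j ≠ 0 := by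
  intro hj
  have h1 := relCoord_self hv hi
  rw [← h, relCoord_apply, hj, div_zero] at h1
  exact zero_ne_one h1

variable (hgen : ∀ i, (∃ u ∈ V, u i ≠ 0) → v i ≠ 0)
include hgen

theorem relCoord_mul_self (i : κ) (u : V) : relCoord V v i u * v i = (u : κ → ℝ) i := by
  rw [relCoord_apply]
  by_cases hi : v i = 0
  · have : (u : κ → ℝ) i = 0 := by
      by_contra h
      exact hgen i ⟨u, u.2, h⟩ hi
    rw [hi, this, mul_zero]
  · exact div_mul_cancel₀ _ hi

variable [Fintype κ]
  (hφ : ∀ p : ℝ≥0∞, 1 ≤ p → ¬ φ.EquivalentToPow p) (hv : v ∈ V) (hVW : V ⊔ W = ⊤)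
  {δ : ℝ} (hδ : 0 < δ)
  (hrel : ∀ f ∈ V, (∀ i, |f i| ≤ δ) → ∀ w ∈ W, ∑ i, w i * φ.oddQuot (f i) = 0)
include hφ hv hVW hδ hrel

open Classical in
-- Write the block as `u + w` with `u ∈ V`, `w ∈ W`. If `w ≠ 0`, the relation for `w` is a
-- functional equation between sums over classes. Elimination makes the sum `S d₀` of some class a
-- polynomial near `0`, and this sum is comparable to `φ t / t`.
theorem block_mem (i₁ : κ) : block V v (relCoord V v i₁) ∈ V := by
  have htop := hφ ∞ le_top
  have h1 := hφ 1 le_rfl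
  set c := relCoord V v i₁
  obtain ⟨u, hu, w, hw, huw⟩ : ∃ u ∈ V, ∃ w ∈ W, u + w = block V v c :=
    Submodule.mem_sup.1 (by rw [hVW]; trivial)
  -- On each class `w` is a multiple of `v`, so the relation can be grouped by classes.
  have hwi : ∀ i, w i = ((if relCoord V v i = c then 1 else 0) - relCoord V v i ⟨u, hu⟩) * v i := by
    intro i
    have h2 := congrFun huw i
    have h3 := relCoord_mul_self hgen i ⟨u, hu⟩
    rw [Pi.add_apply] at h2
    rw [sub_mul, ite_mul, one_mul, zero_mul]
    simp only [block] at h2 h3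
    linarith
  by_cases hw0 : w = 0
  · rw [hw0, add_zero] at huw
    rwa [← huw]
  exfalso
  obtain ⟨i₀, hi₀⟩ := Function.ne_iff.1 hw0
  rw [Pi.zero_apply, hwi] at hi₀
  have hvi₀ := right_ne_zero_of_mul hi₀
  set d₀ := relCoord V v i₀ with hd₀
  let β : (V →ₗ[ℝ] ℝ) → ℝ := fun d => (if d = c then 1 else 0) - d ⟨u, hu⟩
  have hβ : β d₀ ≠ 0 := left_ne_zero_of_mul hi₀
  let S : (V →ₗ[ℝ] ℝ) → ℝ → ℝ := fun d τ =>
    ∑ i ∈ Finset.univ.filter fun i => relCoord V v i = d, v i * φ.oddQuot (τ * v i)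
  let I := Finset.univ.image (relCoord V v)
  have hd₀I : d₀ ∈ I := Finset.mem_image_of_mem _ (Finset.mem_univ _)
  have hsum : ∀ f : V, ‖f‖ ≤ δ → β d₀ * S d₀ (d₀ f) + ∑ d ∈ I.erase d₀, β d * S d (d f) = 0 := by
    intro f hf
    have hf' : ∀ i, |(f : κ → ℝ) i| ≤ δ := fun i =>
      (norm_le_pi_norm (f : κ → ℝ) i).trans hf
    rw [Finset.add_sum_erase I (fun d => β d * S d (d f)) hd₀I, ← hrel f f.2 hf' w hw,
      ← Finset.sum_fiberwise_of_maps_to (s := Finset.univ) (t := I) (g := relCoord V v)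
        fun i _ => Finset.mem_image_of_mem _ (Finset.mem_univ i)]
    refine Finset.sum_congr rfl fun d _ => ?_
    rw [Finset.mul_sum]
    refine Finset.sum_congr rfl fun i hi => ?_
    have hi' : relCoord V v i = d := (Finset.mem_filter.1 hi).2
    rw [hwi, hi', ← relCoord_mul_self hgen i f, hi']
    simp only [β]
    ring
  obtain ⟨δ', hδ', hvan⟩ := exists_diffsVanish_of_sum_eq_zero d₀ (fun d : V →ₗ[ℝ] ℝ => d)
    (relCoord_self hv hvi₀) (I.erase d₀) (by
      intro d hd
      obtain ⟨hne, hdI⟩ := Finset.mem_erase.1 hd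
      obtain ⟨i, -, rfl⟩ := Finset.mem_image.1 hdI
      -- If `v i = 0`, the functional is zero because division by zero gives `0`, and `v` itself
      -- serves as witness.
      by_cases hi : v i = 0
      · exact ⟨⟨v, hv⟩, by rw [relCoord_apply, hi, div_zero], relCoord_self hv hvi₀⟩
      · obtain ⟨x, hx⟩ : ∃ x, relCoord V v i x ≠ d₀ x := by
          by_contra! h
          exact hne (LinearMap.ext h)
        set a := relCoord V v i x
        have ha : d₀ x - a ≠ 0 := sub_ne_zero.2 hx.symm
        refine ⟨(d₀ x - a)⁻¹ • (x - a • ⟨v, hv⟩), ?_, ?_⟩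
        · rw [map_smul, map_sub, map_smul, relCoord_self hv hi]
          simp [a]
        · rw [map_smul, map_sub, map_smul, relCoord_self hv hvi₀]
          simp [ha]) hδ
  have hvan' := (hvan (fun x => β d₀ * S d₀ x) (fun d x => β d * S d x) hsum).const_mul (β d₀)⁻¹
  simp only [inv_mul_cancel_left₀ hβ] at hvan'
  have hScont : Continuous (S d₀) := continuous_finsetSum _ fun i _ =>
    continuous_const.mul ((φ.continuous_oddQuot h1).comp (continuous_mul_const _))
  obtain ⟨p, ε, hε, hp⟩ := hvan'.exists_polynomial hδ' hScont
  set J := Finset.univ.filter fun i => relCoord V v i = d₀ with hJ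
  have hi₀J : i₀ ∈ J := by simp [hJ, hd₀]
  have hSabs : ∀ τ, S d₀ τ = ∑ i ∈ J, |v i| * φ.oddQuot (τ * |v i|) := fun τ =>
    Finset.sum_congr rfl fun i _ => mul_oddQuot_mul τ (v i)
  -- With `a` the largest modulus of `v` in the class, `S d₀ τ` lies between `a` and `vsum` times
  -- `φ.oddQuot (τ * a)`.
  obtain ⟨i₂, hi₂, hmax⟩ := J.exists_max_image (fun i => |v i|) ⟨i₀, hi₀J⟩
  set a := |v i₂|
  have ha : 0 < a := (abs_pos.2 hvi₀).trans_le (hmax i₀ hi₀J)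
  have hq0 : ∀ t, 0 ≤ t → 0 ≤ φ.oddQuot t := fun t ht => by
    simpa [φ.oddQuot_zero] using φ.oddQuot_mono le_rfl ht
  have hlow : ∀ τ, 0 ≤ τ → a * φ.oddQuot (τ * a) ≤ S d₀ τ := fun τ hτ => by
    rw [hSabs]
    exact Finset.single_le_sum (f := fun i => |v i| * φ.oddQuot (τ * |v i|))
      (fun i _ => mul_nonneg (abs_nonneg _) (hq0 _ (by positivity))) hi₂
  set vsum := ∑ i ∈ J, |v i| with hvsum
  have hvs : 0 < vsum := ha.trans_le (Finset.single_le_sum (f := fun i => |v i|)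
    (fun i _ => abs_nonneg _) hi₂)
  have hup : ∀ τ, 0 ≤ τ → S d₀ τ ≤ vsum * φ.oddQuot (τ * a) := fun τ hτ => by
    rw [hSabs, hvsum, Finset.sum_mul]
    refine Finset.sum_le_sum fun i hi => mul_le_mul_of_nonneg_left ?_ (abs_nonneg _)
    exact φ.oddQuot_mono (by positivity) (mul_le_mul_of_nonneg_left (hmax i hi) hτ)
  obtain ⟨k, c₁, hc₁, C₁, hC₁, t₀, ht₀, hpow⟩ := exists_pow_bounds_of_eval_pos hε (p := p) (by
    intro t ht hte
    rw [← hp t (by rwa [abs_of_pos ht])]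
    exact (mul_pos ha (φ.oddQuot_pos htop (mul_pos ht ha))).trans_le (hlow t ht.le))
  refine hφ (ENNReal.ofReal ((k : ℝ) + 1)) (by simp) (φ.equivalentToPow_of_quotient
    (Nat.cast_nonneg k) (c := c₁ / a ^ k / vsum) (C := C₁ / a ^ k / a) (t₀ := min ε t₀ * a)
    (by positivity) (by positivity) (by positivity) fun t ht htt => ?_)
  rw [Real.rpow_natCast, ← φ.oddQuot_of_pos ht]
  rw [← div_lt_iff₀ ha] at htt
  have hta : 0 < t / a := div_pos ht ha
  obtain ⟨h2, h3⟩ := hpow (t / a) hta (htt.trans_le (min_le_right _ _))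
  rw [← hp (t / a) (by rw [abs_of_pos hta]; exact htt.le.trans (min_le_left _ _)), div_pow] at h2 h3
  have h4 := hlow (t / a) hta.le
  have h5 := hup (t / a) hta.le
  rw [div_mul_cancel₀ _ ha.ne'] at h4 h5
  constructor
  · rw [div_mul_eq_mul_div, div_le_iff₀ hvs, mul_comm (φ.oddQuot t), div_mul_eq_mul_div,
      ← mul_div_assoc']
    exact h2.trans h5
  · rw [div_mul_eq_mul_div, le_div_iff₀ ha, mul_comm (φ.oddQuot t), div_mul_eq_mul_div,
      ← mul_div_assoc']
    exact h4.trans h3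

open Classical in
-- Apply the relation to multiples `τ` of the block and to the `W`-part of a unit vector `e_m` in
-- its class: `φ.oddQuot (τ * v m)` is a constant times a function of `τ` that is the same for all
-- `m` in the class. Different moduli would thus give the scaling equation of
-- `equivalentToPow_of_scaling`.
theorem abs_le_abs_of_relCoord_eq {i j : κ} (hij : relCoord V v i = relCoord V v j)
    (hi : v i ≠ 0) : |v j| ≤ |v i| := by
  have htop := hφ ∞ le_top
  by_contra! hlt
  set c := relCoord V v i with hc
  have hb := block_mem hgen hφ hv hVW hδ hrel i
  set K := Finset.univ.filter fun k => relCoord V v k = c with hK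
  let S : ℝ → ℝ := fun τ => ∑ k ∈ K, v k * φ.oddQuot (τ * v k)
  obtain ⟨T, hT0, hT⟩ : ∃ T > 0, ∀ k, |v k| ≤ T := by
    refine ⟨‖v‖ + 1, by positivity, fun k => (norm_le_pi_norm v k).trans (by linarith)⟩
  have key : ∀ m, relCoord V v m = c → ∃ β : ℝ, ∀ τ, 0 ≤ τ → τ ≤ δ / T →
      φ.oddQuot (τ * v m) = β * S τ := by
    intro m hm
    obtain ⟨u, hu, w, hw, huw⟩ : ∃ u ∈ V, ∃ w ∈ W, u + w = Pi.single m (1 : ℝ) :=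
      Submodule.mem_sup.1 (by rw [hVW]; trivial)
    refine ⟨c ⟨u, hu⟩, fun τ hτ hτ' => ?_⟩
    rw [le_div_iff₀ hT0] at hτ'
    have h2 := hrel (τ • block V v c) (V.smul_mem τ hb) (fun k => by
      rw [Pi.smul_apply, smul_eq_mul, abs_mul, abs_of_nonneg hτ]
      simp only [block]
      split_ifs
      · exact (mul_le_mul_of_nonneg_left (hT k) hτ).trans hτ'
      · simpa using hδ.le) w hw
    have h3 : ∑ k, w k * φ.oddQuot ((τ • block V v c) k) =
        ∑ k ∈ K, w k * φ.oddQuot (τ * v k) := by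
      rw [hK, Finset.sum_filter]
      refine Finset.sum_congr rfl fun k _ => ?_
      rw [Pi.smul_apply, smul_eq_mul]
      simp only [block]
      split_ifs <;> simp [φ.oddQuot_zero]
    have h4 : ∑ k ∈ K, w k * φ.oddQuot (τ * v k) =
        ∑ k ∈ K, ((Pi.single m (1 : ℝ) : κ → ℝ) k * φ.oddQuot (τ * v k) -
          c ⟨u, hu⟩ * (v k * φ.oddQuot (τ * v k))) := by
      refine Finset.sum_congr rfl fun k hk => ?_
      have hk' : relCoord V v k = c := (Finset.mem_filter.1 hk).2
      have h5 := congrFun huw k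
      have h6 := relCoord_mul_self hgen k ⟨u, hu⟩
      rw [hk'] at h6
      simp only at h6
      rw [← h5, Pi.add_apply, ← h6]
      ring
    have hmK : m ∈ K := by simp [hK, hm]
    rw [h3, h4, Finset.sum_sub_distrib, ← Finset.mul_sum, Finset.sum_eq_single_of_mem m hmK
      fun k _ hkm => by simp [hkm]] at h2
    simp only [Pi.single_eq_same, one_mul] at h2
    exact sub_eq_zero.1 h2
  obtain ⟨β, hβ⟩ := key i rfl
  obtain ⟨β', hβ'⟩ := key j hij.symm
  have hj : v j ≠ 0 := ne_zero_of_relCoord_eq hv hi hij.symm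
  have hai : 0 < |v i| := abs_pos.2 hi
  have haj : 0 < |v j| := abs_pos.2 hj
  have habs : ∀ τ x : ℝ, 0 ≤ τ → |φ.oddQuot (τ * x)| = φ.oddQuot (τ * |x|) := by
    intro τ x hτ
    have hnn : 0 ≤ φ.oddQuot (τ * |x|) := by
      simpa [φ.oddQuot_zero] using φ.oddQuot_mono le_rfl (by positivity : 0 ≤ τ * |x|)
    rcases abs_cases x with ⟨h, -⟩ | ⟨h, -⟩
    · rw [h] at hnn ⊢
      exact abs_of_nonneg hnn
    · rw [h, mul_neg, φ.oddQuot_neg] at hnn ⊢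
      exact abs_of_nonpos (by linarith)
  have hτ₀ : 0 < δ / T := div_pos hδ hT0
  have hβ'0 : β' ≠ 0 := by
    rintro rfl
    have h2 := φ.oddQuot_pos htop (mul_pos hτ₀ haj)
    rw [← habs _ _ hτ₀.le, hβ' _ hτ₀.le le_rfl, zero_mul, abs_zero] at h2
    exact lt_irrefl _ h2
  obtain ⟨p, hp1, hp⟩ := equivalentToPow_of_scaling htop (r := |v i| / |v j|) (κ := |β| / |β'|)
    (t₀ := δ / T * |v j|) (by positivity) ((div_lt_one haj).2 hlt) (by positivity) (by
      intro t ht htt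
      rw [← div_le_iff₀ haj] at htt
      set τ := t / |v j| with hτ
      have hτ0 : 0 ≤ τ := by positivity
      have ht' : t = τ * |v j| := by rw [hτ, div_mul_cancel₀ _ haj.ne']
      have e : |v i| / |v j| * t = τ * |v i| := by
        rw [ht']
        field_simp
      rw [e, ht', ← habs _ _ hτ0, ← habs _ _ hτ0, hβ τ hτ0 htt, hβ' τ hτ0 htt, abs_mul, abs_mul]
      have := abs_pos.2 hβ'0
      field_simp)
  exact hφ p hp1 hp

end Blocks

end OrliczFunction

namespace OrliczFunction

variable {φ : OrliczFunction}

section Blocks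

variable {κ : Type*} [Fintype κ] {V W : Submodule ℝ (κ → ℝ)}
  (hφ : ∀ p : ℝ≥0∞, 1 ≤ p → ¬ φ.EquivalentToPow p) (hVW : V ⊔ W = ⊤) {δ : ℝ} (hδ : 0 < δ)
  (hrel : ∀ f ∈ V, (∀ i, |f i| ≤ δ) → ∀ w ∈ W, ∑ i, w i * φ.oddQuot (f i) = 0)
include hφ hVW hδ hrel

theorem exists_blocks : ∃ B : Set (κ → ℝ), B ⊆ V ∧ V ≤ Submodule.span ℝ B ∧
    (∀ b ∈ B, b ≠ 0 ∧ ∀ i j, b i ≠ 0 → b j ≠ 0 → |b i| = |b j|) ∧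
    ∀ b ∈ B, ∀ c ∈ B, b ≠ c → ∀ i, b i = 0 ∨ c i = 0 := by
  classical
  obtain ⟨v, hv, hgen⟩ := exists_mem_forall_apply_ne_zero V
  have hmem := block_mem hgen hφ hv hVW hδ hrel
  refine ⟨{b | b ≠ 0 ∧ ∃ i, b = block V v (relCoord V v i)}, ?_, ?_, ?_, ?_⟩
  · rintro b ⟨-, i, rfl⟩
    exact hmem i
  · intro u hu
    -- On the class of `c`, the vector `u` is `c u` times `v`.
    have e : u = ∑ c ∈ Finset.univ.image (relCoord V v), c ⟨u, hu⟩ • block V v c := by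
      ext i
      rw [Finset.sum_apply, Finset.sum_eq_single_of_mem (relCoord V v i)
        (Finset.mem_image_of_mem _ (Finset.mem_univ i))]
      · simpa [block] using (relCoord_mul_self hgen i ⟨u, hu⟩).symm
      · intro c _ hc
        simp [block, hc.symm]
    rw [e]
    refine Submodule.sum_mem _ fun c hc => Submodule.smul_mem _ _ ?_
    obtain ⟨i, -, rfl⟩ := Finset.mem_image.1 hc
    by_cases h0 : block V v (relCoord V v i) = 0
    · rw [h0]
      exact Submodule.zero_mem _
    · exact Submodule.subset_span ⟨h0, i, rfl⟩
  · rintro b ⟨hb, k, rfl⟩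
    refine ⟨hb, fun i j hi hj => ?_⟩
    simp only [block, ne_eq, ite_eq_right_iff, Classical.not_imp] at hi hj
    simp only [block, if_pos hi.1, if_pos hj.1]
    exact le_antisymm
      (abs_le_abs_of_relCoord_eq hgen hφ hv hVW hδ hrel (hj.1.trans hi.1.symm) hj.2)
      (abs_le_abs_of_relCoord_eq hgen hφ hv hVW hδ hrel (hi.1.trans hj.1.symm) hi.2)
  · rintro b ⟨-, k, rfl⟩ c ⟨-, l, rfl⟩ hne i
    by_contra! h
    simp only [block, ne_eq, ite_eq_right_iff, Classical.not_imp] at h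
    exact hne (by rw [← h.1.1, ← h.2.1])

open Classical in
-- Let `T` consist of one representative of each class on which `v ≠ 0`, so that `dim V ≤ |T|`. A
-- class with one element puts its unit vector in `V`. Hence a representative whose unit vector is
-- missing has a partner outside `T`, and at most `2 |Tᶜ|` unit vectors are missing.
theorem card_single_notMem_le :
    (Finset.univ.filter fun i => (Pi.single i 1 : κ → ℝ) ∉ V).card + 2 * Module.finrank ℝ V ≤
      2 * Fintype.card κ := by
  obtain ⟨v, hv, hgen⟩ := exists_mem_forall_apply_ne_zero V
  have hmem := block_mem hgen hφ hv hVW hδ hrel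
  let rep : κ → κ := fun i => Set.rangeSplitting (relCoord V v) ⟨relCoord V v i, i, rfl⟩
  have hrep : ∀ i, relCoord V v (rep i) = relCoord V v i := fun i =>
    Set.apply_rangeSplitting (relCoord V v) _
  have hrep' : ∀ i j, relCoord V v i = relCoord V v j → rep i = rep j := fun i j h => by
    simp only [rep, h]
  let T := Finset.univ.filter fun i => v i ≠ 0 ∧ rep i = i
  let bad := Finset.univ.filter fun i => (Pi.single i 1 : κ → ℝ) ∉ V
  have hT : Module.finrank ℝ V ≤ T.card := by
    let r : V →ₗ[ℝ] (T → ℝ) := (LinearMap.funLeft ℝ ℝ (Subtype.val : T → κ)).domRestrict V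
    have hr : Function.Injective r := by
      rw [injective_iff_map_eq_zero]
      rintro ⟨u, hu⟩ hu0
      ext i
      by_contra hi
      have hvi := hgen i ⟨u, hu, hi⟩
      have hvr := ne_zero_of_relCoord_eq hv hvi (hrep i)
      have hmemT : rep i ∈ T := by
        simp only [T, Finset.mem_filter, Finset.mem_univ, true_and]
        exact ⟨hvr, hrep' _ _ (hrep i)⟩
      have h0 : u (rep i) = 0 := congrFun hu0 ⟨rep i, hmemT⟩
      have h1 := relCoord_mul_self hgen i ⟨u, hu⟩
      rw [← hrep i, relCoord_apply] at h1
      simp only [h0, zero_div, zero_mul] at h1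
      exact hi h1.symm
    have := LinearMap.finrank_le_finrank_of_injective hr
    rwa [Module.finrank_fintype_fun_eq_card, Fintype.card_coe] at this
  have hpartner : ∀ i ∈ bad ∩ T, ∃ j, j ≠ i ∧ relCoord V v j = relCoord V v i := by
    intro i hi
    simp only [bad, T, Finset.mem_inter, Finset.mem_filter, Finset.mem_univ, true_and] at hi
    by_contra! hc
    refine hi.1 ?_
    have e : (Pi.single i 1 : κ → ℝ) = (v i)⁻¹ • block V v (relCoord V v i) := by
      ext j
      by_cases hj : j = i
      · subst hj
        simp [block, hi.2.1]
      · simp [block, hj, hc j hj]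
    rw [e]
    exact V.smul_mem _ (hmem i)
  have hcard : (bad ∩ T).card ≤ Tᶜ.card := by
    choose! p hp using hpartner
    refine Finset.card_le_card_of_injOn p (fun i hi => ?_) fun i hi j hj hij => ?_
    · obtain ⟨h1, h2⟩ := hp i hi
      have h3 : rep i = i := (Finset.mem_filter.1 (Finset.mem_inter.1 hi).2).2.2
      simp only [Finset.coe_compl, Set.mem_compl_iff, Finset.mem_coe]
      intro h4
      have h5 : rep (p i) = p i := (Finset.mem_filter.1 h4).2.2
      exact h1 (by rw [← h5, hrep' _ _ h2, h3])
    · have h3 : rep i = i := (Finset.mem_filter.1 (Finset.mem_inter.1 hi).2).2.2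
      have h4 : rep j = j := (Finset.mem_filter.1 (Finset.mem_inter.1 hj).2).2.2
      rw [← h3, ← h4]
      exact hrep' _ _ (by rw [← (hp i hi).2, ← (hp j hj).2, hij])
  have h1 : bad.card ≤ (bad ∩ T).card + Tᶜ.card := by
    rw [← Finset.card_inter_add_card_sdiff bad T]
    gcongr
    intro i hi
    simpa using (Finset.mem_sdiff.1 hi).2
  have h2 := Finset.card_add_card_compl T
  change bad.card + _ ≤ _
  omega

end Blocks

/-! ### Reduction to finitely many coordinates, and assembly of the blocks. -/

section Assembly

variable {ι : Type*} {F : Submodule ℝ (φ.space ι)} {n : ℕ}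
  (hcodim : Module.rank ℝ (φ.space ι ⧸ F) = n) {P : φ.space ι →ₗ[ℝ] φ.space ι}
  (hrange : LinearMap.range P = F) (hPF : ∀ f ∈ F, P f = f)

/-- The restriction of a vector to finitely many coordinates. -/
def restr (φ : OrliczFunction) (J : Finset ι) : φ.space ι →ₗ[ℝ] (J → ℝ) :=
  LinearMap.funLeft ℝ ℝ (Subtype.val : J → ι) ∘ₗ (φ.space ι).subtype

theorem restr_apply (J : Finset ι) (x : φ.space ι) (j : J) : φ.restr J x j = (x : ι → ℝ) j := rfl

include hcodim hrange hPF

theorem finrank_ker_eq : Module.Finite ℝ (LinearMap.ker P) ∧ Module.finrank ℝ (LinearMap.ker P) = n := by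
  have hcompl : IsCompl F (LinearMap.ker P) := by
    refine IsCompl.of_eq ?_ ?_
    · rw [eq_bot_iff]
      rintro x ⟨hx, hx'⟩
      rw [Submodule.mem_bot, ← hPF x hx]
      exact hx'
    · rw [eq_top_iff]
      intro x _
      have hPx : P x ∈ F := hrange ▸ LinearMap.mem_range_self P x
      have h : x - P x ∈ LinearMap.ker P := by
        rw [LinearMap.mem_ker, map_sub, hPF _ hPx, sub_self]
      have := Submodule.add_mem_sup hPx h
      rwa [add_sub_cancel] at this
  let e := Submodule.quotientEquivOfIsCompl F (LinearMap.ker P) hcompl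
  have hq : Module.Finite ℝ (φ.space ι ⧸ F) := by
    rw [← Module.rank_lt_aleph0_iff, hcodim]
    exact Cardinal.natCast_lt_aleph0
  refine ⟨Module.Finite.equiv e, ?_⟩
  rw [← e.finrank_eq]
  exact Module.finrank_eq_of_rank_eq hcodim

/-- Since `ker P` is finite-dimensional, some finite `J` avoiding `i₀` makes the subspace of `ker P`
vanishing on `J` minimal. By minimality its vectors are multiples of `e_{i₀}`, which `P` fixes, so
they are zero. -/
theorem exists_finset_separating_ker {i₀ : ι} (hi₀ : φ.unitVec i₀ ∈ F) :
    ∃ J : Finset ι, i₀ ∉ J ∧ ∀ z, P z = 0 → (∀ j ∈ J, (z : ι → ℝ) j = 0) → z = 0 := by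
  classical
  obtain ⟨hfin, -⟩ := finrank_ker_eq hcodim hrange hPF
  let K := LinearMap.ker P
  have hart : IsArtinian ℝ K := @isArtinian_of_fg_of_artinian' ℝ K _ _ _ _ hfin
  let Z : Finset ι → Submodule ℝ K := fun J => LinearMap.ker (φ.restr J ∘ₗ K.subtype)
  have hZ : ∀ J (z : K), z ∈ Z J ↔ ∀ j ∈ J, ((z : φ.space ι) : ι → ℝ) j = 0 := by
    intro J z
    rw [LinearMap.mem_ker, funext_iff]
    exact ⟨fun h j hj => h ⟨j, hj⟩, fun h j => h j j.2⟩
  obtain ⟨-, ⟨J, hJ, rfl⟩, hmin⟩ := IsArtinian.set_has_minimal (R := ℝ) (M := K)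
    (Z '' {J | i₀ ∉ J}) ⟨_, ∅, by simp, rfl⟩
  refine ⟨J, hJ, fun z hz hzJ => ?_⟩
  have hall : ∀ i, i ≠ i₀ → (z : ι → ℝ) i = 0 := by
    intro i hi
    by_contra hzi
    refine hmin (Z (insert i J)) ⟨_, ?_, rfl⟩ (lt_of_le_of_ne ?_ ?_)
    · simpa [hi.symm] using hJ
    · intro y hy
      rw [hZ] at hy ⊢
      exact fun j hj => hy j (Finset.mem_insert_of_mem hj)
    · intro h
      have h1 : (⟨z, hz⟩ : K) ∈ Z J := (hZ _ _).2 hzJ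
      rw [← h, hZ] at h1
      exact hzi (h1 i (Finset.mem_insert_self _ _))
  have e : z = (z : ι → ℝ) i₀ • φ.unitVec i₀ := by
    ext i
    by_cases hi : i = i₀
    · subst hi
      simp [unitVec_apply_self]
    · simp [hall i hi, unitVec_apply_of_ne hi]
  rw [← hz, e, map_smul, hPF _ hi₀]

variable {N : φ.space ι → ℝ} (hφ : ∀ p : ℝ≥0∞, 1 ≤ p → ¬ φ.EquivalentToPow p)
  (hN : N = φ.luxemburgNorm ∨ (N = φ.orliczNorm ∧ (Finite ι → ∀ u : ℝ, φ.conj u < ∞)))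
  (hP : ∀ x, N (P x) ≤ N x) {i₀ : ι} (hi₀ : φ.unitVec i₀ ∈ F)
include hφ hN hP hi₀

/-- A vector `x` in both subspaces can be paired with a small multiple of itself; this gives a
vanishing sum of terms `|x i| * φ.oddQuot (t * |x i|)`, each positive if `x i ≠ 0`. So the
intersection is zero, and the dimensions, at least `|J| - n` and equal to `n`, add up to `|J|`. -/
theorem sup_eq_top_and_relation {J : Finset ι} (hJ : i₀ ∉ J)
    (hsep : ∀ z, P z = 0 → (∀ j ∈ J, (z : ι → ℝ) j = 0) → z = 0) :
    F.comap (φ.extend J) ⊔ (LinearMap.ker P).map (φ.restr J) = ⊤ ∧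
    ∃ δ > 0, ∀ f ∈ F.comap (φ.extend J), (∀ i, |f i| ≤ δ) →
      ∀ w ∈ (LinearMap.ker P).map (φ.restr J), ∑ i, w i * φ.oddQuot (f i) = 0 := by
  have htop := hφ ∞ le_top
  have h1 := hφ 1 le_rfl
  have hδ : ∃ δ > 0, ∀ f ∈ F.comap (φ.extend J), (∀ i, |f i| ≤ δ) →
      ∀ w ∈ (LinearMap.ker P).map (φ.restr J), ∑ i, w i * φ.oddQuot (f i) = 0 := by
    -- Makes each term of the modular of `2 t f` at most `1 / (|J| + 1)`, so that the sum is below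
    -- `1`.
    set δ : ℝ := 1 / (2 * (J.card + 1)) with hδ
    have hδ0 : 0 < δ := by positivity
    refine ⟨δ, hδ0, fun f hf hfδ w hw => ?_⟩
    obtain ⟨z, hz, rfl⟩ := hw
    have hz' : P z = 0 := hz
    have hsupp : ∀ i ∉ J, (φ.extend J f : ι → ℝ) i = 0 := fun i hi =>
      extend_apply_of_notMem J f hi
    have h2 := sum_mul_oddQuot_eq_zero h1 (f := φ.extend J f) (z := z) hsupp (by
      intro t s ht0 ht1
      refine modular_le_modular_add htop h1 hN hcodim hPF hP hi₀ (F.smul_mem t hf) ?_ ?_ ?_ ?_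
      · simp [hsupp i₀ hJ]
      · refine J.finite_toSet.subset fun i hi => ?_
        by_contra hiJ
        exact hi (by simp [hsupp i hiJ])
      · rw [modular_eq_sum (s := J) fun i hi => by simp [hsupp i hi], ENNReal.ofReal_lt_one]
        have hterm : ∀ i ∈ J, φ |((2 : ℝ) • ((t • φ.extend J f : φ.space ι) : ι → ℝ)) i| ≤
            1 / (J.card + 1) := by
          intro i hi
          have h3 : |((2 : ℝ) • ((t • φ.extend J f : φ.space ι) : ι → ℝ)) i| ≤ 1 / (J.card + 1) := by
            have h4 := hfδ ⟨i, hi⟩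
            rw [← extend_apply_coe J f ⟨i, hi⟩] at h4
            simp only [Pi.smul_apply, Submodule.coe_smul, smul_eq_mul, abs_mul, abs_two,
              abs_of_nonneg ht0]
            have h5 : t * |(φ.extend J f : ι → ℝ) i| ≤ δ :=
              (mul_le_of_le_one_left (abs_nonneg _) ht1).trans h4
            have h6 : 2 * δ = 1 / (J.card + 1) := by rw [hδ]; field_simp
            linarith
          refine (φ.map_le_self (abs_nonneg _) (h3.trans ?_)).trans h3
          rw [div_le_one (by positivity)]
          simp
        refine (Finset.sum_le_sum hterm).trans_lt ?_
        rw [Finset.sum_const, nsmul_eq_mul, mul_one_div, div_lt_one (by positivity)]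
        linarith
      · rw [map_smul, hz', smul_zero])
    rw [← Finset.sum_coe_sort J] at h2
    simpa only [extend_apply_coe, restr_apply] using h2
  refine ⟨?_, hδ⟩
  obtain ⟨δ, hδ, hrel⟩ := hδ
  set V := F.comap (φ.extend J)
  set W := (LinearMap.ker P).map (φ.restr J)
  have hinf : V ⊓ W = ⊥ := by
    rw [eq_bot_iff]
    rintro x ⟨hxV, hxW⟩
    rw [Submodule.mem_bot]
    set t := δ / (‖x‖ + 1) with ht
    have ht0 : 0 < t := by positivity
    have h2 := hrel (t • x) (V.smul_mem t hxV) (fun i => by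
      rw [Pi.smul_apply, smul_eq_mul, abs_mul, abs_of_pos ht0, ht, div_mul_eq_mul_div,
        div_le_iff₀ (by positivity)]
      refine mul_le_mul_of_nonneg_left ((norm_le_pi_norm x i).trans ?_) hδ.le
      linarith) x hxW
    have h3 : ∀ i ∈ Finset.univ, x i * φ.oddQuot ((t • x) i) = |x i| * φ.oddQuot (t * |x i|) :=
      fun i _ => mul_oddQuot_mul t (x i)
    rw [Finset.sum_congr rfl h3] at h2
    have hq0 : ∀ s, 0 ≤ s → 0 ≤ φ.oddQuot s := fun s hs => by
      simpa [φ.oddQuot_zero] using φ.oddQuot_mono le_rfl hs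
    rw [Finset.sum_eq_zero_iff_of_nonneg fun i _ =>
      mul_nonneg (abs_nonneg _) (hq0 _ (by positivity))] at h2
    ext i
    by_contra hi
    have hi' := abs_pos.2 hi
    have h3 := mul_pos hi' (φ.oddQuot_pos htop (mul_pos ht0 hi'))
    exact h3.ne' (h2 i (Finset.mem_univ i))
  obtain ⟨hfin, hrank⟩ := finrank_ker_eq hcodim hrange hPF
  have hW : Module.finrank ℝ W = n := by
    rw [← hrank]
    have e : W = LinearMap.range (φ.restr J ∘ₗ (LinearMap.ker P).subtype) := by
      rw [LinearMap.range_comp, Submodule.range_subtype]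
    rw [e]
    refine LinearMap.finrank_range_of_inj ((injective_iff_map_eq_zero _).2 ?_)
    rintro ⟨z, hz⟩ hz0
    exact Subtype.ext (hsep z hz fun j hj => congrFun hz0 ⟨j, hj⟩)
  have hV := card_le_finrank_comap_extend_add hcodim J
  have hsum := Submodule.finrank_sup_add_finrank_inf_eq V W
  rw [hinf, finrank_bot, hW, add_zero] at hsum
  refine Submodule.eq_top_of_finrank_eq (le_antisymm (Submodule.finrank_le _) ?_)
  rw [Module.finrank_fintype_fun_eq_card, Fintype.card_coe, hsum]
  exact hV

/-- If a set `S` of `2n + 1` unit vectors were missing, then for `J = J₀ ∪ S` the count would give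
`|S| + 2 dim V ≤ 2 |J| ≤ 2 dim V + 2n`. -/
theorem finite_setOf_unitVec_notMem : {i | φ.unitVec i ∉ F}.Finite := by
  classical
  by_contra hinf
  obtain ⟨J₀, hJ₀, hsep⟩ := exists_finset_separating_ker hcodim hrange hPF hi₀
  obtain ⟨S, hS, hcard⟩ := (show {i | φ.unitVec i ∉ F}.Infinite from hinf).exists_subset_card_eq
    (2 * n + 1)
  have hJ : i₀ ∉ J₀ ∪ S := by
    rw [Finset.mem_union, not_or]
    exact ⟨hJ₀, fun h => hS h hi₀⟩
  obtain ⟨hVW, δ, hδ, hrel⟩ := sup_eq_top_and_relation hcodim hrange hPF hφ hN hP hi₀ hJ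
    fun z hz h => hsep z hz fun j hj => h j (Finset.mem_union_left _ hj)
  have h1 := card_single_notMem_le hφ hVW hδ hrel
  have h2 := card_le_finrank_comap_extend_add hcodim (J₀ ∪ S)
  rw [Fintype.card_coe] at h1
  have h3 : ∀ t : Finset ↥(J₀ ∪ S), (∀ i : ↥(J₀ ∪ S), φ.unitVec (i : ι) ∉ F → i ∈ t) → S.card ≤ t.card := by
    intro t ht
    exact Finset.card_le_card_of_surjOn Subtype.val fun i hi =>
      ⟨⟨i, Finset.mem_union_right _ hi⟩, ht _ (hS hi), rfl⟩
  have h4 : S.card + 2 * Module.finrank ℝ (F.comap (φ.extend (J₀ ∪ S))) ≤ 2 * (J₀ ∪ S).card := by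
    refine le_trans (Nat.add_le_add_right (h3 _ fun i hi => ?_) _) h1
    refine Finset.mem_filter.2 ⟨Finset.mem_univ i, fun h => hi ?_⟩
    rwa [Submodule.mem_comap, extend, Fintype.linearCombination_apply_single, one_smul] at h
  omega

theorem exists_isConstCoeffBlockBasis
    (hbasis : closedSpan N (Set.range φ.unitVec) = Set.univ) :
    ∃ B : Set (φ.space ι), IsConstCoeffBlockBasis B ∧
      (F : Set (φ.space ι)) = closedSpan N B := by
  classical
  have hsym : IsSymmetricNorm N := by
    rcases hN with rfl | ⟨rfl, -⟩
    · exact isSymmetricNorm_luxemburgNorm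
    · exact isSymmetricNorm_orliczNorm
  obtain ⟨J₀, hJ₀, hsep⟩ := exists_finset_separating_ker hcodim hrange hPF hi₀
  have hSfin := finite_setOf_unitVec_notMem hcodim hrange hPF hφ hN hP hi₀
  set J := J₀ ∪ hSfin.toFinset with hJdef
  have hJ : i₀ ∉ J := by
    rw [hJdef, Finset.mem_union, not_or]
    exact ⟨hJ₀, by simpa using hi₀⟩
  have hJF : ∀ i ∉ J, φ.unitVec i ∈ F := fun i hi => by
    by_contra h
    exact hi (Finset.mem_union_right _ (by simpa using h))
  obtain ⟨hVW, δ, hδ, hrel⟩ := sup_eq_top_and_relation hcodim hrange hPF hφ hN hP hi₀ hJ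
    fun z hz h => hsep z hz fun j hj => h j (Finset.mem_union_left _ hj)
  obtain ⟨B₀, hB₀V, hVB₀, hB₀c, hB₀d⟩ := exists_blocks hφ hVW hδ hrel
  have hunit : ∀ i j : ι, (φ.unitVec i : ι → ℝ) j ≠ 0 ↔ j = i := fun i j => by
    by_cases h : j = i
    · subst h
      simp [unitVec_apply_self]
    · simp [unitVec_apply_of_ne h, h]
  set B₁ := φ.unitVec '' (J : Set ι)ᶜ
  set B₂ := φ.extend J '' B₀
  have hsupp₂ : ∀ b : J → ℝ, ∀ i, (φ.extend J b : ι → ℝ) i ≠ 0 → ∃ h : i ∈ J, b ⟨i, h⟩ ≠ 0 := by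
    intro b i hi
    by_cases h : i ∈ J
    · exact ⟨h, by rwa [← extend_apply_coe J b ⟨i, h⟩]⟩
    · exact absurd (extend_apply_of_notMem J b h) hi
  have hBF : B₁ ∪ B₂ ⊆ F := by
    rintro _ (⟨i, hi, rfl⟩ | ⟨b, hb, rfl⟩)
    · exact hJF i hi
    · exact hB₀V hb
  have hclosed : ∀ B ⊆ (F : Set (φ.space ι)), closedSpan N B ⊆ F := by
    intro B hB x hx
    have h := hsym.apply_eq_of_mem_closedSpan hP (fun b hb => hPF b (hB hb)) hx
    rw [← h, ← hrange]
    exact LinearMap.mem_range_self P x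
  refine ⟨B₁ ∪ B₂, ⟨?_, ?_⟩, Set.Subset.antisymm ?_ (hclosed _ hBF)⟩
  · rintro _ (⟨i, hi, rfl⟩ | ⟨b, hb, rfl⟩)
    · refine ⟨fun h => ?_, (Set.finite_singleton i).subset fun j hj => (hunit i j).1 hj, ?_⟩
      · have := (hunit i i).2 rfl
        simp [h] at this
      · intro j hj k hk
        rw [(hunit i j).1 hj, (hunit i k).1 hk]
    · obtain ⟨hb0, hbc⟩ := hB₀c b hb
      refine ⟨fun h => ?_, J.finite_toSet.subset fun i hi => (hsupp₂ b i hi).1, ?_⟩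
      · refine hb0 (funext fun j => ?_)
        rw [← extend_apply_coe J b j, h]
        rfl
      · intro i hi j hj
        obtain ⟨hiJ, hi'⟩ := hsupp₂ b i hi
        obtain ⟨hjJ, hj'⟩ := hsupp₂ b j hj
        have := hbc _ _ hi' hj'
        rwa [← extend_apply_coe J b ⟨i, hiJ⟩, ← extend_apply_coe J b ⟨j, hjJ⟩] at this
  · rintro _ (⟨i, hi, rfl⟩ | ⟨b, hb, rfl⟩) _ (⟨j, hj, rfl⟩ | ⟨c, hc, rfl⟩) hne <;>
      refine Set.disjoint_left.2 fun k hk hk' => ?_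
    · exact hne (by rw [← (hunit i k).1 hk, ← (hunit j k).1 hk'])
    · exact hi ((hunit i k).1 hk ▸ (hsupp₂ c k hk').1)
    · exact hj ((hunit j k).1 hk' ▸ (hsupp₂ b k hk).1)
    · obtain ⟨hkJ, h1⟩ := hsupp₂ b k hk
      obtain ⟨_, h2⟩ := hsupp₂ c k hk'
      have hbc : b ≠ c := fun h => hne (by rw [h])
      exact (hB₀d b hb c hc hbc ⟨k, hkJ⟩).elim h1 h2
  · intro x hx
    have ha : ∀ i, |if i ∈ J then (0 : ℝ) else 1| ≤ 1 := fun i => by split_ifs <;> simp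
    -- Split `x` into its parts off and on `J`. The part off `J` is a limit of combinations of unit
    -- vectors of `F`, hence lies in the closed subspace `F`. So the part on `J` lies in `F` as well
    -- and is a combination of blocks.
    set R := φ.diagOp ha
    have hR : ∀ y, N (R y) ≤ N y := hsym.matOp_le _
    have hsplit : ∀ y : φ.space ι, y = R y + φ.extend J (φ.restr J y) := by
      intro y
      ext i
      rw [Submodule.coe_add, Pi.add_apply, diagOp_apply]
      by_cases hi : i ∈ J
      · rw [if_pos hi, zero_mul, zero_add, extend_apply_coe J _ ⟨i, hi⟩]
        rfl
      · rw [if_neg hi, one_mul, extend_apply_of_notMem J _ hi, add_zero]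
    have hRspan : ∀ y ∈ Submodule.span ℝ (Set.range φ.unitVec), R y ∈ Submodule.span ℝ B₁ := by
      intro y hy
      have h := Submodule.mem_map_of_mem (f := R) hy
      rw [Submodule.map_span] at h
      refine Submodule.span_le.2 ?_ h
      rintro _ ⟨_, ⟨k, rfl⟩, rfl⟩
      by_cases hk : k ∈ J
      · have e : R (φ.unitVec k) = 0 := by
          ext i
          rw [diagOp_apply]
          by_cases hi : i = k
          · simp [hi, hk]
          · simp [unitVec_apply_of_ne hi]
        rw [e]
        exact Submodule.zero_mem _
      · have e : R (φ.unitVec k) = φ.unitVec k := by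
          ext i
          rw [diagOp_apply]
          by_cases hi : i = k
          · simp [hi, hk]
          · simp [unitVec_apply_of_ne hi]
        rw [e]
        exact Submodule.subset_span ⟨k, hk, rfl⟩
    have happrox : ∀ ε > 0, ∃ y ∈ Submodule.span ℝ B₁, N (R x - y) < ε := by
      intro ε hε
      have hx' : x ∈ closedSpan N (Set.range φ.unitVec) := by rw [hbasis]; trivial
      obtain ⟨y, hy, hxy⟩ := hx' ε hε
      refine ⟨R y, hRspan y hy, ?_⟩
      rw [← map_sub]
      exact (hR _).trans_lt hxy
    have hRF : R x ∈ F := hclosed B₁ (Set.subset_union_left.trans hBF) happrox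
    have hV : φ.restr J x ∈ F.comap (φ.extend J) := by
      rw [Submodule.mem_comap]
      have e : φ.extend J (φ.restr J x) = x - R x := by
        rw [eq_sub_iff_add_eq, add_comm]
        exact (hsplit x).symm
      rw [e]
      exact F.sub_mem hx hRF
    intro ε hε
    obtain ⟨y, hy, hxy⟩ := happrox ε hε
    refine ⟨y + φ.extend J (φ.restr J x), Submodule.add_mem _
      (Submodule.span_mono Set.subset_union_left hy) ?_, ?_⟩
    · have h := Submodule.mem_map_of_mem (f := φ.extend J) (hVB₀ hV)
      rw [Submodule.map_span] at h
      exact Submodule.span_mono Set.subset_union_right h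
    · have e : x - (y + φ.extend J (φ.restr J x)) = R x - y := by
        nth_rewrite 1 [hsplit x]
        abel
      rwa [e]

end Assembly

end OrliczFunction

end

theorem mainTheorem5 {ι : Type*} [Countable ι] (φ : OrliczFunction)
    (hφ : ∀ p : ℝ≥0∞, 1 ≤ p → ¬ φ.EquivalentToPow p)
    -- `N` is the Luxemburg norm or the Orlicz norm; in the second case, if the space is
    -- finite-dimensional, the complementary function `φ*` is finite-valued
    (N : φ.space ι → ℝ)
    (hN : N = φ.luxemburgNorm ∨
      (N = φ.orliczNorm ∧ (Finite ι → ∀ u : ℝ, φ.conj u < ∞)))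
    -- the unit vectors form a basis of `ℓ_φ`
    (hbasis : OrliczFunction.closedSpan N (Set.range φ.unitVec) = Set.univ)
    (n : ℕ) (F : Submodule ℝ (φ.space ι))
    (hcodim : Module.rank ℝ (φ.space ι ⧸ F) = n)
    (hdim : 1 < Module.rank ℝ F)
    (hmem : ∃ i : ι, φ.unitVec i ∈ F) :
    OrliczFunction.IsOneComplemented N F ↔
      ∃ B : Set (φ.space ι), OrliczFunction.IsConstCoeffBlockBasis B ∧
        (F : Set (φ.space ι)) = OrliczFunction.closedSpan N B := by
  constructor
  · rintro ⟨P, hPP, hrange, hP⟩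
    obtain ⟨i₀, hi₀⟩ := hmem
    have hPF : ∀ f ∈ F, P f = f := by
      intro f hf
      rw [← hrange] at hf
      obtain ⟨x, rfl⟩ := hf
      exact LinearMap.congr_fun hPP x
    exact OrliczFunction.exists_isConstCoeffBlockBasis hcodim hrange hPF hφ hN hP hi₀ hbasis
  · rintro ⟨B, hB, hF⟩
    have hsym : OrliczFunction.IsSymmetricNorm N := by
      rcases hN with rfl | ⟨rfl, -⟩
      · exact OrliczFunction.isSymmetricNorm_luxemburgNorm
      · exact OrliczFunction.isSymmetricNorm_orliczNorm
    exact hsym.isOneComplemented_of_isConstCoeffBlockBasis hbasis hB hF
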